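/- **Construction.** For a totally ordered abelian group $\mathcal G$ of monomials (written multiplicatively, with order $\gg$), let $S(\mathcal G)$ be the ordered algebra of finitely generated formal series with real coefficients $\sum_{\mathbf k\ge\mathbf k_0}c_{\mathbf k}\mu_1^{k_1}\cdots\mu_M^{k_M}$, where $M\in\mathbb N$, $\mathbf k_0\in\mathbb Z^M$, $\mu_i\in\mathcal G$, $\mu_i\ll1$; a nonzero series with dominant (i.e. $\gg$-largest) term $\mathrm{dom}(T)=c\,\mathrm{mag}(T)$, $c\in\mathbb R\setminus\{0\}$, $\mathrm{mag}(T)\in\mathcal G$, is positive iff $c>0$. Let $\mathcal G^{[0]}=\{x^\sigma:\sigma\in\mathbb R\}$ with $x^{\sigma_1}\gg x^{\sigma_2}$ iff $\sigma_1>\sigma_2$, $\mathcal T^{[n]}=S(\mathcal G^{[n]})$, and $\mathcal G^{[n+1]}=\{x^\sigma e^{L}\}$ with $\sigma\in\mathbb R$ and $L\in\mathcal T^{[n]}$ having only monomials $\gg1$, where $x^{\sigma_1}e^{L_1}\gg x^{\sigma_2}e^{L_2}$ iff $L_1>L_2$, or $L_1=L_2$ and $\sigma_1>\sigma_2$. The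 log-free transseries are the elements of $\bigcup_n\mathcal T^{[n]}$, with the natural inclusions $\mathcal T^{[n]}\subset\mathcal T^{[n+1]}$. On log-free transseries the derivative $\mathcal D$ is taken term by term, from $\mathcal D x^\sigma=\sigma x^{\sigma-1}$ and, inductively, $\mathcal D(x^\sigma e^L)=(\sigma x^{-1}+\mathcal DL)\,x^\sigma e^L$. Powers and exponentials are given by $(c\,\mathfrak m(1+s))^\sigma=c^\sigma\mathfrak m^\sigma\sum_{k\ge 0}\binom{\sigma}{k}s^k$ for $c>0$, $\mathfrak m$ a monomial and $s\ll1$, and by $e^{L+C+s}=e^C e^L\sum_{k\ge 0} s^k/k!$ for $L$ with only monomials $\gg1$, $C\in\mathbb R$ and $s\ll1$. If $\mathrm{mag}(g)\gg1$ and $\mathrm{dom}(g)>0$, then $f\circ g$ is taken term by term, from $x^\sigma\circ g=g^\sigma$ and, inductively, $(x^\sigma e^L)\circ g=g^\sigma e^{L\circ g}$. Let $L_p$ be the $p$-fold iterated logarithm, with $L_0=x$. The space $\mathcal T$ of general transseries is the set of formal compositions $f\circ L_p$ ($f$ log-free, $p\in\mathbb N$), where $f\circ L_p$ is identified with $(f\circ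 e^x)\circ L_{p+1}$. Algebraic operations and order on $\mathcal T$ are those of log-free transseries after two elements are brought to the form $f\circ L_p$, $g\circ L_p$ with the same $p$, and $\mathcal D(f\circ L_p)=\bigl(\prod_{k=0}^{p-1}L_k\bigr)^{-1}(\mathcal Df)\circ L_p$. Further, $\exp(f\circ L_p)=(\exp f)\circ L_p$, and $L_p\circ B$ is the element of $\mathcal T$ whose $p$-fold exponential is $B$. If $L_p\circ B=g\circ L_q$ with $g$ log-free, $\mathrm{mag}(g)\gg1$ and $\mathrm{dom}(g)>0$, then $(f\circ L_p)\circ B:=(f\circ g)\circ L_q$. **Proposition.** With these operations, which are well defined, $\mathcal T$ is an ordered differential field. It is closed under restricted composition: for all $A,B\in\mathcal T$ such that $B=g\circ L_q$ with $g$ log-free, $\mathrm{mag}(g)\gg1$ and $\mathrm{dom}(g)>0$, the composition $A\circ B$ exists in $\mathcal T$ and is unique. -/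

import Mathlib

noncomputable section

namespace Transseries

/-! ### Grids and finitely generated series

Groups of transmonomials are written additively, through their valuation: a monomial `𝔪` is
represented by an element `v` of a totally ordered abelian group `V`, products of monomials are sums
of elements, real powers are multiplication by real scalars, and `𝔪₁ ≫ 𝔪₂` means `v₁ < v₂`. Thus the
monomials `𝔪 ≪ 1` are the elements `v > 0`, the monomials `𝔪 ≫ 1` are the elements `v < 0`, and a
formal series of monomials with a largest term is a Hahn series over `V`. -/

/-- A totally ordered abelian group with multiplication by real scalars. -/
structure OrdVec : Type 1 where
  carrier : Type
  [acg : AddCommGroup carrier]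
  [mod : Module ℝ carrier]
  [lo : LinearOrder carrier]
  [ioam : IsOrderedAddMonoid carrier]

instance : CoeSort OrdVec Type := ⟨OrdVec.carrier⟩
instance (V : OrdVec) : AddCommGroup V := V.acg
instance (V : OrdVec) : Module ℝ V := V.mod
instance (V : OrdVec) : LinearOrder V := V.lo
instance (V : OrdVec) : IsOrderedAddMonoid V := V.ioam

/-- `S` is contained in `{μ₁^k₁ ⋯ μ_M^k_M : k ≥ k₀}` for some `M ∈ ℕ`, some monomials
`μ₁, …, μ_M ≪ 1` and some `k₀ ∈ ℤ^M`. -/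
def IsGrid {V : OrdVec} (S : Set V) : Prop :=
  ∃ (M : ℕ) (μ : Fin M → V) (k₀ : Fin M → ℤ), (∀ i, 0 < μ i) ∧
    ∀ v ∈ S, ∃ k : Fin M → ℤ, k₀ ≤ k ∧ v = ∑ i, k i • μ i

theorem IsGrid.mono {V : OrdVec} {S T : Set V} (hT : IsGrid T) (h : S ⊆ T) : IsGrid S := by
  obtain ⟨M, μ, k₀, hμ, H⟩ := hT
  exact ⟨M, μ, k₀, hμ, fun v hv => H v (h hv)⟩

theorem IsGrid.zero {V : OrdVec} : IsGrid ({0} : Set V) :=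
  ⟨0, Fin.elim0, Fin.elim0, fun i => i.elim0, fun v hv => ⟨Fin.elim0, fun i => i.elim0, by
    simpa using hv⟩⟩

theorem IsGrid.union {V : OrdVec} {S T : Set V} (hS : IsGrid S) (hT : IsGrid T) :
    IsGrid (S ∪ T) := by
  obtain ⟨M, μ, k₀, hμ, H⟩ := hS
  obtain ⟨N, ν, l₀, hν, K⟩ := hT
  refine ⟨M + N, Fin.append μ ν, Fin.append (k₀ ⊓ 0) (l₀ ⊓ 0), ?_, ?_⟩
  · intro i
    refine Fin.addCases (fun i => ?_) (fun i => ?_) i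
    · simpa using hμ i
    · simpa using hν i
  · rintro v (hv | hv)
    · obtain ⟨k, hk, rfl⟩ := H v hv
      refine ⟨Fin.append k 0, fun i => ?_, by simp [Fin.sum_univ_add]⟩
      refine Fin.addCases (fun i => ?_) (fun i => ?_) i
      · simpa using Or.inl (hk i)
      · simp
    · obtain ⟨k, hk, rfl⟩ := K v hv
      refine ⟨Fin.append 0 k, fun i => ?_, by simp [Fin.sum_univ_add]⟩
      refine Fin.addCases (fun i => ?_) (fun i => ?_) i
      · simp
      · simpa using Or.inl (hk i)

theorem IsGrid.add {V : OrdVec} {S T U : Set V} (hS : IsGrid S) (hT : IsGrid T)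
    (hU : ∀ u ∈ U, ∃ s ∈ S, ∃ t ∈ T, s + t = u) : IsGrid U := by
  obtain ⟨M, μ, k₀, hμ, H⟩ := hS
  obtain ⟨N, ν, l₀, hν, K⟩ := hT
  refine ⟨M + N, Fin.append μ ν, Fin.append k₀ l₀, ?_, ?_⟩
  · intro i
    refine Fin.addCases (fun i => ?_) (fun i => ?_) i
    · simpa using hμ i
    · simpa using hν i
  · intro u hu
    obtain ⟨s, hs, t, ht, rfl⟩ := hU u hu
    obtain ⟨k, hk, rfl⟩ := H s hs
    obtain ⟨l, hl, rfl⟩ := K t ht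
    refine ⟨Fin.append k l, fun i => ?_, by simp [Fin.sum_univ_add]⟩
    refine Fin.addCases (fun i => ?_) (fun i => ?_) i
    · simpa using hk i
    · simpa using hl i

/-- The algebra of finitely generated formal series with real coefficients over a group of
monomials. -/
def gridSeries (V : OrdVec) : Subalgebra ℝ (HahnSeries V ℝ) where
  carrier := {f | IsGrid f.support}
  mul_mem' := by
    intro f g hf hg
    refine IsGrid.add hf hg fun u hu => ?_
    obtain ⟨s, hs, t, ht, h⟩ := HahnSeries.support_mul_subset hu
    exact ⟨s, hs, t, ht, h⟩
  add_mem' := by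
    intro f g hf hg
    exact (IsGrid.union hf hg).mono (HahnSeries.support_add_subset f g)
  algebraMap_mem' := by
    intro r
    refine IsGrid.zero.mono ?_
    rw [← HahnSeries.C_eq_algebraMap]
    exact HahnSeries.support_single_subset

/-- The large series: every monomial that occurs is `≫ 1`. -/
def largeSeries (V : OrdVec) : Submodule ℝ (Lex (HahnSeries V ℝ)) where
  carrier := {f | ofLex f ∈ gridSeries V ∧ ∀ v, (ofLex f).coeff v ≠ 0 → v < 0}
  zero_mem' := ⟨(gridSeries V).zero_mem, fun v h => absurd rfl h⟩
  add_mem' := by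
    rintro f g ⟨hf, hf'⟩ ⟨hg, hg'⟩
    refine ⟨(gridSeries V).add_mem hf hg, fun v hv => ?_⟩
    by_cases h : (ofLex f).coeff v = 0
    · exact hg' v fun h' => hv (by
        change (ofLex f).coeff v + (ofLex g).coeff v = 0
        rw [h, h', add_zero])
    · exact hf' v h
  smul_mem' := by
    rintro c f ⟨hf, hf'⟩
    refine ⟨(gridSeries V).smul_mem hf c, fun v hv => hf' v fun h => hv ?_⟩
    change c • (ofLex f).coeff v = 0
    rw [h, smul_zero]

/-- A family of series is summable with sum `S` when all the series are supported in one grid and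
every monomial occurs in finitely many of them (so that the partial sums converge in the asymptotic
topology), and the coefficients of `S` are the sums of the coefficients. -/
def HasGridSum {V : OrdVec} {ι : Type} (F : ι → HahnSeries V ℝ) (S : HahnSeries V ℝ) : Prop :=
  IsGrid (⋃ i, (F i).support) ∧ (∀ v, {i | (F i).coeff v ≠ 0}.Finite) ∧
    ∀ v, S.coeff v = ∑ᶠ i, (F i).coeff v

/-! ### Transmonomials -/

/-- The group of the monomials `x^(-σ) exp(-L)`, with `σ` real and `L` large, represented by the pairs
`(L, σ)`. The order is lexicographic: `x^(-σ₁) exp(-L₁) ≫ x^(-σ₂) exp(-L₂)` iff `L₁ < L₂`, or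
`L₁ = L₂` and `σ₁ < σ₂`. Here `L₁ < L₂` means that the leading coefficient of `L₂ - L₁` is
positive. -/
def expMonomials (V : OrdVec) : OrdVec where
  carrier := largeSeries V ×ₗ ℝ

/-- The monomial `x^(-σ) exp(-L)`. -/
def mono {V : OrdVec} (L : largeSeries V) (σ : ℝ) : expMonomials V := toLex (L, σ)

/-- `L` for the monomial `x^(-σ) exp(-L)`. -/
def largePart {V : OrdVec} (γ : expMonomials V) : largeSeries V := (ofLex γ).1

/-- `σ` for the monomial `x^(-σ) exp(-L)`. -/
def xExponent {V : OrdVec} (γ : expMonomials V) : ℝ := (ofLex γ).2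

/-- A large series as a finitely generated series. -/
def largeSeries.toGrid {V : OrdVec} (L : largeSeries V) : gridSeries V := ⟨ofLex L.1, L.2.1⟩

/-- The real line, `σ` representing the monomial `x^(-σ)`. -/
def powerMonomials : OrdVec where
  carrier := ℝ

/-- The group of transmonomials of level at most `n`. -/
def G : ℕ → OrdVec
  | 0 => powerMonomials
  | n + 1 => expMonomials (G n)

/-- The log-free transseries of level at most `n`. -/
abbrev T (n : ℕ) : Type := gridSeries (G n)

/-- The monomial `x^(-σ)` of level `0`. -/
def G.pow (σ : ℝ) : G 0 := σ

/-- `σ` for the monomial `x^(-σ)` of level `0`. -/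
def G.powExponent (γ : G 0) : ℝ := γ

/-- The monomial `x^(-σ) exp(-L)` of level at most `n + 1`. -/
def G.mono {n : ℕ} (L : largeSeries (G n)) (σ : ℝ) : G (n + 1) := Transseries.mono L σ

/-- `L` for the monomial `x^(-σ) exp(-L)` of level at most `n + 1`. -/
def G.largePart {n : ℕ} (γ : G (n + 1)) : largeSeries (G n) :=
  Transseries.largePart (V := G n) γ

/-- `σ` for the monomial `x^(-σ) exp(-L)` of level at most `n + 1`. -/
def G.xExponent {n : ℕ} (γ : G (n + 1)) : ℝ := Transseries.xExponent (V := G n) γ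

/-! ### The embedding of level `n` into level `n + 1` -/

/-- Embeddings of groups of monomials. -/
structure MonoEmb (V W : OrdVec) extends V →ₗ[ℝ] W where
  strictMono : StrictMono toFun

def MonoEmb.toOrderEmb {V W : OrdVec} (φ : MonoEmb V W) : V ↪o W :=
  OrderEmbedding.ofStrictMono φ.toFun φ.strictMono

/-- The action of an embedding of monomials on series, term by term. -/
def MonoEmb.mapSeries {V W : OrdVec} (φ : MonoEmb V W) (f : HahnSeries V ℝ) : HahnSeries W ℝ :=
  HahnSeries.embDomain φ.toOrderEmb f

theorem MonoEmb.mapSeries_mem {V W : OrdVec} (φ : MonoEmb V W) {f : HahnSeries V ℝ}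
    (hf : f ∈ gridSeries V) : φ.mapSeries f ∈ gridSeries W := by
  obtain ⟨M, μ, k₀, hμ, H⟩ := hf
  refine ⟨M, fun i => φ.toLinearMap (μ i), k₀, fun i => ?_, fun w hw => ?_⟩
  · have := φ.strictMono (hμ i)
    change φ.toLinearMap 0 < φ.toLinearMap (μ i) at this
    rwa [map_zero] at this
  · obtain ⟨v, hv, rfl⟩ := HahnSeries.support_embDomain_subset hw
    obtain ⟨k, hk, rfl⟩ := H v hv
    refine ⟨k, hk, ?_⟩
    change φ.toLinearMap _ = _
    simp only [map_sum, map_zsmul]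

/-- The action on large series. -/
def MonoEmb.mapLarge {V W : OrdVec} (φ : MonoEmb V W) (L : largeSeries V) : largeSeries W :=
  ⟨toLex (φ.mapSeries (ofLex L.1)), φ.mapSeries_mem L.2.1, fun w hw => by
    obtain ⟨v, hv, rfl⟩ := HahnSeries.support_embDomain_subset hw
    have := φ.strictMono (L.2.2 v hv)
    change φ.toLinearMap v < φ.toLinearMap 0 at this
    rwa [map_zero] at this⟩

theorem MonoEmb.mapLarge_strictMono {V W : OrdVec} (φ : MonoEmb V W) :
    StrictMono φ.mapLarge := fun a b h =>
  (HahnSeries.embDomainOrderEmbedding φ.toOrderEmb (R := ℝ)).strictMono (a := a.1) (b := b.1) h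

/-- `x^(-σ) ↦ x^(-σ)`. -/
def powerEmb (V : OrdVec) : MonoEmb powerMonomials (expMonomials V) where
  toFun σ := mono 0 σ
  map_add' a b := by
    change toLex ((0 : largeSeries V), a + b) = toLex ((0 : largeSeries V) + 0, a + b)
    rw [add_zero]
  map_smul' c a := by
    change toLex ((0 : largeSeries V), c • a) = toLex (c • (0 : largeSeries V), c • a)
    rw [smul_zero]
  strictMono := fun a b h => Prod.Lex.toLex_lt_toLex.2 (Or.inr ⟨rfl, h⟩)

/-- `x^(-σ) exp(-L) ↦ x^(-σ) exp(-φ(L))`. -/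
def MonoEmb.exp {V W : OrdVec} (φ : MonoEmb V W) :
    MonoEmb (expMonomials V) (expMonomials W) where
  toFun γ := mono (φ.mapLarge (largePart γ)) (xExponent γ)
  map_add' a b := by
    refine congrArg toLex (Prod.ext (Subtype.ext ?_) rfl)
    exact HahnSeries.embDomain_add φ.toOrderEmb (ofLex (largePart a).1) (ofLex (largePart b).1)
  map_smul' c a := by
    refine congrArg toLex (Prod.ext (Subtype.ext ?_) rfl)
    exact HahnSeries.embDomain_smul φ.toOrderEmb c (ofLex (largePart a).1)
  strictMono := fun a b h => by
    have h : toLex ((largePart a, xExponent a) : largeSeries V × ℝ) <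
        toLex ((largePart b, xExponent b) : largeSeries V × ℝ) := h
    rcases Prod.Lex.toLex_lt_toLex.1 h with h | ⟨h, h'⟩
    · exact Prod.Lex.toLex_lt_toLex.2 (Or.inl (φ.mapLarge_strictMono h))
    · exact Prod.Lex.toLex_lt_toLex.2 (Or.inr ⟨congrArg φ.mapLarge h, h'⟩)

/-- The inclusion of the transmonomials of level at most `n` in those of level at most `n + 1`. -/
def incl : (n : ℕ) → MonoEmb (G n) (G (n + 1))
  | 0 => powerEmb powerMonomials
  | n + 1 => (incl n).exp

/-- The inclusion of level at most `n` in level at most `n + 1`. -/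
def T.lift {n : ℕ} (f : T n) : T (n + 1) :=
  ⟨(incl n).mapSeries f.1, (incl n).mapSeries_mem f.2⟩

/-- The inclusion of level at most `m` in level at most `m + n`. -/
def liftSeries (m : ℕ) : (n : ℕ) → HahnSeries (G m) ℝ → HahnSeries (G (m + n)) ℝ
  | 0, f => f
  | n + 1, f => (incl (m + n)).mapSeries (liftSeries m n f)

/-! ### Differentiation of log-free transseries -/

/-- The element that represents the monomial `x^(-σ)` in level `n`. -/
def xMono : (n : ℕ) → ℝ → G n
  | 0, σ => G.pow σ
  | _ + 1, σ => G.mono 0 σ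

/-- `IsDeriv n f g`: `g` is the derivative of the transseries `f` of level at most `n`, obtained by
term by term differentiation from `D x^(-σ) = -σ x^(-σ) x^(-1)` and, inductively,
`D (x^(-σ) exp(-L)) = x^(-σ) exp(-L) (-σ x^(-1) - D L)`. -/
def IsDeriv : (n : ℕ) → T n → T n → Prop
  | 0, f, g => HasGridSum
      (fun γ : G 0 => f.1.coeff γ • (HahnSeries.single γ (1 : ℝ) *
        HahnSeries.single (xMono 0 1) (-G.powExponent γ))) g.1
  | n + 1, f, g => ∃ d : G (n + 1) → T n,
      (∀ γ, IsDeriv n (largeSeries.toGrid (G.largePart γ)) (d γ)) ∧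
      HasGridSum
        (fun γ : G (n + 1) => f.1.coeff γ • (HahnSeries.single γ (1 : ℝ) *
          (HahnSeries.single (xMono (n + 1) 1) (-G.xExponent γ) - (T.lift (d γ)).1))) g.1

/-! ### Powers, exponentials and restricted composition of log-free transseries -/

/-- `f / dom(f)`. -/
def normalized {V : OrdVec} (f : HahnSeries V ℝ) : HahnSeries V ℝ :=
  HahnSeries.single (-f.order) f.leadingCoeff⁻¹ * f

/-- The real power `f^σ = c^σ 𝔪^σ ∑ (σ choose k) s^k` of `f = c 𝔪 (1 + s)`, with `c > 0`, `𝔪 = mag(f)`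
and `s ≪ 1`. -/
def rpow {V : OrdVec} (f : HahnSeries V ℝ) (σ : ℝ) : HahnSeries V ℝ :=
  HahnSeries.single (σ • f.order) (f.leadingCoeff ^ σ) *
    PowerSeries.heval (normalized f - 1) (PowerSeries.binomialSeries ℝ σ)

/-- The restriction of a series to the monomials in a set `s`. -/
def restrict {V : OrdVec} (f : HahnSeries V ℝ) (s : Set V) : HahnSeries V ℝ where
  coeff := s.indicator f.coeff
  isPWO_support' := f.isPWO_support.mono fun _ hv h => hv (Set.indicator_apply_eq_zero.2 fun _ => h)

/-- The large part `L(f)`, made of the terms of `f` whose monomial is `≫ 1`. -/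
def largeTerms {V : OrdVec} (f : gridSeries V) : largeSeries V :=
  ⟨toLex (restrict f.1 (Set.Iio 0)),
    IsGrid.mono f.2 fun _ hv h => hv (Set.indicator_apply_eq_zero.2 fun _ => h),
    fun v hv => by
      by_contra h
      exact hv (Set.indicator_of_notMem (s := Set.Iio (0 : V)) h _)⟩

/-- The small part `s(f)`, made of the terms of `f` whose monomial is `≪ 1`. -/
def smallTerms {V : OrdVec} (f : HahnSeries V ℝ) : HahnSeries V ℝ := restrict f (Set.Ioi 0)

/-- The exponential of `f`: `e^C exp(L) ∑ s^k / k!`, where `f = L + C + s` with `L` large, `C` constant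
and `s` small. -/
def expSeries {n : ℕ} (f : T n) : HahnSeries (G (n + 1)) ℝ :=
  HahnSeries.single (G.mono (-largeTerms f) 0) (Real.exp (f.1.coeff 0)) *
    PowerSeries.heval ((incl n).mapSeries (smallTerms f.1)) (PowerSeries.exp ℝ)

/-- `h = exp f`. -/
def IsExp {n : ℕ} (f : T n) (h : T (n + 1)) : Prop := h.1 = expSeries f

/-- `mag(g) ≫ 1` and `dom(g) > 0`. -/
def LargePos {n : ℕ} (g : T n) : Prop := g.1.order < 0 ∧ 0 < g.1.leadingCoeff

/-- `IsComp n m f g h`: `h = f ∘ g`, for `f` of level at most `n` and `g` of level at most `m`. The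
composition is taken term by term, from `x^(-σ) ∘ g = g^(-σ)` and, inductively,
`(x^(-σ) exp(-L)) ∘ g = g^(-σ) exp(-(L ∘ g))`. -/
def IsComp : (n m : ℕ) → T n → T m → T (m + n) → Prop
  | 0, _, f, g, h => HasGridSum
      (fun γ : G 0 => f.1.coeff γ • rpow g.1 (-G.powExponent γ)) h.1
  | n + 1, m, f, g, h => ∃ c : G (n + 1) → T (m + n),
      (∀ γ, IsComp n m (largeSeries.toGrid (G.largePart γ)) g (c γ)) ∧
      HasGridSum
        (fun γ : G (n + 1) => f.1.coeff γ •
          (liftSeries m (n + 1) (rpow g.1 (-G.xExponent γ)) * expSeries (-c γ))) h.1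

/-! ### General transseries -/

theorem single_mem {V : OrdVec} (v : V) (c : ℝ) : HahnSeries.single v c ∈ gridSeries V := by
  have h1 : IsGrid ({v} : Set V) := by
    rcases lt_trichotomy v 0 with h | h | h
    · exact ⟨1, fun _ => -v, fun _ => -1, fun _ => neg_pos.2 h, fun w hw =>
        ⟨fun _ => -1, le_rfl, by simpa using hw⟩⟩
    · subst h
      exact IsGrid.zero
    · exact ⟨1, fun _ => v, fun _ => 1, fun _ => h, fun w hw => ⟨fun _ => 1, le_rfl, by
        simpa using hw⟩⟩
  exact h1.mono HahnSeries.support_single_subset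

/-- The transseries `x`. -/
def X : T 0 := ⟨HahnSeries.single (xMono 0 (-1)) 1, single_mem _ _⟩

/-- The large transseries `x`. -/
def XLarge : largeSeries (G 0) :=
  ⟨toLex X.1, X.2, fun v hv => by
    have h : v = xMono 0 (-1) := by
      by_contra h
      exact hv (HahnSeries.coeff_single_of_ne h)
    subst h
    exact neg_one_lt_zero (R := ℝ)⟩

/-- The transseries `exp x`. -/
def expX : T 1 := ⟨HahnSeries.single (G.mono (-XLarge) 0) 1, single_mem _ _⟩

/-- The formal composition `f ∘ L_p` of a log-free transseries `f` of level at most `n` with the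
`p`-fold iterated logarithm `L_p`. -/
structure FormalComp where
  n : ℕ
  p : ℕ
  f : T n

/-- The identifications between formal compositions: a transseries of level at most `n` has level at
most `n + 1`, and `f ∘ L_p = (f ∘ exp) ∘ L_(p+1)`. -/
inductive FormalComp.Ident : FormalComp → FormalComp → Prop
  | lift (n p : ℕ) (f : T n) : Ident ⟨n, p, f⟩ ⟨n + 1, p, T.lift f⟩
  | log (n p : ℕ) (f : T n) (g : T (1 + n)) (h : IsComp n 1 f expX g) :
      Ident ⟨n, p, f⟩ ⟨1 + n, p + 1, g⟩

/-- The space of general transseries. -/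
def GeneralTransseries : Type := Quot FormalComp.Ident

/-- The general transseries `f ∘ L_p`. -/
def compLog (n p : ℕ) (f : T n) : GeneralTransseries := Quot.mk _ ⟨n, p, f⟩

/-- The iterated logarithm `L_k`. -/
def iterLog (k : ℕ) : GeneralTransseries := compLog 0 k X

/-- `IsGenExp Y Z`: `Z = exp Y`, where `exp (f ∘ L_p) = (exp f) ∘ L_p`. -/
inductive IsGenExp : GeneralTransseries → GeneralTransseries → Prop
  | mk (n p : ℕ) (f : T n) (h : T (n + 1)) (hfh : IsExp f h) :
      IsGenExp (compLog n p f) (compLog (n + 1) p h)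

/-- `IsIterLog p B Y`: `Y = L_p ∘ B`, that is, `B` is the `p`-fold iterated exponential of `Y`. -/
def IsIterLog : ℕ → GeneralTransseries → GeneralTransseries → Prop
  | 0, B, Y => Y = B
  | p + 1, B, Y => ∃ Z, IsIterLog p B Z ∧ IsGenExp Y Z

/-- `IsGenComp A B C`: `C = A ∘ B`. If `A = f ∘ L_p` and `L_p ∘ B = g ∘ L_q`, with `f` and `g` log-free,
`mag(g) ≫ 1` and `dom(g) > 0`, then `A ∘ B = (f ∘ g) ∘ L_q`. -/
inductive IsGenComp : GeneralTransseries → GeneralTransseries → GeneralTransseries → Prop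
  | mk (n p : ℕ) (f : T n) (B : GeneralTransseries) (m q : ℕ) (g : T m) (c : T (m + n))
      (hB : IsIterLog p B (compLog m q g)) (hg : LargePos g) (hc : IsComp n m f g c) :
      IsGenComp (compLog n p f) B (compLog (m + n) q c)

end Transseries

end

open Transseries

noncomputable section

namespace Transseries

/-! ### Grids -/

/-! The groups `G n` are glued into one ordered group `TM` of all log-free transmonomials, their
direct limit. Composition with exp acts on it by an order embedding `E`, and the direct limit `KM`
of `TM` along `E` is the group of all transmonomials. A general transseries f ∘ L_p thus becomes a
Hahn series over `KM`, and `val_injective` shows that the identifications in the quotient are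
exactly those made by the direct limits. So the space is a subset of a field of Hahn series, closed
under the operations (inverses are grid-based by `isGrid_inv`), and it inherits the field structure
and the order.

The operations defined term by term rest on summability theorems for grids. For composition,
`IsSubst.gridSummable` extends a multiplicative map from monomials to positive series, provided that
small monomials go to small series. That 𝔪 ↦ 𝔪 ∘ g has this property is proved in `comp_spec` by
induction on the level. The danger is that in g^(-σ) exp(-(L ∘ g)) the power of g outweighs the
exponential. It cannot, because a monomial x^(-σ) exp(-L) ≫ 1 exceeds every monomial of L
(`expM_lt_of_mem`), so that the images of large monomials dominate the exponent in mag(g).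

For the derivative, D𝔪 = 𝔪 · δ(𝔪) with δ additive. Additivity bounds the supports of all δ(𝔪) for 𝔪
in a grid by finitely many of them (`tame_deriv`), the extension is strongly additive, and the
Leibniz rule passes from monomials to series (`extend_deriv_mul`).

The relations `IsComp`, `IsExp` and `IsDeriv`, stated level by level, become equations between
series over `TM` (`isComp_iff`, `isExp_iff`, `isDeriv_iff`). This needs summability to be reflected
by embeddings, hence that grids pull back (`IsGrid.preimage`). Independence of representatives then
comes down to D(f ∘ exp) = exp x · (Df ∘ exp) (`deriv_E`), (f ∘ g) ∘ exp = f ∘ (g ∘ exp) (`E_circ`)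
and (f ∘ exp) ∘ g = f ∘ exp g (`circ_E`). Iterated logarithms exist because every large positive g
has a logarithm after composition with exp (`exists_texp_eq`). -/

theorem isGrid_singleton {V : OrdVec} (b : V) : IsGrid ({b} : Set V) := by
  have h := single_mem b (1 : ℝ)
  change IsGrid (HahnSeries.single b (1 : ℝ)).support at h
  rwa [HahnSeries.support_single_of_ne one_ne_zero] at h

theorem isGrid_closure {V : OrdVec} {F : Set V} (hF : F.Finite) (h : ∀ v ∈ F, 0 < v) :
    IsGrid (AddSubmonoid.closure F : Set V) := by
  obtain ⟨M, μ, rfl⟩ := hF.fin_embedding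
  refine ⟨M, μ, 0, fun i => h _ ⟨i, rfl⟩, fun v hv => ?_⟩
  obtain ⟨a, rfl⟩ := AddSubmonoid.mem_closure_range_iff_of_fintype.1 hv
  exact ⟨fun i => (a i : ℤ), fun i => by simp, by simp⟩

theorem isGrid_of_mem_closure {V : OrdVec} {S F : Set V} (b : V) (hF : F.Finite)
    (h : ∀ v ∈ F, 0 < v) (hS : ∀ s ∈ S, ∃ t ∈ AddSubmonoid.closure F, s = b + t) : IsGrid S :=
  IsGrid.add (isGrid_singleton b) (isGrid_closure hF h) fun u hu => by
    obtain ⟨t, ht, rfl⟩ := hS u hu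
    exact ⟨b, rfl, t, ht, rfl⟩

/-- Moving the corner k₀ into a base point turns integer exponents into natural ones, so that
arguments about finitely generated monoids apply. -/
theorem IsGrid.exists_nat {V : OrdVec} {S : Set V} (hS : IsGrid S) :
    ∃ (M : ℕ) (μ : Fin M → V) (b : V), (∀ i, 0 < μ i) ∧
      ∀ s ∈ S, ∃ n : Fin M → ℕ, s = b + ∑ i, n i • μ i := by
  obtain ⟨M, μ, k₀, hμ, H⟩ := hS
  refine ⟨M, μ, ∑ i, k₀ i • μ i, hμ, fun s hs => ?_⟩
  obtain ⟨k, hk, rfl⟩ := H s hs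
  refine ⟨fun i => (k i - k₀ i).toNat, ?_⟩
  rw [← Finset.sum_add_distrib]
  refine Finset.sum_congr rfl fun i _ => ?_
  rw [← natCast_zsmul, Int.toNat_of_nonneg (sub_nonneg.2 (hk i)), ← add_smul]
  congr 1
  ring

/-- Since ℕ^M is well-quasi-ordered, the minimal elements of `K` form a finite antichain, and every
element of `K` lies above one of them. -/
theorem exists_finite_lower {M : ℕ} (K : Set (Fin M → ℕ)) :
    ∃ K₀ ⊆ K, K₀.Finite ∧ ∀ k ∈ K, ∃ k₀ ∈ K₀, k₀ ≤ k := by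
  have hK := Set.isPWO_of_wellQuasiOrderedLE K
  refine ⟨{k | Minimal (· ∈ K) k}, fun k hk => hk.1,
    (setOfPred_minimal_antichain _).finite_of_partiallyWellOrderedOn
      (Set.isPWO_of_wellQuasiOrderedLE _), fun k hk => ?_⟩
  obtain ⟨b, hb, hb'⟩ := hK.exists_le_minimal hk
  exact ⟨b, hb', hb⟩

/-- Dickson's lemma for grids: the base points can be chosen in the set itself. -/
theorem IsGrid.exists_base {V : OrdVec} {S : Set V} (hS : IsGrid S) :
    ∃ (B : Set V) (M : ℕ) (μ : Fin M → V), B ⊆ S ∧ B.Finite ∧ (∀ i, 0 < μ i) ∧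
      ∀ s ∈ S, ∃ b ∈ B, ∃ n : Fin M → ℕ, s = b + ∑ i, n i • μ i := by
  obtain ⟨M, μ, b, hμ, H⟩ := hS.exists_nat
  obtain ⟨K₀, hK, hfin, hle⟩ := exists_finite_lower {n : Fin M → ℕ | b + ∑ i, n i • μ i ∈ S}
  refine ⟨(fun n : Fin M → ℕ => b + ∑ i, n i • μ i) '' K₀, M, μ, ?_, hfin.image _, hμ, ?_⟩
  · rintro _ ⟨n, hn, rfl⟩
    exact hK hn
  · intro s hs
    obtain ⟨n, rfl⟩ := H s hs
    obtain ⟨k, hk, hkn⟩ := hle n hs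
    refine ⟨_, ⟨k, hk, rfl⟩, n - k, ?_⟩
    simp only [add_assoc, ← Finset.sum_add_distrib]
    congr 1
    refine Finset.sum_congr rfl fun i _ => ?_
    rw [← add_smul, Pi.sub_apply, Nat.add_sub_cancel' (hkn i)]

theorem sum_mem_closure {V : OrdVec} {M : ℕ} (μ : Fin M → V) (n : Fin M → ℕ) :
    ∑ i, n i • μ i ∈ AddSubmonoid.closure (Set.range μ) :=
  AddSubmonoid.mem_closure_range_iff_of_fintype.2 ⟨n, rfl⟩

/-- A grid of small monomials lies in a finitely generated monoid of small monomials. -/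
theorem IsGrid.subset_closure_of_pos {V : OrdVec} {S : Set V} (hS : IsGrid S)
    (h : ∀ s ∈ S, 0 < s) :
    ∃ F : Set V, F.Finite ∧ (∀ v ∈ F, 0 < v) ∧ S ⊆ AddSubmonoid.closure F := by
  -- The base points lie in `S`, hence are positive, so they can serve as generators themselves.
  obtain ⟨B, M, μ, hB, hfin, hμ, H⟩ := hS.exists_base
  refine ⟨B ∪ Set.range μ, hfin.union (Set.finite_range μ), ?_, fun s hs => ?_⟩
  · rintro v (hv | ⟨i, rfl⟩)
    exacts [h v (hB hv), hμ i]
  · obtain ⟨b, hb, n, rfl⟩ := H s hs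
    exact add_mem (AddSubmonoid.subset_closure (Or.inl hb))
      (AddSubmonoid.closure_mono Set.subset_union_right (sum_mem_closure μ n))

theorem closure_nonneg {V : OrdVec} {F : Set V} (h : ∀ v ∈ F, 0 < v) {t : V}
    (ht : t ∈ AddSubmonoid.closure F) : 0 ≤ t := by
  induction ht using AddSubmonoid.closure_induction with
  | mem x hx => exact (h x hx).le
  | zero => exact le_rfl
  | add x y _ _ hx hy => exact add_nonneg hx hy

theorem isPWO_closure {V : OrdVec} {F : Set V} (hF : F.Finite) (h : ∀ v ∈ F, 0 < v) :
    (AddSubmonoid.closure F : Set V).IsPWO :=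
  hF.isPWO.addSubmonoid_closure fun v hv => (h v hv).le

theorem IsGrid.isPWO {V : OrdVec} {S : Set V} (hS : IsGrid S) : S.IsPWO := by
  obtain ⟨M, μ, b, hμ, H⟩ := hS.exists_nat
  have h1 : (AddSubmonoid.closure (Set.range μ) : Set V).IsPWO :=
    isPWO_closure (Set.finite_range μ) (by rintro _ ⟨i, rfl⟩; exact hμ i)
  refine (h1.image_of_monotone (f := fun t => b + t) fun x y h => by simpa using h).mono ?_
  intro s hs
  obtain ⟨n, rfl⟩ := H s hs
  exact ⟨_, sum_mem_closure μ n, rfl⟩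

/-- A grid contained in the image of an embedding comes from a grid. -/
theorem IsGrid.preimage {V W : OrdVec} (φ : MonoEmb V W) {S : Set W} (hS : IsGrid S)
    (h : S ⊆ Set.range φ.toLinearMap) : IsGrid (φ.toLinearMap ⁻¹' S) := by
  obtain ⟨B, M, μ, hB, hfin, hμ, H⟩ := hS.exists_base
  have hinj : Function.Injective φ.toLinearMap := φ.strictMono.injective
  let lin : (Fin M → ℕ) →+ W :=
    { toFun := fun n => ∑ i, n i • μ i
      map_zero' := by simp
      map_add' := fun a b => by simp [add_smul, Finset.sum_add_distrib] }
  -- The exponent vectors whose value lies in the image of `φ` form a subtractive submonoid of ℕ^M: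
  -- it contains y as soon as it contains x and x + y. Such submonoids are finitely generated.
  obtain ⟨Gen, hGen, hGfin⟩ := (AddSubmonoid.fg_iff _).1
    (AddSubmonoid.fg_of_subtractive (P := (LinearMap.range φ.toLinearMap).toAddSubmonoid.comap lin)
      (by
        intro x hx y hxy
        change lin x ∈ LinearMap.range φ.toLinearMap at hx
        change lin (x + y) ∈ LinearMap.range φ.toLinearMap at hxy
        change lin y ∈ LinearMap.range φ.toLinearMap
        rw [map_add] at hxy
        exact (Submodule.add_mem_iff_right _ hx).1 hxy))
  -- A generator of value 0 is dropped, because it contributes nothing to a sum and the generators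
  -- of a grid must be positive.
  let F : Set V := {v | φ.toLinearMap v ∈ lin '' Gen ∧ 0 < v}
  have hF : F.Finite := ((hGfin.image lin).preimage hinj.injOn).subset fun v hv => hv.1
  have hlin : ∀ n, 0 ≤ lin n := fun n => by
    change 0 ≤ ∑ i, n i • μ i
    exact Finset.sum_nonneg fun i _ => nsmul_nonneg (hμ i).le _
  have hpos : ∀ v, 0 < φ.toLinearMap v → 0 < v := fun v hv => by
    have : φ.toLinearMap 0 < φ.toLinearMap v := by simpa using hv
    exact φ.strictMono.lt_iff_lt.1 this
  have key : ∀ n ∈ AddSubmonoid.closure Gen, ∃ v ∈ AddSubmonoid.closure F,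
      φ.toLinearMap v = lin n := by
    intro n hn
    induction hn using AddSubmonoid.closure_induction with
    | mem x hx =>
      have : x ∈ (LinearMap.range φ.toLinearMap).toAddSubmonoid.comap lin :=
        hGen ▸ AddSubmonoid.subset_closure hx
      obtain ⟨v, hv⟩ := this
      rcases (hlin x).eq_or_lt with h0 | h0
      · exact ⟨0, zero_mem _, by rw [map_zero, h0]⟩
      · exact ⟨v, AddSubmonoid.subset_closure ⟨⟨x, hx, hv.symm⟩, hpos v (hv ▸ h0)⟩, hv⟩
    | zero => exact ⟨0, zero_mem _, by simp⟩
    | add x y _ _ hx hy =>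
      obtain ⟨v, hv, hv'⟩ := hx
      obtain ⟨w, hw, hw'⟩ := hy
      exact ⟨v + w, add_mem hv hw, by rw [map_add, map_add, hv', hw']⟩
  have hgrid : IsGrid (φ.toLinearMap ⁻¹' B) := by
    have : (φ.toLinearMap ⁻¹' B).Finite := hfin.preimage hinj.injOn
    refine this.induction_on (motive := fun s _ => IsGrid s) _ (IsGrid.zero.mono (by simp)) ?_
    intro a s _ _ hs
    rw [Set.insert_eq]
    exact (isGrid_singleton a).union hs
  refine IsGrid.add hgrid (isGrid_closure hF fun v hv => hv.2) fun u hu => ?_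
  obtain ⟨b, hb, n, hn⟩ := H _ hu
  obtain ⟨b', rfl⟩ := h (hB hb)
  have hn' : n ∈ AddSubmonoid.closure Gen := by
    rw [hGen]
    refine ⟨u - b', ?_⟩
    rw [map_sub, hn]
    exact add_sub_cancel_left _ _
  obtain ⟨v, hv, hv'⟩ := key n hn'
  refine ⟨b', hb, v, hv, hinj ?_⟩
  rw [map_add, hv', hn]
  rfl

/-! ### Dominant terms -/

theorem order_leadingCoeff_of {V : OrdVec} {f : HahnSeries V ℝ} {v : V} (h : f.coeff v ≠ 0)
    (h' : ∀ w < v, f.coeff w = 0) : f.order = v ∧ f.leadingCoeff = f.coeff v := by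
  have h1 : f.order = v := by
    refine le_antisymm (HahnSeries.order_le_of_coeff_ne_zero h) (le_of_not_gt fun h2 => ?_)
    have := h' _ h2
    rw [HahnSeries.coeff_order_eq_zero] at this
    exact h (by simp [this])
  exact ⟨h1, by rw [HahnSeries.leadingCoeff_eq, h1]⟩

theorem orderTop_pos_iff {V : OrdVec} {f : HahnSeries V ℝ} :
    0 < f.orderTop ↔ ∀ v ∈ f.support, 0 < v := by
  rw [← not_le, ← not_iff_not, not_not]
  push Not
  constructor
  · intro h
    have hf : f ≠ 0 := by
      rintro rfl
      simp at h
    refine ⟨f.order, by simpa [HahnSeries.coeff_order_eq_zero] using hf, ?_⟩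
    rw [← HahnSeries.order_eq_orderTop_of_ne_zero hf] at h
    exact_mod_cast h
  · rintro ⟨v, hv, hv'⟩
    exact (HahnSeries.orderTop_le_of_coeff_ne_zero hv).trans (by exact_mod_cast hv')

theorem leadingCoeff_pos_ne_zero {V : OrdVec} {f : HahnSeries V ℝ} (h : 0 < f.leadingCoeff) :
    f ≠ 0 := HahnSeries.leadingCoeff_ne_zero.1 h.ne'

/-- This is the form dom(f)(1 + s): the positive elements of the support shifted by -`f.order` form
a grid of small monomials, and those have finitely many small generators. -/
theorem support_subset_order_add {V : OrdVec} {f : HahnSeries V ℝ} (hf : IsGrid f.support) :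
    ∃ F : Set V, F.Finite ∧ (∀ v ∈ F, 0 < v) ∧
      ∀ v ∈ f.support, ∃ t ∈ AddSubmonoid.closure F, v = f.order + t := by
  have h1 : IsGrid {u : V | 0 < u ∧ f.order + u ∈ f.support} :=
    IsGrid.add (isGrid_singleton (-f.order)) hf fun u hu => ⟨_, rfl, _, hu.2, by simp⟩
  obtain ⟨F, hF, hpos, hsub⟩ := h1.subset_closure_of_pos fun s hs => hs.1
  refine ⟨F, hF, hpos, fun v hv => ?_⟩
  rcases (HahnSeries.order_le_of_coeff_ne_zero hv).eq_or_lt with h | h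
  · exact ⟨0, zero_mem _, by rw [h, add_zero]⟩
  · exact ⟨v - f.order, hsub ⟨sub_pos.2 h, by simpa using hv⟩, by simp⟩

theorem exists_ne_zero_of_finsum_ne_zero {ι : Type} {a : ι → ℝ} (h : ∑ᶠ i, a i ≠ 0) :
    ∃ i, a i ≠ 0 := by
  by_contra h'
  push Not at h'
  exact h (finsum_eq_zero_of_forall_eq_zero h')

/-! ### Sums of families and extension of maps of monomials -/

/-- The sum of a family of series, taken coefficientwise. -/
def gsum {V : OrdVec} {ι : Type} (F : ι → HahnSeries V ℝ) : HahnSeries V ℝ :=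
  open Classical in
  if h : (⋃ i, (F i).support).IsPWO then
    { coeff := fun v => ∑ᶠ i, (F i).coeff v
      isPWO_support' := h.mono fun v hv => by
        obtain ⟨i, hi⟩ := exists_ne_zero_of_finsum_ne_zero hv
        exact Set.mem_iUnion.2 ⟨i, hi⟩ }
  else 0

/-- The part of `HasGridSum` that does not mention the sum. -/
def GridSummable {V : OrdVec} {ι : Type} (F : ι → HahnSeries V ℝ) : Prop :=
  IsGrid (⋃ i, (F i).support) ∧ ∀ v, {i | (F i).coeff v ≠ 0}.Finite

theorem GridSummable.hasGridSum {V : OrdVec} {ι : Type} {F : ι → HahnSeries V ℝ}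
    (h : GridSummable F) : HasGridSum F (gsum F) :=
  ⟨h.1, h.2, fun v => by rw [gsum, dif_pos h.1.isPWO]⟩

theorem HasGridSum.gridSummable {V : OrdVec} {ι : Type} {F : ι → HahnSeries V ℝ}
    {S : HahnSeries V ℝ} (h : HasGridSum F S) : GridSummable F := ⟨h.1, h.2.1⟩

theorem HasGridSum.unique {V : OrdVec} {ι : Type} {F : ι → HahnSeries V ℝ}
    {S S' : HahnSeries V ℝ} (h : HasGridSum F S) (h' : HasGridSum F S') : S = S' := by
  ext v
  rw [h.2.2, h'.2.2]

theorem HasGridSum.gsum_eq {V : OrdVec} {ι : Type} {F : ι → HahnSeries V ℝ}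
    {S : HahnSeries V ℝ} (h : HasGridSum F S) : gsum F = S :=
  h.gridSummable.hasGridSum.unique h

theorem HasGridSum.support_subset {V : OrdVec} {ι : Type} {F : ι → HahnSeries V ℝ}
    {S : HahnSeries V ℝ} (h : HasGridSum F S) : S.support ⊆ ⋃ i, (F i).support := by
  intro v hv
  rw [HahnSeries.mem_support, h.2.2] at hv
  obtain ⟨i, hi⟩ := exists_ne_zero_of_finsum_ne_zero hv
  exact Set.mem_iUnion.2 ⟨i, hi⟩

theorem HasGridSum.isGrid {V : OrdVec} {ι : Type} {F : ι → HahnSeries V ℝ}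
    {S : HahnSeries V ℝ} (h : HasGridSum F S) : IsGrid S.support :=
  h.1.mono h.support_subset

/-- The strongly linear extension of a map of monomials. -/
def extend {V W : OrdVec} (Φ : V → HahnSeries W ℝ) (f : HahnSeries V ℝ) : HahnSeries W ℝ :=
  gsum fun γ => f.coeff γ • Φ γ

/-! ### Embeddings -/

theorem MonoEmb.mapSeries_coeff {V W : OrdVec} (φ : MonoEmb V W) (f : HahnSeries V ℝ) (v : V) :
    (φ.mapSeries f).coeff (φ.toLinearMap v) = f.coeff v :=
  HahnSeries.embDomain_coeff (f := φ.toOrderEmb)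

theorem MonoEmb.mapSeries_coeff_of_notMem {V W : OrdVec} (φ : MonoEmb V W) (f : HahnSeries V ℝ)
    {w : W} (h : w ∉ Set.range φ.toLinearMap) : (φ.mapSeries f).coeff w = 0 :=
  HahnSeries.embDomain_of_notMem_range (f := φ.toOrderEmb) h

theorem MonoEmb.support_mapSeries {V W : OrdVec} (φ : MonoEmb V W) (f : HahnSeries V ℝ) :
    (φ.mapSeries f).support = φ.toLinearMap '' f.support := by
  refine subset_antisymm (HahnSeries.support_embDomain_subset (f := φ.toOrderEmb)) ?_
  rintro _ ⟨v, hv, rfl⟩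
  rw [HahnSeries.mem_support, φ.mapSeries_coeff]
  exact hv

theorem MonoEmb.injective {V W : OrdVec} (φ : MonoEmb V W) : Function.Injective φ.toLinearMap :=
  φ.strictMono.injective

theorem MonoEmb.lt_iff {V W : OrdVec} (φ : MonoEmb V W) {a b : V} :
    φ.toLinearMap a < φ.toLinearMap b ↔ a < b := φ.strictMono.lt_iff_lt

theorem MonoEmb.pos_iff {V W : OrdVec} (φ : MonoEmb V W) {a : V} :
    0 < φ.toLinearMap a ↔ 0 < a := by
  simpa using φ.lt_iff (a := 0) (b := a)

theorem MonoEmb.neg_iff {V W : OrdVec} (φ : MonoEmb V W) {a : V} :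
    φ.toLinearMap a < 0 ↔ a < 0 := by
  simpa using φ.lt_iff (a := a) (b := 0)

theorem MonoEmb.mapSeries_injective {V W : OrdVec} (φ : MonoEmb V W) :
    Function.Injective φ.mapSeries := HahnSeries.embDomain_injective

/-- The action of an embedding of monomials on series, as a homomorphism of algebras. -/
def MonoEmb.mapAlg {V W : OrdVec} (φ : MonoEmb V W) : HahnSeries V ℝ →ₐ[ℝ] HahnSeries W ℝ :=
  HahnSeries.embDomainAlgHom φ.toLinearMap.toAddMonoidHom φ.injective fun _ _ =>
    φ.strictMono.le_iff_le

theorem MonoEmb.mapAlg_apply {V W : OrdVec} (φ : MonoEmb V W) (f : HahnSeries V ℝ) :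
    φ.mapAlg f = φ.mapSeries f := rfl

theorem MonoEmb.mapSeries_single {V W : OrdVec} (φ : MonoEmb V W) (v : V) (c : ℝ) :
    φ.mapSeries (HahnSeries.single v c) = HahnSeries.single (φ.toLinearMap v) c :=
  HahnSeries.embDomain_single (f := φ.toOrderEmb)

theorem MonoEmb.isGrid_mapSeries {V W : OrdVec} (φ : MonoEmb V W) {f : HahnSeries V ℝ}
    (h : IsGrid f.support) : IsGrid (φ.mapSeries f).support := φ.mapSeries_mem h

theorem MonoEmb.isGrid_of_mapSeries {V W : OrdVec} (φ : MonoEmb V W) {f : HahnSeries V ℝ}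
    (h : IsGrid (φ.mapSeries f).support) : IsGrid f.support := by
  have := h.preimage φ (by rw [φ.support_mapSeries]; exact Set.image_subset_range _ _)
  rwa [φ.support_mapSeries, Set.preimage_image_eq _ φ.injective] at this

theorem MonoEmb.order_leadingCoeff {V W : OrdVec} (φ : MonoEmb V W) (f : HahnSeries V ℝ) :
    (φ.mapSeries f).order = φ.toLinearMap f.order ∧
      (φ.mapSeries f).leadingCoeff = f.leadingCoeff := by
  by_cases hf : f = 0
  · subst hf
    simp [← φ.mapAlg_apply]
  have h := order_leadingCoeff_of (f := φ.mapSeries f) (v := φ.toLinearMap f.order)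
    (by rw [φ.mapSeries_coeff]; simpa [HahnSeries.coeff_order_eq_zero] using hf)
    (fun w hw => by
      by_cases h : w ∈ Set.range φ.toLinearMap
      · obtain ⟨v, rfl⟩ := h
        rw [φ.mapSeries_coeff]
        exact HahnSeries.coeff_eq_zero_of_lt_order (φ.lt_iff.1 hw)
      · exact φ.mapSeries_coeff_of_notMem f h)
  rw [φ.mapSeries_coeff, ← HahnSeries.leadingCoeff_eq] at h
  exact h

theorem MonoEmb.exists_mapSeries_eq {V W : OrdVec} (φ : MonoEmb V W) {f : HahnSeries W ℝ}
    (h : f.support ⊆ Set.range φ.toLinearMap) : ∃ g, φ.mapSeries g = f := by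
  refine ⟨⟨fun v => f.coeff (φ.toLinearMap v), ?_⟩, ?_⟩
  · have h1 := f.isPWO_support
    rw [Set.isPWO_iff_isWF, Set.isWF_iff_no_descending_seq] at h1 ⊢
    intro s hs hs'
    exact h1 (fun n => φ.toLinearMap (s n)) (fun a b hab => φ.lt_iff.2 (hs hab)) fun n => hs' n
  · ext w
    by_cases hw : w ∈ Set.range φ.toLinearMap
    · obtain ⟨v, rfl⟩ := hw
      rw [φ.mapSeries_coeff]
    · rw [φ.mapSeries_coeff_of_notMem _ hw]
      by_contra hne
      exact hw (h (Ne.symm hne))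

/-- The forward direction rests on `IsGrid.preimage`. It allows summability at a finite level to be
tested after passing to the direct limit. -/
theorem MonoEmb.hasGridSum_map_iff {V W : OrdVec} (φ : MonoEmb V W) {ι : Type}
    {F : ι → HahnSeries V ℝ} {S : HahnSeries V ℝ} :
    HasGridSum (fun i => φ.mapSeries (F i)) (φ.mapSeries S) ↔ HasGridSum F S := by
  have hU : (⋃ i, (φ.mapSeries (F i)).support) = φ.toLinearMap '' (⋃ i, (F i).support) := by
    simp only [φ.support_mapSeries, Set.image_iUnion]
  constructor
  · rintro ⟨h1, h2, h3⟩
    refine ⟨?_, fun v => ?_, fun v => ?_⟩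
    · rw [hU] at h1
      have := h1.preimage φ (Set.image_subset_range _ _)
      rwa [Set.preimage_image_eq _ φ.injective] at this
    · simpa [φ.mapSeries_coeff] using h2 (φ.toLinearMap v)
    · simpa [φ.mapSeries_coeff] using h3 (φ.toLinearMap v)
  · rintro ⟨h1, h2, h3⟩
    refine ⟨?_, fun w => ?_, fun w => ?_⟩
    · rw [hU]
      obtain ⟨M, μ, k₀, hμ, H⟩ := h1
      refine ⟨M, fun i => φ.toLinearMap (μ i), k₀, fun i => φ.pos_iff.2 (hμ i), ?_⟩
      rintro _ ⟨v, hv, rfl⟩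
      obtain ⟨k, hk, rfl⟩ := H v hv
      exact ⟨k, hk, by simp only [map_sum, map_zsmul]⟩
    · by_cases hw : w ∈ Set.range φ.toLinearMap
      · obtain ⟨v, rfl⟩ := hw
        simpa [φ.mapSeries_coeff] using h2 v
      · simp [φ.mapSeries_coeff_of_notMem _ hw]
    · by_cases hw : w ∈ Set.range φ.toLinearMap
      · obtain ⟨v, rfl⟩ := hw
        simpa [φ.mapSeries_coeff] using h3 v
      · simp [φ.mapSeries_coeff_of_notMem _ hw]

/-! ### Multiplicative substitutions -/

/-- A multiplicative map from monomials to positive grid-based series that maps small monomials to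
small series. -/
structure IsSubst {V W : OrdVec} (Φ : V → HahnSeries W ℝ) : Prop where
  zero : Φ 0 = 1
  add : ∀ a b, Φ (a + b) = Φ a * Φ b
  grid : ∀ a, IsGrid (Φ a).support
  lc : ∀ a, 0 < (Φ a).leadingCoeff
  pos : ∀ a, 0 < a → 0 < (Φ a).order

namespace IsSubst

variable {V W : OrdVec} {Φ : V → HahnSeries W ℝ}

/-- The map of dominant monomials. -/
def ord (h : IsSubst Φ) : V →+ W where
  toFun a := (Φ a).order
  map_zero' := by rw [h.zero, HahnSeries.order_one]
  map_add' a b := by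
    rw [h.add, HahnSeries.order_mul (leadingCoeff_pos_ne_zero (h.lc a))
      (leadingCoeff_pos_ne_zero (h.lc b))]

theorem ord_strictMono (h : IsSubst Φ) : StrictMono h.ord := by
  intro a b hab
  have := h.pos (b - a) (sub_pos.2 hab)
  change 0 < h.ord (b - a) at this
  rwa [map_sub, sub_pos] at this

/-- By multiplicativity, the supports relative to the dominant monomial are controlled by those of
the finitely many series Φ b and Φ (μ i). A single finitely generated monoid therefore contains all
of them, and dominant monomials run through the grid generated by the `h.ord (μ i)`. A monomial v
occurs finitely often because v = ord γ + t has finitely many solutions in two partially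
well-ordered sets and `ord` is injective. -/
theorem gridSummable (h : IsSubst Φ) {f : HahnSeries V ℝ} (hf : IsGrid f.support) :
    GridSummable fun γ => f.coeff γ • Φ γ := by
  obtain ⟨M, μ, b, hμ, H⟩ := hf.exists_nat
  choose F hF hpos hsub using fun a => support_subset_order_add (h.grid a)
  -- `Fb` generates the relative supports; `Ft` also contains the increments of the dominant
  -- monomials along the grid.
  let Fb : Set W := F b ∪ ⋃ i, F (μ i)
  let Ft : Set W := Fb ∪ Set.range fun i => h.ord (μ i)
  have hFb : Fb.Finite := (hF b).union (Set.finite_iUnion fun i => hF (μ i))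
  have hFt : Ft.Finite := hFb.union (Set.finite_range _)
  have hposb : ∀ v ∈ Fb, 0 < v := by
    rintro v (hv | hv)
    · exact hpos _ v hv
    · obtain ⟨i, hi⟩ := Set.mem_iUnion.1 hv
      exact hpos _ v hi
  have hpost : ∀ v ∈ Ft, 0 < v := by
    rintro v (hv | ⟨i, rfl⟩)
    exacts [hposb v hv, h.pos _ (hμ i)]
  let Q : AddSubmonoid V :=
    { carrier := {a | ∀ v ∈ (Φ a).support, ∃ t ∈ AddSubmonoid.closure Fb, v = h.ord a + t}
      zero_mem' := by
        intro v hv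
        rw [h.zero] at hv
        have : v = 0 := by
          by_contra h0
          exact hv (by simp [HahnSeries.coeff_one, h0])
        exact ⟨0, zero_mem _, by simp [this]⟩
      add_mem' := by
        intro a c ha hc v hv
        rw [h.add] at hv
        obtain ⟨s, hs, t, ht, rfl⟩ := HahnSeries.support_mul_subset hv
        obtain ⟨s', hs', rfl⟩ := ha s hs
        obtain ⟨t', ht', rfl⟩ := hc t ht
        exact ⟨s' + t', add_mem hs' ht', by rw [map_add]; dsimp only; abel⟩ }
  have hQb : b ∈ Q := fun v hv => by
    obtain ⟨t, ht, ht'⟩ := hsub b v hv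
    exact ⟨t, AddSubmonoid.closure_mono Set.subset_union_left ht, ht'⟩
  have hQμ : ∀ i, μ i ∈ Q := fun i v hv => by
    obtain ⟨t, ht, ht'⟩ := hsub (μ i) v hv
    exact ⟨t, AddSubmonoid.closure_mono
      ((Set.subset_iUnion (fun i => F (μ i)) i).trans Set.subset_union_right) ht, ht'⟩
  have hQ : ∀ γ ∈ f.support, γ ∈ Q := by
    intro γ hγ
    obtain ⟨n, rfl⟩ := H γ hγ
    exact add_mem hQb (sum_mem fun i _ => nsmul_mem (hQμ i) _)
  have hsupp : ∀ γ v, (f.coeff γ • Φ γ).coeff v ≠ 0 → γ ∈ f.support ∧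
      ∃ t ∈ AddSubmonoid.closure Fb, v = h.ord γ + t := by
    intro γ v hv
    have h0 : f.coeff γ ≠ 0 := fun h0 => hv (by simp [h0])
    exact ⟨h0, hQ γ h0 v fun h1 => hv (by simp [h1])⟩
  constructor
  · refine isGrid_of_mem_closure (h.ord b) hFt hpost fun v hv => ?_
    obtain ⟨γ, hγ⟩ := Set.mem_iUnion.1 hv
    obtain ⟨hγ', t, ht, rfl⟩ := hsupp γ v hγ
    obtain ⟨n, rfl⟩ := H γ hγ'
    refine ⟨∑ i, n i • h.ord (μ i) + t, add_mem ?_ ?_, ?_⟩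
    · exact AddSubmonoid.closure_mono Set.subset_union_right (sum_mem_closure _ n)
    · exact AddSubmonoid.closure_mono Set.subset_union_left ht
    · simp only [map_add, map_sum, map_nsmul, add_assoc]
  · intro v
    have hpwo : (h.ord '' f.support).IsPWO :=
      f.isPWO_support.image_of_monotone h.ord_strictMono.monotone
    have hfin := Set.AddAntidiagonal.finite_of_isPWO hpwo (isPWO_closure hFb hposb) v
    refine Set.Finite.of_finite_image ((hfin.image Prod.fst).subset ?_)
      (h.ord_strictMono.injective.injOn (s := {γ | (f.coeff γ • Φ γ).coeff v ≠ 0}))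
    rintro _ ⟨γ, hγ, rfl⟩
    obtain ⟨hγ', t, ht, rfl⟩ := hsupp γ v hγ
    exact ⟨(h.ord γ, t), ⟨⟨γ, hγ', rfl⟩, ht, rfl⟩, rfl⟩

theorem hasGridSum (h : IsSubst Φ) {f : HahnSeries V ℝ} (hf : IsGrid f.support) :
    HasGridSum (fun γ => f.coeff γ • Φ γ) (extend Φ f) :=
  (h.gridSummable hf).hasGridSum

/-- Since `ord` is strictly increasing, the dominant term of the image comes from the dominant term
of `f` alone and cannot be cancelled. -/
theorem order_leadingCoeff (h : IsSubst Φ) {f : HahnSeries V ℝ} (hf : IsGrid f.support)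
    (h0 : f ≠ 0) : (extend Φ f).order = (Φ f.order).order ∧
      (extend Φ f).leadingCoeff = f.leadingCoeff * (Φ f.order).leadingCoeff := by
  have hs := h.hasGridSum hf
  have hlow : ∀ γ ∈ f.support, ∀ w, w < (Φ γ).order → (Φ γ).coeff w = 0 := fun γ _ w hw =>
    HahnSeries.coeff_eq_zero_of_lt_order hw
  have hle : ∀ γ ∈ f.support, (Φ f.order).order ≤ (Φ γ).order := fun γ hγ =>
    h.ord_strictMono.monotone (HahnSeries.order_le_of_coeff_ne_zero hγ)
  have hc : (extend Φ f).coeff (Φ f.order).order = f.leadingCoeff * (Φ f.order).leadingCoeff := by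
    rw [hs.2.2, finsum_eq_single _ f.order]
    · simp [HahnSeries.leadingCoeff_eq]
    · intro γ hγ
      by_cases hγ' : f.coeff γ = 0
      · simp [hγ']
      · have : f.order < γ :=
          lt_of_le_of_ne (HahnSeries.order_le_of_coeff_ne_zero hγ') (Ne.symm hγ)
        have h1 : (Φ f.order).order < (Φ γ).order := h.ord_strictMono this
        simp [hlow γ hγ' _ h1]
  have hne : f.leadingCoeff * (Φ f.order).leadingCoeff ≠ 0 :=
    mul_ne_zero (HahnSeries.leadingCoeff_ne_zero.2 h0) (h.lc _).ne'
  rw [← hc] at hne ⊢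
  refine order_leadingCoeff_of hne fun w hw => ?_
  rw [hs.2.2]
  refine finsum_eq_zero_of_forall_eq_zero fun γ => ?_
  by_cases hγ' : f.coeff γ = 0
  · simp [hγ']
  · simp [hlow γ hγ' w (hw.trans_le (hle γ hγ'))]

end IsSubst

/-! ### Power series in small series -/

section PowerSeries

variable {V W : OrdVec}

theorem series_mul_smul (a : ℝ) (x y : HahnSeries V ℝ) : x * a • y = a • (x * y) :=
  Algebra.mul_smul_comm _ _ _

theorem series_smul_mul (a : ℝ) (x y : HahnSeries V ℝ) : a • x * y = a • (x * y) :=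
  Algebra.smul_mul_assoc _ _ _

theorem series_smul_smul (a b : ℝ) (x : HahnSeries V ℝ) : a • b • x = (a * b) • x :=
  smul_smul _ _ _

theorem series_natCast (n : ℕ) : (n : HahnSeries V ℝ) = (n : ℝ) • (1 : HahnSeries V ℝ) :=
  (HahnSeries.C_mul_eq_smul (r := (n : ℝ)) (x := (1 : HahnSeries V ℝ)) ▸ by simp)

theorem coeff_heval_of_pos {s : HahnSeries V ℝ} (hs : 0 < s.orderTop) (p : PowerSeries ℝ) (v : V) :
    (PowerSeries.heval s p).coeff v = ∑ᶠ k, PowerSeries.coeff k p * (s ^ k).coeff v := by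
  rw [PowerSeries.coeff_heval]
  refine finsum_congr fun k => ?_
  rw [HahnSeries.SummableFamily.coeff_def,
    HahnSeries.SummableFamily.powerSeriesFamily_of_orderTop_pos hs]
  simp

/-- The default value of `heval` off the small series: only the constant coefficient survives. It
lets the next lemmas on supports, grids and embeddings dispense with a smallness hypothesis. -/
theorem heval_of_not_pos {s : HahnSeries V ℝ} (hs : ¬ 0 < s.orderTop) (p : PowerSeries ℝ) :
    PowerSeries.heval s p = PowerSeries.constantCoeff p • (1 : HahnSeries V ℝ) := by
  rw [PowerSeries.heval_apply, HahnSeries.SummableFamily.powerSeriesFamily_of_not_orderTop_pos hs,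
    HahnSeries.SummableFamily.powerSeriesFamily_hsum_zero]

theorem support_heval (s : HahnSeries V ℝ) (p : PowerSeries ℝ) :
    (PowerSeries.heval s p).support ⊆ AddSubmonoid.closure s.support := by
  intro v hv
  by_cases hs : 0 < s.orderTop
  · rw [HahnSeries.mem_support, coeff_heval_of_pos hs] at hv
    obtain ⟨k, hk⟩ := exists_ne_zero_of_finsum_ne_zero hv
    exact HahnSeries.SummableFamily.support_pow_subset_closure s k (right_ne_zero_of_mul hk)
  · rw [heval_of_not_pos hs] at hv
    have : v = 0 := by
      by_contra h0
      exact hv (by simp [HahnSeries.coeff_one, h0])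
    rw [this]
    exact zero_mem _

theorem isGrid_heval {s : HahnSeries V ℝ} (hs : IsGrid s.support) (p : PowerSeries ℝ) :
    IsGrid (PowerSeries.heval s p).support := by
  by_cases h : 0 < s.orderTop
  · obtain ⟨F, hF, hpos, hsub⟩ := hs.subset_closure_of_pos (orderTop_pos_iff.1 h)
    refine (isGrid_closure hF hpos).mono ((support_heval s p).trans ?_)
    exact AddSubmonoid.closure_le.2 hsub
  · rw [heval_of_not_pos h]
    exact (gridSeries V).smul_mem (gridSeries V).one_mem _

theorem MonoEmb.orderTop_pos_iff (φ : MonoEmb V W) (s : HahnSeries V ℝ) :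
    0 < (φ.mapSeries s).orderTop ↔ 0 < s.orderTop := by
  simp [Transseries.orderTop_pos_iff, φ.support_mapSeries, φ.pos_iff, -HahnSeries.mem_support]

theorem MonoEmb.mapSeries_heval (φ : MonoEmb V W) (s : HahnSeries V ℝ) (p : PowerSeries ℝ) :
    φ.mapSeries (PowerSeries.heval s p) = PowerSeries.heval (φ.mapSeries s) p := by
  by_cases hs : 0 < s.orderTop
  · have hs' := (φ.orderTop_pos_iff s).2 hs
    ext w
    rw [coeff_heval_of_pos hs']
    simp only [← φ.mapAlg_apply, ← map_pow]
    simp only [φ.mapAlg_apply]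
    by_cases hw : w ∈ Set.range φ.toLinearMap
    · obtain ⟨v, rfl⟩ := hw
      simp only [φ.mapSeries_coeff]
      exact coeff_heval_of_pos hs p v
    · simp [φ.mapSeries_coeff_of_notMem _ hw]
  · rw [heval_of_not_pos hs, heval_of_not_pos (mt (φ.orderTop_pos_iff s).1 hs)]
    simp only [← φ.mapAlg_apply, map_smul, map_one]

theorem orderTop_heval_pos {s : HahnSeries V ℝ} (hs : 0 < s.orderTop) {q : PowerSeries ℝ}
    (hq : PowerSeries.constantCoeff q = 0) : 0 < (PowerSeries.heval s q).orderTop := by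
  rw [orderTop_pos_iff] at hs ⊢
  intro v hv
  rcases (closure_nonneg hs (support_heval s q hv)).eq_or_lt with h | h
  · subst h
    rw [HahnSeries.mem_support, PowerSeries.coeff_heval_zero, hq] at hv
    exact absurd rfl hv
  · exact h

/-- For a fixed monomial v only finitely many powers of s contain v, and q^k has no terms of degree
less than k. Both infinite sums can thus be cut off at the same `N`, and the two finite sums
interchanged. -/
theorem heval_subst {s : HahnSeries V ℝ} (hs : 0 < s.orderTop) {q : PowerSeries ℝ}
    (hq : PowerSeries.constantCoeff q = 0) (p : PowerSeries ℝ) :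
    PowerSeries.heval s (p.subst q) = PowerSeries.heval (PowerSeries.heval s q) p := by
  have hq' : PowerSeries.HasSubst q := PowerSeries.HasSubst.of_constantCoeff_zero' hq
  have hlow : ∀ {k j : ℕ}, j < k → PowerSeries.coeff j (q ^ k) = 0 := fun {k j} hjk =>
    PowerSeries.coeff_of_lt_order _ ((by exact_mod_cast hjk : (j : ℕ∞) < k).trans_le
      (PowerSeries.le_order_pow_of_constantCoeff_eq_zero k hq))
  ext v
  have hfin := HahnSeries.SummableFamily.pow_finite_co_support hs v
  obtain ⟨N, hN⟩ : ∃ N, ∀ j, (s ^ j).coeff v ≠ 0 → j < N := by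
    obtain ⟨N, hN⟩ := hfin.bddAbove
    exact ⟨N + 1, fun j hj => Nat.lt_succ_of_le (hN hj)⟩
  have h1 : ∀ r : PowerSeries ℝ, (PowerSeries.heval s r).coeff v =
      ∑ j ∈ Finset.range N, PowerSeries.coeff j r * (s ^ j).coeff v := by
    intro r
    rw [coeff_heval_of_pos hs]
    refine finsum_eq_sum_of_support_subset _ fun j hj => ?_
    exact Finset.mem_coe.2 (Finset.mem_range.2 (hN j (right_ne_zero_of_mul hj)))
  have h2 : ∀ j, j < N → PowerSeries.coeff j (p.subst q) =
      ∑ k ∈ Finset.range N, PowerSeries.coeff k p * PowerSeries.coeff j (q ^ k) := by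
    intro j hj
    rw [PowerSeries.coeff_subst' hq']
    refine finsum_eq_sum_of_support_subset _ fun k hk => ?_
    refine Finset.mem_coe.2 (Finset.mem_range.2 (lt_of_not_ge fun hle => hk ?_))
    simp only [hlow (hj.trans_le hle), smul_zero]
  rw [h1, coeff_heval_of_pos (orderTop_heval_pos hs hq)]
  rw [finsum_eq_sum_of_support_subset (s := Finset.range N)]
  · rw [Finset.sum_congr rfl fun j hj => by rw [h2 j (Finset.mem_range.1 hj), Finset.sum_mul],
      Finset.sum_comm]
    refine Finset.sum_congr rfl fun k _ => ?_
    rw [← map_pow, h1, Finset.mul_sum]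
    exact Finset.sum_congr rfl fun j _ => mul_assoc _ _ _
  · intro k hk
    refine Finset.mem_coe.2 (Finset.mem_range.2 (lt_of_not_ge fun hle => hk ?_))
    dsimp only
    rw [← map_pow, h1, Finset.sum_eq_zero, mul_zero]
    intro j hj
    rw [hlow ((Finset.mem_range.1 hj).trans_le hle), zero_mul]

/-! ### Exponentials and logarithms of small series. -/

/-- The exponential of a small series. -/
def sexp (s : HahnSeries V ℝ) : HahnSeries V ℝ := PowerSeries.heval s (PowerSeries.exp ℝ)

theorem orderTop_add_pos {s t : HahnSeries V ℝ} (hs : 0 < s.orderTop) (ht : 0 < t.orderTop) :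
    0 < (s + t).orderTop :=
  (lt_min hs ht).trans_le HahnSeries.min_orderTop_le_orderTop_add

theorem orderTop_smul_pos {s : HahnSeries V ℝ} (c : ℝ) (hs : 0 < s.orderTop) :
    0 < (c • s).orderTop :=
  hs.trans_le (HahnSeries.orderTop_le_orderTop_smul c s)

theorem orderTop_neg_pos {s : HahnSeries V ℝ} (hs : 0 < s.orderTop) : 0 < (-s).orderTop := by
  rwa [HahnSeries.orderTop_neg]

theorem finsum_antidiagonal (a : ℕ × ℕ → ℝ) (ha : a.support.Finite) :
    ∑ᶠ x, a x = ∑ᶠ n, ∑ x ∈ Finset.HasAntidiagonal.antidiagonal n, a x := by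
  obtain ⟨N, hN⟩ : ∃ N, ∀ x, a x ≠ 0 → x.1 + x.2 < N := by
    obtain ⟨N, hN⟩ := (ha.image fun x => x.1 + x.2).bddAbove
    exact ⟨N + 1, fun x hx => Nat.lt_succ_of_le (hN ⟨x, hx, rfl⟩)⟩
  rw [finsum_eq_sum_of_support_subset (s := (Finset.range N).biUnion
      Finset.HasAntidiagonal.antidiagonal),
    finsum_eq_sum_of_support_subset (s := Finset.range N), Finset.sum_biUnion]
  · intro i _ j _ hij
    refine Finset.disjoint_left.2 fun x hx hx' => hij ?_
    rw [← Finset.HasAntidiagonal.mem_antidiagonal.1 hx,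
      ← Finset.HasAntidiagonal.mem_antidiagonal.1 hx']
  · intro n hn
    obtain ⟨x, hx, hx'⟩ := Finset.exists_ne_zero_of_sum_ne_zero hn
    have := hN x hx'
    rw [Finset.HasAntidiagonal.mem_antidiagonal.1 hx] at this
    simpa using this
  · intro x hx
    simpa using hN x hx

/-- The product of the two exponential families, grouped by total degree, is the exponential family
of s + t by the binomial theorem. -/
theorem sexp_add {s t : HahnSeries V ℝ} (hs : 0 < s.orderTop) (ht : 0 < t.orderTop) :
    sexp (s + t) = sexp s * sexp t := by
  have hst := orderTop_add_pos hs ht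
  let F := HahnSeries.SummableFamily.powerSeriesFamily s (PowerSeries.exp ℝ)
  let G := HahnSeries.SummableFamily.powerSeriesFamily t (PowerSeries.exp ℝ)
  have h1 : sexp s * sexp t = (F.mul G).hsum := by
    rw [HahnSeries.SummableFamily.hsum_mul]
    rfl
  rw [h1]
  ext v
  rw [HahnSeries.SummableFamily.coeff_hsum, sexp, coeff_heval_of_pos hst, finsum_antidiagonal]
  · refine finsum_congr fun n => ?_
    have hF : ∀ i, F i = ((i.factorial : ℝ)⁻¹) • s ^ i := fun i => by
      simp only [F]
      rw [HahnSeries.SummableFamily.powerSeriesFamily_of_orderTop_pos hs]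
      simp
    have hG : ∀ i, G i = ((i.factorial : ℝ)⁻¹) • t ^ i := fun i => by
      simp only [G]
      rw [HahnSeries.SummableFamily.powerSeriesFamily_of_orderTop_pos ht]
      simp
    simp only [HahnSeries.SummableFamily.mul_toFun, hF, hG]
    rw [← HahnSeries.coeff_sum]
    have h2 : ∑ x ∈ Finset.HasAntidiagonal.antidiagonal n, ((x.1.factorial : ℝ)⁻¹ • s ^ x.1) *
        ((x.2.factorial : ℝ)⁻¹ • t ^ x.2) = (n.factorial : ℝ)⁻¹ • (s + t) ^ n := by
      rw [add_pow, Finset.Nat.sum_antidiagonal_eq_sum_range_succ_mk, Finset.smul_sum]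
      refine Finset.sum_congr rfl fun i hi => ?_
      have hi' : i ≤ n := Nat.lt_succ_iff.1 (Finset.mem_range.1 hi)
      rw [series_natCast, series_smul_mul, series_mul_smul, series_smul_smul,
        series_mul_smul _ (s ^ i * t ^ (n - i)), mul_one, series_smul_smul]
      congr 1
      rw [Nat.cast_choose ℝ hi']
      have := Nat.factorial_ne_zero n
      field_simp
    rw [h2]
    simp
  · exact (F.mul G).finite_co_support v

theorem sexp_zero : sexp (0 : HahnSeries V ℝ) = 1 := by
  have h := sexp_add (s := (0 : HahnSeries V ℝ)) (t := 0) (by simp) (by simp)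
  rw [add_zero] at h
  have hne : sexp (0 : HahnSeries V ℝ) ≠ 0 := by
    intro h0
    have := PowerSeries.coeff_heval_zero (0 : HahnSeries V ℝ) (PowerSeries.exp ℝ)
    rw [← sexp, h0] at this
    simp at this
  exact mul_left_cancel₀ hne (by rw [← h, mul_one])

/-- Here exp(u) - 1 = u · r(u), where r has constant coefficient 1, so that r(u) ≠ 0. -/
theorem sexp_eq_one {u : HahnSeries V ℝ} (hu : 0 < u.orderTop) (h : sexp u = 1) : u = 0 := by
  have h1 := PowerSeries.sub_const_eq_X_mul_shift (PowerSeries.exp ℝ)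
  have h2 := congrArg (PowerSeries.heval u) h1
  rw [map_sub, map_mul, PowerSeries.heval_X u hu, ← sexp, h] at h2
  simp only [PowerSeries.constantCoeff_exp, map_one, sub_self] at h2
  rcases mul_eq_zero.1 h2.symm with h3 | h3
  · exact h3
  · have := PowerSeries.coeff_heval_zero u
      (PowerSeries.mk fun p => (PowerSeries.coeff (p + 1)) (PowerSeries.exp ℝ))
    rw [h3] at this
    rw [← PowerSeries.coeff_zero_eq_constantCoeff_apply] at this
    simp at this

theorem sexp_injective {s t : HahnSeries V ℝ} (hs : 0 < s.orderTop) (ht : 0 < t.orderTop)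
    (h : sexp s = sexp t) : s = t := by
  have ht' := orderTop_neg_pos ht
  refine sub_eq_zero.1 (sexp_eq_one (by rw [sub_eq_add_neg]; exact orderTop_add_pos hs ht') ?_)
  rw [sub_eq_add_neg, sexp_add hs ht', h, ← sexp_add ht ht', add_neg_cancel, sexp_zero]

theorem sexp_orderTop_sub_one {s : HahnSeries V ℝ} (hs : 0 < s.orderTop) :
    0 < (sexp s - 1).orderTop := by
  have : sexp s - 1 = PowerSeries.heval s (PowerSeries.exp ℝ - 1) := by
    rw [map_sub, map_one, sexp]
  rw [this]
  exact orderTop_heval_pos hs (by simp)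

theorem order_eq_of_sub_one {f : HahnSeries V ℝ} (h : 0 < (f - 1).orderTop) :
    f.order = 0 ∧ f.leadingCoeff = 1 := by
  obtain ⟨h1, h2⟩ := (HahnSeries.orderTop_self_sub_one_pos_iff _).1 h
  refine ⟨?_, h2⟩
  have hf : f ≠ 0 := by
    rintro rfl
    simp at h1
  rw [← HahnSeries.order_eq_orderTop_of_ne_zero hf] at h1
  exact_mod_cast h1

/-- Both sides have constant coefficient 1 and satisfy (1 + X) y' = σ y, that is, (n + 1) y_(n+1) =
(σ - n) y_n, which determines all coefficients. It turns real powers into exponentials, so that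
their rules follow from `sexp_add`. -/
theorem binomialSeries_eq_exp_log (σ : ℝ) :
    PowerSeries.binomialSeries ℝ σ = (PowerSeries.exp ℝ).subst (σ • PowerSeries.log ℝ) := by
  have hc : PowerSeries.constantCoeff (σ • PowerSeries.log ℝ) = 0 := by
    simp [PowerSeries.smul_eq_C_mul]
  have hs := PowerSeries.HasSubst.of_constantCoeff_zero' hc
  set y := (PowerSeries.exp ℝ).subst (σ • PowerSeries.log ℝ) with hy
  have hlog : (1 + PowerSeries.X) * PowerSeries.derivative ℝ (PowerSeries.log ℝ) = 1 := by
    rw [PowerSeries.deriv_log]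
    ext n
    rcases n with _ | n
    · simp [add_mul]
    · simp [add_mul, PowerSeries.coeff_succ_X_mul, PowerSeries.coeff_one, pow_succ]
  have hode : (1 + PowerSeries.X) * PowerSeries.derivative ℝ y = σ • y := by
    rw [hy, PowerSeries.derivative_subst hs, PowerSeries.derivative_exp, Derivation.map_smul,
      ← hy, Algebra.mul_smul_comm, Algebra.mul_smul_comm, mul_left_comm, hlog, mul_one]
  have h0 : PowerSeries.coeff 0 y = 1 := by
    rw [hy, PowerSeries.coeff_subst' hs, finsum_eq_single _ 0]
    · simp
    · intro k hk
      simp [hc, hk]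
  have hrec : ∀ n : ℕ, PowerSeries.coeff (n + 1) y * (n + 1) = (σ - n) * PowerSeries.coeff n y := by
    intro n
    have := congrArg (PowerSeries.coeff n) hode
    rw [add_mul, one_mul, map_add, PowerSeries.coeff_derivative] at this
    rcases n with _ | n
    · simpa using this
    · rw [PowerSeries.coeff_succ_X_mul, PowerSeries.coeff_derivative] at this
      simp only [map_smul, smul_eq_mul] at this
      push_cast at this ⊢
      linear_combination this
  have hbin : ∀ n : ℕ, Ring.choose σ (n + 1) * (n + 1) = (σ - n) * Ring.choose σ n := by
    intro n
    have h1 := Ring.descPochhammer_eq_factorial_smul_choose σ n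
    have h2 := Ring.descPochhammer_eq_factorial_smul_choose σ (n + 1)
    rw [descPochhammer_succ_right, Polynomial.smeval_mul, h1, Nat.factorial_succ] at h2
    simp only [Polynomial.smeval_sub, Polynomial.smeval_X, Polynomial.smeval_natCast,
      nsmul_eq_mul, pow_one, pow_zero] at h2
    have h3 : (n.factorial : ℝ) ≠ 0 := by exact_mod_cast Nat.factorial_ne_zero n
    push_cast at h2
    refine mul_left_cancel₀ h3 ?_
    linear_combination -h2
  ext n
  induction n with
  | zero => rw [h0]; simp
  | succ n ih =>
    rw [PowerSeries.binomialSeries_coeff] at ih ⊢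
    have hn : (n + 1 : ℝ) ≠ 0 := by positivity
    refine mul_right_cancel₀ hn ?_
    rw [hrec, ← ih]
    simpa using hbin n

/-- The logarithm of `1 + s`, for `s` small. -/
def slog (s : HahnSeries V ℝ) : HahnSeries V ℝ := PowerSeries.heval s (PowerSeries.log ℝ)

theorem orderTop_slog_pos {s : HahnSeries V ℝ} (hs : 0 < s.orderTop) : 0 < (slog s).orderTop :=
  orderTop_heval_pos hs PowerSeries.constantCoeff_log

theorem heval_binomialSeries {s : HahnSeries V ℝ} (hs : 0 < s.orderTop) (σ : ℝ) :
    PowerSeries.heval s (PowerSeries.binomialSeries ℝ σ) = sexp (σ • slog s) := by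
  rw [binomialSeries_eq_exp_log, heval_subst hs, map_smul]
  · rfl
  · simp [PowerSeries.smul_eq_C_mul]

/-- The exponent σ = 1 of `heval_binomialSeries`, as the binomial series of exponent 1 is 1 + X. -/
theorem sexp_slog {s : HahnSeries V ℝ} (hs : 0 < s.orderTop) : sexp (slog s) = 1 + s := by
  have h := heval_binomialSeries hs 1
  rw [one_smul] at h
  rw [← h]
  have := PowerSeries.binomialSeries_nat (R := ℝ) (A := ℝ) 1
  simp only [Nat.cast_one, pow_one] at this
  rw [this, map_add, map_one, PowerSeries.heval_X s hs]

/-! ### Real powers -/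

theorem orderTop_normalized {f : HahnSeries V ℝ} (hf : 0 < f.leadingCoeff) :
    0 < (normalized f - 1).orderTop := by
  have h0 := leadingCoeff_pos_ne_zero hf
  have h1 : HahnSeries.single (-f.order) f.leadingCoeff⁻¹ ≠ 0 :=
    HahnSeries.single_ne_zero (inv_ne_zero hf.ne')
  have h2 : normalized f ≠ 0 := mul_ne_zero h1 h0
  refine (HahnSeries.orderTop_self_sub_one_pos_iff _).2 ⟨?_, ?_⟩
  · rw [← HahnSeries.order_eq_orderTop_of_ne_zero h2, normalized, HahnSeries.order_mul h1 h0,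
      HahnSeries.order_single (inv_ne_zero hf.ne'), neg_add_cancel]
    rfl
  · rw [normalized, HahnSeries.leadingCoeff_mul, HahnSeries.leadingCoeff_of_single,
      inv_mul_cancel₀ hf.ne']

/-- The logarithm of `f / dom(f)`. -/
def logNormalized (f : HahnSeries V ℝ) : HahnSeries V ℝ := slog (normalized f - 1)

theorem orderTop_logNormalized {f : HahnSeries V ℝ} (hf : 0 < f.leadingCoeff) :
    0 < (logNormalized f).orderTop := orderTop_slog_pos (orderTop_normalized hf)

/-- The normal form c 𝔪 exp(t) with t small, from which powers, inverses and logarithms are read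
off. -/
theorem eq_single_mul_sexp {f : HahnSeries V ℝ} (hf : 0 < f.leadingCoeff) :
    f = HahnSeries.single f.order f.leadingCoeff * sexp (logNormalized f) := by
  rw [logNormalized, sexp_slog (orderTop_normalized hf), add_sub_cancel, normalized, ← mul_assoc,
    HahnSeries.single_mul_single, add_neg_cancel, mul_inv_cancel₀ hf.ne',
    HahnSeries.single_zero_one,
    one_mul]

theorem rpow_eq {f : HahnSeries V ℝ} (hf : 0 < f.leadingCoeff) (σ : ℝ) :
    rpow f σ = HahnSeries.single (σ • f.order) (f.leadingCoeff ^ σ) *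
      sexp (σ • logNormalized f) := by
  rw [rpow, heval_binomialSeries (orderTop_normalized hf), logNormalized]

theorem sexp_ne_zero {t : HahnSeries V ℝ} (ht : 0 < t.orderTop) : sexp t ≠ 0 :=
  leadingCoeff_pos_ne_zero (by
    rw [(order_eq_of_sub_one (sexp_orderTop_sub_one ht)).2]; exact one_pos)

theorem order_single_mul_sexp (m : V) {c : ℝ} (hc : c ≠ 0) {t : HahnSeries V ℝ}
    (ht : 0 < t.orderTop) : (HahnSeries.single m c * sexp t).order = m ∧
      (HahnSeries.single m c * sexp t).leadingCoeff = c := by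
  obtain ⟨h1, h2⟩ := order_eq_of_sub_one (sexp_orderTop_sub_one ht)
  rw [HahnSeries.order_mul (HahnSeries.single_ne_zero hc) (sexp_ne_zero ht),
    HahnSeries.leadingCoeff_mul, h1, h2, HahnSeries.order_single hc,
    HahnSeries.leadingCoeff_of_single]
  simp

/-- The small exponent t is recovered from the product, because the exponential is injective on
small series. -/
theorem rpow_single_mul_sexp (m : V) {c : ℝ} (hc : 0 < c) {t : HahnSeries V ℝ}
    (ht : 0 < t.orderTop) (σ : ℝ) : rpow (HahnSeries.single m c * sexp t) σ =
      HahnSeries.single (σ • m) (c ^ σ) * sexp (σ • t) := by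
  obtain ⟨h1, h2⟩ := order_single_mul_sexp m hc.ne' ht
  have hf : 0 < (HahnSeries.single m c * sexp t).leadingCoeff := h2.symm ▸ hc
  have h3 : logNormalized (HahnSeries.single m c * sexp t) = t := by
    refine sexp_injective (orderTop_logNormalized hf) ht ?_
    have h4 := eq_single_mul_sexp hf
    rw [h1, h2] at h4
    exact (mul_left_cancel₀ (HahnSeries.single_ne_zero hc.ne') h4).symm
  rw [rpow_eq hf, h1, h2, h3]

theorem order_rpow {f : HahnSeries V ℝ} (hf : 0 < f.leadingCoeff) (σ : ℝ) :
    (rpow f σ).order = σ • f.order ∧ (rpow f σ).leadingCoeff = f.leadingCoeff ^ σ := by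
  rw [rpow_eq hf]
  exact order_single_mul_sexp _ (Real.rpow_pos_of_pos hf σ).ne'
    (orderTop_smul_pos σ (orderTop_logNormalized hf))

theorem rpow_add {f : HahnSeries V ℝ} (hf : 0 < f.leadingCoeff) (σ τ : ℝ) :
    rpow f (σ + τ) = rpow f σ * rpow f τ := by
  have h := orderTop_logNormalized hf
  rw [rpow_eq hf, rpow_eq hf, rpow_eq hf, add_smul σ τ f.order, add_smul σ τ (logNormalized f),
    Real.rpow_add hf,
    sexp_add (orderTop_smul_pos σ h) (orderTop_smul_pos τ h), ← HahnSeries.single_mul_single]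
  ring

theorem rpow_zero {f : HahnSeries V ℝ} (hf : 0 < f.leadingCoeff) : rpow f 0 = 1 := by
  rw [rpow_eq hf, zero_smul ℝ f.order, zero_smul ℝ (logNormalized f), Real.rpow_zero, sexp_zero,
    HahnSeries.single_zero_one,
    one_mul]

theorem rpow_one {f : HahnSeries V ℝ} (hf : 0 < f.leadingCoeff) : rpow f 1 = f := by
  rw [rpow_eq hf, one_smul, one_smul, Real.rpow_one, ← eq_single_mul_sexp hf]

theorem isGrid_mul {f g : HahnSeries V ℝ} (hf : IsGrid f.support) (hg : IsGrid g.support) :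
    IsGrid (f * g).support := (gridSeries V).mul_mem hf hg

theorem isGrid_sub {f g : HahnSeries V ℝ} (hf : IsGrid f.support) (hg : IsGrid g.support) :
    IsGrid (f - g).support := (gridSeries V).sub_mem hf hg

theorem isGrid_one : IsGrid (1 : HahnSeries V ℝ).support := (gridSeries V).one_mem

theorem isGrid_single (v : V) (c : ℝ) : IsGrid (HahnSeries.single v c).support := single_mem v c

theorem isGrid_normalized_sub_one {f : HahnSeries V ℝ} (hf : IsGrid f.support) :
    IsGrid (normalized f - 1).support :=
  isGrid_sub (isGrid_mul (isGrid_single _ _) hf) isGrid_one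

theorem isGrid_rpow {f : HahnSeries V ℝ} (hf : IsGrid f.support) (σ : ℝ) :
    IsGrid (rpow f σ).support :=
  isGrid_mul (isGrid_single _ _) (isGrid_heval (isGrid_normalized_sub_one hf) _)

theorem MonoEmb.mapSeries_mul (φ : MonoEmb V W) (f g : HahnSeries V ℝ) :
    φ.mapSeries (f * g) = φ.mapSeries f * φ.mapSeries g := map_mul φ.mapAlg f g

theorem MonoEmb.mapSeries_normalized_sub_one (φ : MonoEmb V W) (f : HahnSeries V ℝ) :
    φ.mapSeries (normalized f - 1) = normalized (φ.mapSeries f) - 1 := by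
  obtain ⟨h1, h2⟩ := φ.order_leadingCoeff f
  simp only [normalized, ← φ.mapAlg_apply, map_sub, map_one, map_mul]
  simp only [φ.mapAlg_apply, φ.mapSeries_single, map_neg, h1, h2]

theorem MonoEmb.mapSeries_rpow (φ : MonoEmb V W) (f : HahnSeries V ℝ) (σ : ℝ) :
    φ.mapSeries (rpow f σ) = rpow (φ.mapSeries f) σ := by
  obtain ⟨h1, h2⟩ := φ.order_leadingCoeff f
  rw [rpow, rpow, φ.mapSeries_mul, φ.mapSeries_single, φ.mapSeries_heval, h1, h2,
    φ.mapSeries_normalized_sub_one, map_smul]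

theorem MonoEmb.mapSeries_logNormalized (φ : MonoEmb V W) (f : HahnSeries V ℝ) :
    φ.mapSeries (logNormalized f) = logNormalized (φ.mapSeries f) := by
  rw [logNormalized, logNormalized, slog, slog, φ.mapSeries_heval, φ.mapSeries_normalized_sub_one]

theorem isGrid_logNormalized {f : HahnSeries V ℝ} (hf : IsGrid f.support) :
    IsGrid (logNormalized f).support :=
  isGrid_heval (isGrid_normalized_sub_one hf) _

/-! ### Inverses -/

theorem isGrid_neg {f : HahnSeries V ℝ} (hf : IsGrid f.support) : IsGrid (-f).support := by
  rwa [HahnSeries.support_neg]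

theorem leadingCoeff_neg (f : HahnSeries V ℝ) : (-f).leadingCoeff = -f.leadingCoeff := by
  rw [HahnSeries.leadingCoeff_eq, HahnSeries.order_neg, HahnSeries.coeff_neg,
    ← HahnSeries.leadingCoeff_eq]

theorem inv_eq_rpow {f : HahnSeries V ℝ} (hf : 0 < f.leadingCoeff) : f⁻¹ = rpow f (-1) := by
  have h : rpow f (-1) * f = 1 := by
    have h1 := rpow_add hf (-1) 1
    rwa [neg_add_cancel, rpow_zero hf, rpow_one hf, eq_comm] at h1
  exact inv_eq_of_mul_eq_one_left h

/-- For a positive leading coefficient the inverse is the power of exponent -1. The negative case is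
reduced to it by a change of sign. -/
theorem isGrid_inv {f : HahnSeries V ℝ} (hf : IsGrid f.support) : IsGrid (f⁻¹).support := by
  rcases lt_trichotomy f.leadingCoeff 0 with h | h | h
  · have h1 := isGrid_neg (isGrid_rpow (isGrid_neg hf) (-1))
    rw [← inv_eq_rpow (by rw [leadingCoeff_neg]; exact neg_pos.2 h)] at h1
    have h2 : -(-f)⁻¹ = f⁻¹ := (congrArg Neg.neg (inv_neg (a := f))).trans (neg_neg _)
    rwa [h2] at h1
  · rw [HahnSeries.leadingCoeff_eq_zero.1 h, inv_zero]
    exact (gridSeries V).zero_mem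
  · rw [inv_eq_rpow h]
    exact isGrid_rpow hf _

end PowerSeries

/-! ### Direct limits of groups of monomials -/

namespace Lim

section

variable {V : ℕ → OrdVec} (φ : ∀ n, MonoEmb (V n) (V (n + 1)))

/-- The sequences that are eventually compatible with the embeddings. -/
def compat : Submodule ℝ (∀ n, V n) where
  carrier := {s | ∀ᶠ n in Filter.atTop, s (n + 1) = (φ n).toLinearMap (s n)}
  zero_mem' := Filter.Eventually.of_forall fun n => by simp
  add_mem' := by
    intro s t hs ht
    filter_upwards [hs, ht] with n h1 h2
    simp [h1, h2]
  smul_mem' := by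
    intro c s hs
    filter_upwards [hs] with n h1
    simp [h1]

/-- The compatible sequences that eventually vanish. -/
def null : Submodule ℝ (compat φ) where
  carrier := {s | ∀ᶠ n in Filter.atTop, s.1 n = 0}
  zero_mem' := Filter.Eventually.of_forall fun n => rfl
  add_mem' := by
    intro s t hs ht
    filter_upwards [hs, ht] with n h1 h2
    simp [h1, h2]
  smul_mem' := by
    intro c s hs
    filter_upwards [hs] with n h1
    simp [h1]

/-- The underlying space of the direct limit. -/
def Carrier : Type := compat φ ⧸ null φ

instance : AddCommGroup (Carrier φ) := inferInstanceAs (AddCommGroup (compat φ ⧸ null φ))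
instance : Module ℝ (Carrier φ) := inferInstanceAs (Module ℝ (compat φ ⧸ null φ))

def mk (s : compat φ) : Carrier φ := Submodule.Quotient.mk s

theorem mk_eq_mk {s t : compat φ} :
    mk φ s = mk φ t ↔ ∀ᶠ n in Filter.atTop, s.1 n = t.1 n := by
  refine (Submodule.Quotient.eq _).trans ?_
  change (∀ᶠ n in Filter.atTop, s.1 n - t.1 n = 0) ↔ _
  simp only [sub_eq_zero]

/-- The compatible sequence that starts with `v` in place `n`. -/
def seq (n : ℕ) (v : V n) : ∀ m, V m
  -- The places before `n` receive 0, which is harmless because only the tail of a sequence counts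
  -- in the quotient.
  | 0 => if h : n = 0 then h ▸ v else 0
  | m + 1 => if h : n = m + 1 then h ▸ v else (φ m).toLinearMap (seq n v m)

theorem seq_self (n : ℕ) (v : V n) : seq φ n v n = v := by
  cases n <;> simp [seq]

theorem seq_lt (n : ℕ) (v : V n) {m : ℕ} (h : m < n) : seq φ n v m = 0 := by
  induction m with
  | zero => simp [seq, h.ne']
  | succ m ih => simp [seq, h.ne', ih (Nat.lt_of_succ_lt h)]

theorem seq_succ (n : ℕ) (v : V n) {m : ℕ} (h : n ≤ m) :
    seq φ n v (m + 1) = (φ m).toLinearMap (seq φ n v m) := by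
  simp [seq, (Nat.lt_succ_of_le h).ne]

theorem seq_compat (n : ℕ) (v : V n) : seq φ n v ∈ compat φ := by
  filter_upwards [Filter.eventually_ge_atTop n] with m hm
  exact seq_succ φ n v hm

theorem seq_add (n : ℕ) (v w : V n) (m : ℕ) : seq φ n (v + w) m = seq φ n v m + seq φ n w m := by
  rcases lt_or_ge m n with h | h
  · simp [seq_lt φ n _ h]
  · induction m, h using Nat.le_induction with
    | base => simp [seq_self]
    | succ m hm ih => simp [seq_succ φ n _ hm, ih]

theorem seq_smul (n : ℕ) (c : ℝ) (v : V n) (m : ℕ) : seq φ n (c • v) m = c • seq φ n v m := by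
  rcases lt_or_ge m n with h | h
  · simp [seq_lt φ n _ h]
  · induction m, h using Nat.le_induction with
    | base => simp [seq_self]
    | succ m hm ih => simp [seq_succ φ n _ hm, ih]

theorem seq_pos (n : ℕ) {v : V n} (hv : 0 < v) {m : ℕ} (h : n ≤ m) : 0 < seq φ n v m := by
  induction m, h using Nat.le_induction with
  | base => rwa [seq_self]
  | succ m hm ih => rw [seq_succ φ n _ hm]; exact (φ m).pos_iff.2 ih

/-- The canonical map to the direct limit. -/
def ofLin (n : ℕ) : V n →ₗ[ℝ] Carrier φ where
  toFun v := mk φ ⟨seq φ n v, seq_compat φ n v⟩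
  map_add' v w := by
    refine congrArg (mk φ) (Subtype.ext ?_)
    ext m
    exact seq_add φ n v w m
  map_smul' c v := by
    refine congrArg (mk φ) (Subtype.ext ?_)
    ext m
    exact seq_smul φ n c v m

theorem ofLin_succ (n : ℕ) (v : V n) : ofLin φ (n + 1) ((φ n).toLinearMap v) = ofLin φ n v := by
  refine (mk_eq_mk φ).2 ?_
  filter_upwards [Filter.eventually_ge_atTop (n + 1)] with m hm
  induction m, hm using Nat.le_induction with
  | base => exact (seq_self φ _ _).trans (by rw [seq_succ φ n v le_rfl, seq_self])
  | succ m hm ih =>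
    exact (seq_succ φ (n + 1) _ hm).trans
      ((congrArg _ ih).trans (seq_succ φ n v (Nat.le_of_succ_le hm)).symm)

theorem exists_ofLin (x : Carrier φ) : ∃ n v, ofLin φ n v = x := by
  obtain ⟨s, rfl⟩ := Submodule.Quotient.mk_surjective (null φ) x
  obtain ⟨n, hn⟩ := Filter.eventually_atTop.1 s.2
  refine ⟨n, s.1 n, (mk_eq_mk φ).2 ?_⟩
  filter_upwards [Filter.eventually_ge_atTop n] with m hm
  induction m, hm using Nat.le_induction with
  | base => exact seq_self φ _ _
  | succ m hm ih => exact (seq_succ φ n _ hm).trans ((congrArg _ ih).trans (hn m hm).symm)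

theorem exists_ofLin_add (x : Carrier φ) {n : ℕ} (h : ∃ v, ofLin φ n v = x) (k : ℕ) :
    ∃ v, ofLin φ (n + k) v = x := by
  induction k with
  | zero => exact h
  | succ k ih =>
    obtain ⟨v, rfl⟩ := ih
    exact ⟨_, ofLin_succ φ _ v⟩

theorem exists_ofLin₂ (x y : Carrier φ) : ∃ n v w, ofLin φ n v = x ∧ ofLin φ n w = y := by
  obtain ⟨n, hn⟩ := exists_ofLin φ x
  obtain ⟨m, hm⟩ := exists_ofLin φ y
  obtain ⟨v, hv⟩ := exists_ofLin_add φ x hn m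
  have hmn : ∃ w, ofLin φ (n + m) w = y := add_comm m n ▸ exists_ofLin_add φ y hm n
  obtain ⟨w, hw⟩ := hmn
  exact ⟨_, v, w, hv, hw⟩

/-- Nonnegative elements. -/
def Nonneg (x : Carrier φ) : Prop := ∃ n v, 0 ≤ v ∧ ofLin φ n v = x

/-- The embeddings preserve strict positivity, so representatives that agree at a late stage have
the same sign at every earlier stage. The sign is therefore independent of the representative. -/
theorem nonneg_iff {n : ℕ} {v : V n} : Nonneg φ (ofLin φ n v) ↔ 0 ≤ v := by
  refine ⟨?_, fun h => ⟨n, v, h, rfl⟩⟩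
  rintro ⟨m, w, hw, h⟩
  by_contra hv
  rw [not_le] at hv
  have h1 : ∀ᶠ k in Filter.atTop, seq φ m w k = seq φ n v k := (mk_eq_mk φ).1 h
  obtain ⟨k, hk, hkm, hkn⟩ := (h1.and ((Filter.eventually_ge_atTop m).and
    (Filter.eventually_ge_atTop n))).exists
  have h2 : 0 ≤ seq φ m w k := by
    rcases hw.eq_or_lt with rfl | hw
    · have := seq_smul φ m 0 0 k
      rw [zero_smul, zero_smul] at this
      exact this.ge
    · exact (seq_pos φ m hw hkm).le
  have h3 : 0 < -seq φ n v k := by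
    have := seq_smul φ n (-1) v k
    rw [neg_one_smul, neg_one_smul] at this
    rw [← this]
    exact seq_pos φ n (neg_pos.2 hv) hkn
  rw [hk] at h2
  exact absurd h2 (not_le.2 (neg_pos.1 h3))

theorem ofLin_injective (n : ℕ) : Function.Injective (ofLin φ n) := by
  refine (injective_iff_map_eq_zero _).2 fun v hv => ?_
  have h1 : Nonneg φ (ofLin φ n v) := by
    rw [hv, ← map_zero (ofLin φ n)]
    exact (nonneg_iff φ).2 le_rfl
  have h2 : Nonneg φ (ofLin φ n (-v)) := by
    rw [map_neg, hv, neg_zero, ← map_zero (ofLin φ n)]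
    exact (nonneg_iff φ).2 le_rfl
  exact le_antisymm (neg_nonneg.1 ((nonneg_iff φ).1 h2)) ((nonneg_iff φ).1 h1)

instance : LinearOrder (Carrier φ) where
  le x y := Nonneg φ (y - x)
  le_refl x := by
    rw [sub_self]
    exact ⟨0, 0, le_rfl, map_zero _⟩
  le_trans x y z hxy hyz := by
    obtain ⟨n, v, w, hv, hw⟩ := exists_ofLin₂ φ (y - x) (z - y)
    rw [← hv] at hxy
    rw [← hw] at hyz
    have : z - x = ofLin φ n (v + w) := by rw [map_add, hv, hw]; abel
    rw [this]
    exact (nonneg_iff φ).2 (add_nonneg ((nonneg_iff φ).1 hxy) ((nonneg_iff φ).1 hyz))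
  le_antisymm x y hxy hyx := by
    obtain ⟨n, v, hv⟩ := exists_ofLin φ (y - x)
    have hv' : x - y = ofLin φ n (-v) := by rw [map_neg, hv]; abel
    rw [← hv] at hxy
    rw [hv'] at hyx
    have h0 := le_antisymm (neg_nonneg.1 ((nonneg_iff φ).1 hyx)) ((nonneg_iff φ).1 hxy)
    rw [h0, map_zero] at hv
    exact (sub_eq_zero.1 hv.symm).symm
  le_total x y := by
    obtain ⟨n, v, hv⟩ := exists_ofLin φ (y - x)
    have hv' : x - y = ofLin φ n (-v) := by rw [map_neg, hv]; abel
    rcases le_total 0 v with h | h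
    · exact Or.inl (by rw [← hv]; exact (nonneg_iff φ).2 h)
    · exact Or.inr (by rw [hv']; exact (nonneg_iff φ).2 (neg_nonneg.2 h))
  toDecidableLE := Classical.decRel _

theorem le_iff_nonneg {x y : Carrier φ} : x ≤ y ↔ Nonneg φ (y - x) := Iff.rfl

instance : IsOrderedAddMonoid (Carrier φ) where
  add_le_add_left x y h z := by
    rw [le_iff_nonneg] at h ⊢
    rwa [add_sub_add_right_eq_sub]

/-- The direct limit of a sequence of groups of monomials. -/
def lim : OrdVec where
  carrier := Carrier φ

/-- The embedding in the direct limit. -/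
def of (n : ℕ) : MonoEmb (V n) (lim φ) where
  toLinearMap := ofLin φ n
  strictMono := by
    refine Monotone.strictMono_of_injective (fun v w h => ?_) (ofLin_injective φ n)
    change Nonneg φ (ofLin φ n w - ofLin φ n v)
    rw [← map_sub]
    exact (nonneg_iff φ).2 (sub_nonneg.2 h)

theorem of_succ (n : ℕ) (v : V n) :
    (of φ (n + 1)).toLinearMap ((φ n).toLinearMap v) = (of φ n).toLinearMap v :=
  ofLin_succ φ n v

theorem exists_of (x : lim φ) : ∃ n v, (of φ n).toLinearMap v = x := exists_ofLin φ x

theorem of_range_mono {n m : ℕ} (h : n ≤ m) :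
    Set.range (of φ n).toLinearMap ⊆ Set.range (of φ m).toLinearMap := by
  obtain ⟨k, rfl⟩ := Nat.exists_eq_add_of_le h
  rintro x ⟨v, hv⟩
  exact exists_ofLin_add φ x ⟨v, hv⟩ k

variable {φ}

/-- Two representatives of one element agree at some common later stage, and a compatible family
does not change on the way there. -/
theorem eq_of_of_eq {X : Type} {F : ∀ n, V n → X}
    (hF : ∀ n v, F (n + 1) ((φ n).toLinearMap v) = F n v) {n m : ℕ} {v : V n} {w : V m}
    (h : (of φ n).toLinearMap v = (of φ m).toLinearMap w) : F n v = F m w := by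
  have h0 : ∀ {n} (v : V n) {k}, n ≤ k → F k (seq φ n v k) = F n v := by
    intro n v k hk
    induction k, hk using Nat.le_induction with
    | base => rw [seq_self]
    | succ k hk ih => rw [seq_succ φ n v hk, hF, ih]
  have h1 : ∀ᶠ k in Filter.atTop, seq φ n v k = seq φ m w k := (mk_eq_mk φ).1 h
  obtain ⟨k, hk, hkn, hkm⟩ := (h1.and ((Filter.eventually_ge_atTop n).and
    (Filter.eventually_ge_atTop m))).exists
  rw [← h0 v hkn, hk, h0 w hkm]

/-- The universal property of the direct limit, for maps. -/
def lift {X : Type} (F : ∀ n, V n → X) (x : lim φ) : X :=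
  F (exists_of φ x).choose (exists_of φ x).choose_spec.choose

theorem lift_of {X : Type} {F : ∀ n, V n → X}
    (hF : ∀ n v, F (n + 1) ((φ n).toLinearMap v) = F n v) (n : ℕ) (v : V n) :
    lift F ((of φ n).toLinearMap v) = F n v :=
  eq_of_of_eq hF (exists_of φ ((of φ n).toLinearMap v)).choose_spec.choose_spec

theorem exists_of₂ (x y : lim φ) :
    ∃ n v w, (of φ n).toLinearMap v = x ∧ (of φ n).toLinearMap w = y := exists_ofLin₂ φ x y

/-- The universal property of the direct limit, for embeddings. -/
def liftEmb {W : OrdVec} (F : ∀ n, MonoEmb (V n) W)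
    (hF : ∀ n v, (F (n + 1)).toLinearMap ((φ n).toLinearMap v) = (F n).toLinearMap v) :
    MonoEmb (lim φ) W where
  toFun := lift fun n => (F n).toLinearMap
  map_add' x y := by
    obtain ⟨n, v, w, rfl, rfl⟩ := exists_of₂ x y
    rw [← map_add, lift_of hF, lift_of hF, lift_of hF, map_add]
  map_smul' c x := by
    obtain ⟨n, v, rfl⟩ := exists_of φ x
    rw [← map_smul, lift_of hF, lift_of hF, map_smul]
    rfl
  strictMono x y h := by
    obtain ⟨n, v, w, rfl, rfl⟩ := exists_of₂ x y
    rw [lift_of hF, lift_of hF]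
    exact (F n).strictMono ((of φ n).lt_iff.1 h)

theorem liftEmb_of {W : OrdVec} (F : ∀ n, MonoEmb (V n) W)
    (hF : ∀ n v, (F (n + 1)).toLinearMap ((φ n).toLinearMap v) = (F n).toLinearMap v)
    (n : ℕ) (v : V n) :
    (liftEmb F hF).toLinearMap ((of φ n).toLinearMap v) = (F n).toLinearMap v :=
  lift_of (F := fun n => (F n).toLinearMap) hF n v

end

end Lim

/-! ### Composition of embeddings of monomials. -/

theorem MonoEmb.ext {V W : OrdVec} {φ ψ : MonoEmb V W}
    (h : ∀ v, φ.toLinearMap v = ψ.toLinearMap v) : φ = ψ := by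
  cases φ
  cases ψ
  congr
  exact LinearMap.ext h

/-- The composition of embeddings. -/
def MonoEmb.comp {U V W : OrdVec} (ψ : MonoEmb V W) (φ : MonoEmb U V) : MonoEmb U W where
  toLinearMap := ψ.toLinearMap ∘ₗ φ.toLinearMap
  strictMono := ψ.strictMono.comp φ.strictMono

theorem MonoEmb.comp_apply {U V W : OrdVec} (ψ : MonoEmb V W) (φ : MonoEmb U V) (u : U) :
    (ψ.comp φ).toLinearMap u = ψ.toLinearMap (φ.toLinearMap u) := rfl

theorem MonoEmb.mapSeries_comp {U V W : OrdVec} (ψ : MonoEmb V W) (φ : MonoEmb U V)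
    (f : HahnSeries U ℝ) : (ψ.comp φ).mapSeries f = ψ.mapSeries (φ.mapSeries f) := by
  ext w
  by_cases hw : w ∈ Set.range ψ.toLinearMap
  · obtain ⟨v, rfl⟩ := hw
    rw [ψ.mapSeries_coeff]
    by_cases hv : v ∈ Set.range φ.toLinearMap
    · obtain ⟨u, rfl⟩ := hv
      rw [φ.mapSeries_coeff, ← ψ.comp_apply, (ψ.comp φ).mapSeries_coeff]
    · rw [φ.mapSeries_coeff_of_notMem _ hv, (ψ.comp φ).mapSeries_coeff_of_notMem]
      rintro ⟨u, hu⟩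
      exact hv ⟨u, ψ.injective hu⟩
  · rw [ψ.mapSeries_coeff_of_notMem _ hw, (ψ.comp φ).mapSeries_coeff_of_notMem]
    rintro ⟨u, hu⟩
    exact hw ⟨_, hu⟩

/-! ### The group of all log-free transmonomials -/

/-- The group of all log-free transmonomials. -/
def TM : OrdVec := Lim.lim incl

/-- The inclusion of level at most `n`. -/
def ι (n : ℕ) : MonoEmb (G n) TM := Lim.of incl n

theorem ι_succ (n : ℕ) (v : G n) :
    (ι (n + 1)).toLinearMap ((incl n).toLinearMap v) = (ι n).toLinearMap v := Lim.of_succ incl n v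

theorem ι_mapSeries_succ (n : ℕ) (f : HahnSeries (G n) ℝ) :
    (ι (n + 1)).mapSeries ((incl n).mapSeries f) = (ι n).mapSeries f := by
  rw [← MonoEmb.mapSeries_comp]
  congr 1
  exact MonoEmb.ext fun v => ι_succ n v

/-- The monomial `x^(-σ)`. -/
def xM (σ : ℝ) : TM := (ι 0).toLinearMap (G.pow σ)

theorem xM_add (σ τ : ℝ) : xM (σ + τ) = xM σ + xM τ := map_add (ι 0).toLinearMap (G.pow σ) (G.pow τ)

theorem xM_smul (c σ : ℝ) : xM (c * σ) = c • xM σ := map_smul (ι 0).toLinearMap c (G.pow σ)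

theorem xM_zero : xM 0 = 0 := map_zero (ι 0).toLinearMap

theorem xM_neg (σ : ℝ) : xM (-σ) = -xM σ := map_neg (ι 0).toLinearMap (G.pow σ)

theorem G.mono_add {n : ℕ} (L L' : largeSeries (G n)) (σ τ : ℝ) :
    G.mono (L + L') (σ + τ) = G.mono L σ + G.mono L' τ := rfl

theorem G.mono_smul {n : ℕ} (c : ℝ) (L : largeSeries (G n)) (σ : ℝ) :
    G.mono (c • L) (c * σ) = c • G.mono L σ := rfl

theorem mapLarge_zero {V W : OrdVec} (φ : MonoEmb V W) : φ.mapLarge 0 = 0 :=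
  Subtype.ext (map_zero φ.mapAlg)

theorem incl_xMono (n : ℕ) (σ : ℝ) : (incl n).toLinearMap (xMono n σ) = xMono (n + 1) σ := by
  cases n with
  | zero => rfl
  | succ n =>
    change G.mono ((incl n).mapLarge 0) σ = _
    rw [mapLarge_zero]
    rfl

theorem ι_xMono (n : ℕ) (σ : ℝ) : (ι n).toLinearMap (xMono n σ) = xM σ := by
  induction n with
  | zero => rfl
  | succ n ih => rw [← incl_xMono, ι_succ, ih]

theorem ι_mono (n : ℕ) (L : largeSeries (G n)) (σ : ℝ) :
    (ι (n + 1)).toLinearMap (G.mono L σ) = (ι (n + 1)).toLinearMap (G.mono L 0) + xM σ := by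
  rw [← ι_xMono (n + 1), ← map_add]
  congr 1
  change _ = G.mono L 0 + G.mono 0 σ
  rw [← G.mono_add, add_zero, zero_add]

/-- The image in the series over all log-free transmonomials of a large series. -/
def ιL {n : ℕ} (L : largeSeries (G n)) : HahnSeries TM ℝ := (ι n).mapSeries (ofLex L.1)

/-- Large series of level at most `k`. -/
def IsLargeAt (k : ℕ) (L : HahnSeries TM ℝ) : Prop := ∃ L₀ : largeSeries (G k), ιL L₀ = L

theorem ιL_injective {n : ℕ} : Function.Injective (ιL (n := n)) := fun _ _ h =>
  Subtype.ext ((ι n).mapSeries_injective h)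

/-- Raising the level of L changes neither its image among the series over `TM` nor the image of
exp(-L). This makes `expM` independent of the level chosen in its definition. -/
theorem exists_large_add {k : ℕ} (L : largeSeries (G k)) (d : ℕ) :
    ∃ L' : largeSeries (G (k + d)), ιL L' = ιL L ∧
      (ι (k + d + 1)).toLinearMap (G.mono L' 0) = (ι (k + 1)).toLinearMap (G.mono L 0) := by
  induction d with
  | zero => exact ⟨L, rfl, rfl⟩
  | succ d ih =>
    obtain ⟨L', h1, h2⟩ := ih
    refine ⟨(incl (k + d)).mapLarge L', ?_, ?_⟩
    · rw [← h1]
      exact ι_mapSeries_succ (k + d) _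
    · rw [← h2, ← ι_succ (k + d + 1)]
      rfl

/-- The monomial `exp(-L)`. -/
def expM (L : HahnSeries TM ℝ) : TM :=
  open Classical in
  if h : ∃ k, IsLargeAt k L then (ι (h.choose + 1)).toLinearMap (G.mono h.choose_spec.choose 0)
  else 0

theorem expM_ιL {k : ℕ} (L : largeSeries (G k)) :
    expM (ιL L) = (ι (k + 1)).toLinearMap (G.mono L 0) := by
  have key : ∀ (m : ℕ) (K : largeSeries (G m)), ιL K = ιL L →
      (ι (m + 1)).toLinearMap (G.mono K 0) = (ι (k + 1)).toLinearMap (G.mono L 0) := by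
    intro m K hK
    -- Both series are raised to the level m + k, where equal images force equality.
    obtain ⟨L₁, a1, a2⟩ := exists_large_add K k
    obtain ⟨L₂, b1, b2⟩ : ∃ L' : largeSeries (G (m + k)), ιL L' = ιL L ∧
        (ι (m + k + 1)).toLinearMap (G.mono L' 0) = (ι (k + 1)).toLinearMap (G.mono L 0) :=
      add_comm k m ▸ exists_large_add L m
    have h3 : L₁ = L₂ := ιL_injective (by rw [a1, b1, hK])
    rw [← a2, ← b2, h3]
  have h : ∃ m, IsLargeAt m (ιL L) := ⟨k, L, rfl⟩
  rw [expM, dif_pos h]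
  exact key _ _ h.choose_spec.choose_spec

theorem IsLargeAt.mono {k m : ℕ} (h : k ≤ m) {L : HahnSeries TM ℝ} (hL : IsLargeAt k L) :
    IsLargeAt m L := by
  obtain ⟨d, rfl⟩ := Nat.exists_eq_add_of_le h
  obtain ⟨L₀, rfl⟩ := hL
  obtain ⟨L', h1, -⟩ := exists_large_add L₀ d
  exact ⟨L', h1⟩

theorem ιL_add {k : ℕ} (L L' : largeSeries (G k)) : ιL (L + L') = ιL L + ιL L' :=
  map_add (ι k).mapAlg (ofLex L.1) (ofLex L'.1)

theorem ιL_smul {k : ℕ} (c : ℝ) (L : largeSeries (G k)) : ιL (c • L) = c • ιL L :=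
  map_smul (ι k).mapAlg c (ofLex L.1)

theorem ιL_zero {k : ℕ} : ιL (0 : largeSeries (G k)) = 0 := map_zero (ι k).mapAlg

theorem IsLargeAt.add {k : ℕ} {L L' : HahnSeries TM ℝ} (h : IsLargeAt k L) (h' : IsLargeAt k L') :
    IsLargeAt k (L + L') := by
  obtain ⟨L, rfl⟩ := h
  obtain ⟨L', rfl⟩ := h'
  exact ⟨L + L', ιL_add L L'⟩

theorem IsLargeAt.smul {k : ℕ} {L : HahnSeries TM ℝ} (h : IsLargeAt k L) (c : ℝ) :
    IsLargeAt k (c • L) := by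
  obtain ⟨L, rfl⟩ := h
  exact ⟨c • L, ιL_smul c L⟩

theorem isLargeAt_zero (k : ℕ) : IsLargeAt k 0 := ⟨0, ιL_zero⟩

theorem series_neg_one_smul {V : OrdVec} (f : HahnSeries V ℝ) : (-1 : ℝ) • f = -f :=
  neg_one_smul ℝ f

theorem IsLargeAt.neg {k : ℕ} {L : HahnSeries TM ℝ} (h : IsLargeAt k L) : IsLargeAt k (-L) := by
  rw [← series_neg_one_smul]
  exact h.smul _

/-- Large series of some level. -/
def IsLarge (L : HahnSeries TM ℝ) : Prop := ∃ k, IsLargeAt k L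

theorem IsLarge.common {L L' : HahnSeries TM ℝ} (h : IsLarge L) (h' : IsLarge L') :
    ∃ k, IsLargeAt k L ∧ IsLargeAt k L' := by
  obtain ⟨k, hk⟩ := h
  obtain ⟨m, hm⟩ := h'
  exact ⟨max k m, hk.mono (le_max_left _ _), hm.mono (le_max_right _ _)⟩

theorem IsLarge.add {L L' : HahnSeries TM ℝ} (h : IsLarge L) (h' : IsLarge L') :
    IsLarge (L + L') := by
  obtain ⟨k, h1, h2⟩ := h.common h'
  exact ⟨k, h1.add h2⟩

theorem IsLarge.smul {L : HahnSeries TM ℝ} (h : IsLarge L) (c : ℝ) : IsLarge (c • L) := by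
  obtain ⟨k, h1⟩ := h
  exact ⟨k, h1.smul c⟩

theorem isLarge_zero : IsLarge 0 := ⟨0, isLargeAt_zero 0⟩

theorem IsLarge.neg {L : HahnSeries TM ℝ} (h : IsLarge L) : IsLarge (-L) := by
  obtain ⟨k, h1⟩ := h
  exact ⟨k, h1.neg⟩

theorem IsLarge.sub {L L' : HahnSeries TM ℝ} (h : IsLarge L) (h' : IsLarge L') :
    IsLarge (L - L') := by
  rw [sub_eq_add_neg]
  exact h.add h'.neg

theorem expM_add {L L' : HahnSeries TM ℝ} (h : IsLarge L) (h' : IsLarge L') :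
    expM (L + L') = expM L + expM L' := by
  obtain ⟨k, ⟨L, rfl⟩, ⟨L', rfl⟩⟩ := h.common h'
  rw [← ιL_add, expM_ιL, expM_ιL, expM_ιL, ← map_add, ← G.mono_add, add_zero]

theorem expM_smul {L : HahnSeries TM ℝ} (h : IsLarge L) (c : ℝ) : expM (c • L) = c • expM L := by
  obtain ⟨k, L, rfl⟩ := h
  rw [← ιL_smul, expM_ιL, expM_ιL, ← map_smul, ← G.mono_smul, mul_zero]

theorem expM_zero : expM 0 = 0 := by
  have := expM_smul isLarge_zero 0
  rwa [zero_smul, smul_zero] at this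

theorem expM_neg {L : HahnSeries TM ℝ} (h : IsLarge L) : expM (-L) = -expM L := by
  rw [← series_neg_one_smul, expM_smul h, neg_one_smul]

theorem expM_sub {L L' : HahnSeries TM ℝ} (h : IsLarge L) (h' : IsLarge L') :
    expM (L - L') = expM L - expM L' := by
  rw [sub_eq_add_neg, expM_add h h'.neg, expM_neg h', sub_eq_add_neg]

/-- The lexicographic order on monomials, read in the direct limit: the exponent L decides by the
sign of its dominant coefficient, and σ only breaks ties. -/
theorem expM_pos_iff {L : HahnSeries TM ℝ} (h : IsLarge L) (σ : ℝ) :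
    0 < expM L + xM σ ↔ 0 < L.leadingCoeff ∨ L = 0 ∧ 0 < σ := by
  obtain ⟨k, L, rfl⟩ := h
  rw [expM_ιL, ← ι_mono, (ι (k + 1)).pos_iff, ιL, ((ι k).order_leadingCoeff _).2]
  have h1 : 0 < G.mono L σ ↔ 0 < L ∨ 0 = L ∧ 0 < σ := Prod.Lex.toLex_lt_toLex
  have h2 : 0 < (ofLex L.1).leadingCoeff ↔ 0 < L := HahnSeries.leadingCoeff_pos_iff
  have h3 : (ι k).mapSeries (ofLex L.1) = 0 ↔ 0 = L := by
    rw [eq_comm (a := (0 : largeSeries (G k))), ← ιL_injective.eq_iff, ιL_zero]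
    rfl
  rw [h1, h2, h3]

theorem expM_lt_iff {L L' : HahnSeries TM ℝ} (h : IsLarge L) (h' : IsLarge L') (σ σ' : ℝ) :
    expM L + xM σ < expM L' + xM σ' ↔ 0 < (L' - L).leadingCoeff ∨ L = L' ∧ σ < σ' := by
  rw [← sub_pos, add_sub_add_comm, ← expM_sub h' h, sub_eq_add_neg (xM σ'), ← xM_neg, ← xM_add,
    expM_pos_iff (h'.sub h), sub_eq_zero, ← sub_eq_add_neg, sub_pos, eq_comm]

theorem expM_neg_iff {L : HahnSeries TM ℝ} (h : IsLarge L) (σ : ℝ) :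
    expM L + xM σ < 0 ↔ L.leadingCoeff < 0 ∨ L = 0 ∧ σ < 0 := by
  have := expM_lt_iff h isLarge_zero σ 0
  rwa [expM_zero, xM_zero, zero_add, zero_sub, leadingCoeff_neg, neg_pos] at this

theorem expM_inj {L L' : HahnSeries TM ℝ} (h : IsLarge L) (h' : IsLarge L') {σ σ' : ℝ}
    (he : expM L + xM σ = expM L' + xM σ') : L = L' ∧ σ = σ' := by
  have h1 := mt (expM_lt_iff h h' σ σ').2 he.not_lt
  have h2 := mt (expM_lt_iff h' h σ' σ).2 he.not_gt
  push Not at h1 h2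
  have h3 : L = L' := by
    have h4 : (L' - L).leadingCoeff = 0 := by
      refine le_antisymm h1.1 ?_
      have := h2.1
      rwa [← neg_sub, leadingCoeff_neg, neg_nonpos] at this
    exact (sub_eq_zero.1 (HahnSeries.leadingCoeff_eq_zero.1 h4)).symm
  exact ⟨h3, le_antisymm (h2.2 h3.symm) (h1.2 h3)⟩

/-- A transmonomial of level at most `k + 1` is `x^(-σ) exp(-L)` with `L` of level at most `k`. -/
theorem exists_expM_of_level (k : ℕ) (γ : G (k + 1)) :
    (ι (k + 1)).toLinearMap γ = expM (ιL (G.largePart γ)) + xM (G.xExponent γ) := by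
  rw [expM_ιL, ← ι_mono]
  rfl

theorem exists_expM (m : TM) : ∃ L σ, IsLarge L ∧ m = expM L + xM σ := by
  obtain ⟨k, γ, rfl⟩ := Lim.exists_of incl m
  have h := exists_expM_of_level k ((incl k).toLinearMap γ)
  exact ⟨_, _, ⟨k, _, rfl⟩, (ι_succ k γ).symm.trans h⟩

theorem IsLarge.neg_of_mem {L : HahnSeries TM ℝ} (h : IsLarge L) {v : TM} (hv : v ∈ L.support) :
    v < 0 := by
  obtain ⟨k, L, rfl⟩ := h
  rw [ιL, (ι k).support_mapSeries] at hv
  obtain ⟨u, hu, rfl⟩ := hv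
  exact (ι k).neg_iff.2 (L.2.2 u hu)

/-- A monomial `𝔪 = x^(-σ) exp(-L) ≫ 1` is larger than all the monomials of `L`. -/
theorem expM_lt_of_mem {k : ℕ} {L : HahnSeries TM ℝ} (hL : IsLargeAt k L) {σ : ℝ}
    (h : expM L + xM σ < 0) {v : TM} (hv : v ∈ L.support) : expM L + xM σ < v := by
  have hne : L ≠ 0 := by
    rintro rfl
    exact hv rfl
  have hlc : L.leadingCoeff < 0 := by
    rcases (expM_neg_iff ⟨k, hL⟩ σ).1 h with h | h
    exacts [h, absurd h.1 hne]
  induction k generalizing L σ v with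
  | zero =>
    obtain ⟨L₀, rfl⟩ := hL
    have hv' := hv
    rw [ιL, (ι 0).support_mapSeries] at hv'
    obtain ⟨a, -, rfl⟩ := hv'
    -- At level 0 the monomials of L are powers of x, and the exponential of a positive large series
    -- exceeds all of them.
    change _ < xM a
    have := (expM_lt_iff ⟨0, L₀, rfl⟩ isLarge_zero σ a).2
      (Or.inl (by rw [zero_sub, leadingCoeff_neg]; exact neg_pos.2 hlc))
    rwa [expM_zero, zero_add] at this
  | succ k ih =>
    refine lt_of_lt_of_le ?_ (HahnSeries.order_le_of_coeff_ne_zero hv)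
    have hν : L.order ∈ L.support := by
      simpa [HahnSeries.coeff_order_eq_zero] using hne
    have hνneg := IsLarge.neg_of_mem ⟨_, hL⟩ hν
    obtain ⟨L', s, hL', hνeq⟩ : ∃ L' s, IsLargeAt k L' ∧ L.order = expM L' + xM s := by
      obtain ⟨L₀, rfl⟩ := hL
      rw [ιL, (ι (k + 1)).support_mapSeries] at hν
      obtain ⟨γ, -, hγ⟩ := hν
      exact ⟨_, _, ⟨_, rfl⟩, hγ ▸ exists_expM_of_level k γ⟩
    -- The induction hypothesis is applied to the dominant monomial x^(-s) exp(-L') of L, whose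
    -- exponent L' is of lower level.
    have hlt : ∀ u ∈ L'.support, L.order < u := by
      intro u hu
      rw [hνeq] at hνneg ⊢
      have hne' : L' ≠ 0 := by
        rintro rfl
        exact hu rfl
      refine ih hL' hνneg hu hne' ?_
      rcases (expM_neg_iff ⟨k, hL'⟩ s).1 hνneg with h | h
      exacts [h, absurd h.1 hne']
    have hz : ∀ u, u ≤ L.order → L'.coeff u = 0 := fun u hu => by
      by_contra h0
      exact absurd (hlt u h0) (not_lt.2 hu)
    -- All monomials of L' are ≪ mag(L), so L' cannot influence the dominant term of L' - L.
    have hlead : (L' - L).leadingCoeff = -L.leadingCoeff := by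
      have hc : (L' - L).coeff L.order = -L.leadingCoeff := by
        rw [HahnSeries.coeff_sub, hz _ le_rfl, zero_sub, HahnSeries.leadingCoeff_eq]
      rw [← hc]
      refine (order_leadingCoeff_of ?_ fun w hw => ?_).2
      · rw [hc]
        exact (neg_pos.2 hlc).ne'
      · rw [HahnSeries.coeff_sub, hz _ hw.le, HahnSeries.coeff_eq_zero_of_lt_order hw, sub_zero]
    rw [hνeq]
    exact (expM_lt_iff ⟨_, hL⟩ ⟨_, hL'⟩ σ s).2
      (Or.inl (by rw [hlead]; exact neg_pos.2 hlc))

/-! ### Levels -/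

/-- The series of level at most `k`, as series over all log-free transmonomials. -/
def level (k : ℕ) : Subalgebra ℝ (HahnSeries TM ℝ) := (gridSeries (G k)).map (ι k).mapAlg

theorem mem_level {k : ℕ} {f : HahnSeries TM ℝ} :
    f ∈ level k ↔ ∃ g : T k, (ι k).mapSeries g.1 = f := by
  constructor
  · rintro ⟨g, hg, rfl⟩
    exact ⟨⟨g, hg⟩, rfl⟩
  · rintro ⟨g, rfl⟩
    exact ⟨g.1, g.2, rfl⟩

/-- It turns the level into a condition on the support alone, evidently stable under restriction and
grid-based sums. The converse needs grids to pull back along `ι k`. -/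
theorem mem_level_iff {k : ℕ} {f : HahnSeries TM ℝ} :
    f ∈ level k ↔ IsGrid f.support ∧ f.support ⊆ Set.range (ι k).toLinearMap := by
  constructor
  · rintro ⟨g, hg, rfl⟩
    refine ⟨(ι k).isGrid_mapSeries hg, ?_⟩
    change ((ι k).mapSeries g).support ⊆ _
    rw [(ι k).support_mapSeries]
    exact Set.image_subset_range _ _
  · rintro ⟨h1, h2⟩
    obtain ⟨g, rfl⟩ := (ι k).exists_mapSeries_eq h2
    exact ⟨g, (ι k).isGrid_of_mapSeries h1, rfl⟩

theorem level_mono {k m : ℕ} (h : k ≤ m) : level k ≤ level m := fun f hf => by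
  rw [mem_level_iff] at hf ⊢
  exact ⟨hf.1, hf.2.trans (Lim.of_range_mono incl h)⟩

theorem isLargeAt_iff {k : ℕ} {L : HahnSeries TM ℝ} :
    IsLargeAt k L ↔ L ∈ level k ∧ ∀ v ∈ L.support, v < 0 := by
  constructor
  · intro h
    refine ⟨?_, fun v hv => IsLarge.neg_of_mem ⟨k, h⟩ hv⟩
    obtain ⟨L, rfl⟩ := h
    exact ⟨_, L.2.1, rfl⟩
  · rintro ⟨⟨g, hg, rfl⟩, h2⟩
    refine ⟨⟨toLex g, hg, fun v hv => ?_⟩, rfl⟩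
    refine (ι k).neg_iff.1 (h2 _ ?_)
    change _ ∈ ((ι k).mapSeries g).support
    rw [(ι k).support_mapSeries]
    exact ⟨v, hv, rfl⟩

theorem isGrid_of_mem_level {k : ℕ} {f : HahnSeries TM ℝ} (h : f ∈ level k) : IsGrid f.support :=
  (mem_level_iff.1 h).1

theorem HasGridSum.mem_level {k : ℕ} {I : Type} {F : I → HahnSeries TM ℝ} {S : HahnSeries TM ℝ}
    (h : HasGridSum F S) (hF : ∀ i, F i ∈ level k) : S ∈ level k :=
  mem_level_iff.2 ⟨h.isGrid, h.support_subset.trans (Set.iUnion_subset fun i =>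
    (mem_level_iff.1 (hF i)).2)⟩

theorem single_mem_level {k : ℕ} (v : G k) (c : ℝ) :
    HahnSeries.single ((ι k).toLinearMap v) c ∈ level k := by
  rw [← (ι k).mapSeries_single]
  exact ⟨_, single_mem v c, rfl⟩

theorem expM_mem_range {k : ℕ} {L : HahnSeries TM ℝ} (h : IsLargeAt k L) :
    expM L ∈ Set.range (ι (k + 1)).toLinearMap := by
  obtain ⟨L, rfl⟩ := h
  exact ⟨_, (expM_ιL L).symm⟩

theorem rpow_mem_level {k : ℕ} {f : HahnSeries TM ℝ} (h : f ∈ level k) (σ : ℝ) :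
    rpow f σ ∈ level k := by
  obtain ⟨g, hg, rfl⟩ := h
  change rpow ((ι k).mapSeries g) σ ∈ level k
  rw [← (ι k).mapSeries_rpow]
  exact ⟨_, isGrid_rpow hg σ, rfl⟩

/-! ### Exponentials -/

theorem MonoEmb.mapSeries_restrict {V W : OrdVec} (φ : MonoEmb V W) (f : HahnSeries V ℝ)
    {s : Set V} {t : Set W} (h : ∀ v, φ.toLinearMap v ∈ t ↔ v ∈ s) :
    φ.mapSeries (restrict f s) = restrict (φ.mapSeries f) t := by
  classical
  ext w
  change _ = t.indicator (φ.mapSeries f).coeff w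
  by_cases hw : w ∈ Set.range φ.toLinearMap
  · obtain ⟨v, rfl⟩ := hw
    rw [φ.mapSeries_coeff]
    change s.indicator f.coeff v = _
    rw [Set.indicator_apply, Set.indicator_apply, φ.mapSeries_coeff]
    simp only [h]
  · rw [φ.mapSeries_coeff_of_notMem _ hw, Set.indicator_apply, φ.mapSeries_coeff_of_notMem _ hw,
      ite_self]

theorem restrict_add {V : OrdVec} (f g : HahnSeries V ℝ) (s : Set V) :
    restrict (f + g) s = restrict f s + restrict g s := by
  ext v
  exact congrFun (Set.indicator_add s f.coeff g.coeff) v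

theorem restrict_smul {V : OrdVec} (c : ℝ) (f : HahnSeries V ℝ) (s : Set V) :
    restrict (c • f) s = c • restrict f s := by
  ext v
  exact congrFun (Set.indicator_const_smul s c f.coeff) v

theorem restrict_zero {V : OrdVec} (s : Set V) : restrict (0 : HahnSeries V ℝ) s = 0 := by
  ext v
  exact congrFun (Set.indicator_zero' (M := ℝ) (s := s)) v

theorem restrict_neg {V : OrdVec} (f : HahnSeries V ℝ) (s : Set V) :
    restrict (-f) s = -restrict f s := by
  rw [← series_neg_one_smul, restrict_smul, series_neg_one_smul]

theorem mem_support_restrict {V : OrdVec} {f : HahnSeries V ℝ} {s : Set V} {v : V} :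
    v ∈ (restrict f s).support ↔ v ∈ s ∧ v ∈ f.support := by
  classical
  change s.indicator f.coeff v ≠ 0 ↔ _
  rw [Set.indicator_apply]
  by_cases h : v ∈ s <;> simp [h]

theorem isGrid_restrict {V : OrdVec} {f : HahnSeries V ℝ} (hf : IsGrid f.support) (s : Set V) :
    IsGrid (restrict f s).support := hf.mono fun _ h => (mem_support_restrict.1 h).2

theorem restrict_mem_level {k : ℕ} {f : HahnSeries TM ℝ} (hf : f ∈ level k) (s : Set TM) :
    restrict f s ∈ level k := by
  rw [mem_level_iff] at hf ⊢
  exact ⟨isGrid_restrict hf.1 s, fun v hv => hf.2 (mem_support_restrict.1 hv).2⟩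

/-- The large part. -/
def large (f : HahnSeries TM ℝ) : HahnSeries TM ℝ := restrict f (Set.Iio 0)

theorem isLargeAt_large {k : ℕ} {f : HahnSeries TM ℝ} (hf : f ∈ level k) :
    IsLargeAt k (large f) :=
  isLargeAt_iff.2 ⟨restrict_mem_level hf _, fun _ hv => (mem_support_restrict.1 hv).1⟩

theorem orderTop_smallTerms {V : OrdVec} (f : HahnSeries V ℝ) : 0 < (smallTerms f).orderTop :=
  orderTop_pos_iff.2 fun _ hv => (mem_support_restrict.1 hv).1

theorem large_add_const_add_small (f : HahnSeries TM ℝ) :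
    large f + HahnSeries.single 0 (f.coeff 0) + smallTerms f = f := by
  classical
  ext v
  rw [HahnSeries.coeff_add, HahnSeries.coeff_add]
  change (Set.Iio (0 : TM)).indicator f.coeff v + _ + (Set.Ioi (0 : TM)).indicator f.coeff v = _
  rcases lt_trichotomy v 0 with h | h | h
  · simp [h, h.le, HahnSeries.coeff_single_of_ne h.ne]
  · subst h
    simp
  · simp [h, h.le, HahnSeries.coeff_single_of_ne h.ne']

/-- The exponential. -/
def texp (f : HahnSeries TM ℝ) : HahnSeries TM ℝ :=
  HahnSeries.single (expM (-large f)) (Real.exp (f.coeff 0)) * sexp (smallTerms f)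

theorem ιL_largeTerms {k : ℕ} (f : T k) : ιL (largeTerms f) = large ((ι k).mapSeries f.1) :=
  (ι k).mapSeries_restrict f.1 fun _ => (ι k).neg_iff

theorem ιL_neg {k : ℕ} (L : largeSeries (G k)) : ιL (-L) = -ιL L := map_neg (ι k).mapAlg (ofLex L.1)

theorem ι_smallTerms {k : ℕ} (f : HahnSeries (G k) ℝ) :
    (ι k).mapSeries (smallTerms f) = smallTerms ((ι k).mapSeries f) :=
  (ι k).mapSeries_restrict f fun _ => (ι k).pos_iff

/-- The bridge from exponentials defined level by level to the single function `texp` over `TM`. -/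
theorem ι_expSeries {k : ℕ} (f : T k) :
    (ι (k + 1)).mapSeries (expSeries f) = texp ((ι k).mapSeries f.1) := by
  rw [expSeries, (ι (k + 1)).mapSeries_mul, (ι (k + 1)).mapSeries_single,
    (ι (k + 1)).mapSeries_heval, ι_mapSeries_succ, ι_smallTerms, ← expM_ιL, ιL_neg, ιL_largeTerms,
    texp, sexp]
  congr 3
  exact ((ι k).mapSeries_coeff f.1 0).symm.trans (by rw [map_zero])

theorem isGrid_expSeries {k : ℕ} (f : T k) : IsGrid (expSeries f).support :=
  isGrid_mul (isGrid_single _ _)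
    (isGrid_heval ((incl k).isGrid_mapSeries (isGrid_restrict f.2 _)) _)

theorem texp_mem_level {k : ℕ} {f : HahnSeries TM ℝ} (hf : f ∈ level k) :
    texp f ∈ level (k + 1) := by
  obtain ⟨g, rfl⟩ := mem_level.1 hf
  rw [← ι_expSeries]
  exact ⟨_, isGrid_expSeries g, rfl⟩

/-- Membership in some level: the log-free transseries. -/
def LogFree (f : HahnSeries TM ℝ) : Prop := ∃ k, f ∈ level k

theorem LogFree.common {f g : HahnSeries TM ℝ} (hf : LogFree f) (hg : LogFree g) :
    ∃ k, f ∈ level k ∧ g ∈ level k := by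
  obtain ⟨k, hk⟩ := hf
  obtain ⟨m, hm⟩ := hg
  exact ⟨max k m, level_mono (le_max_left _ _) hk, level_mono (le_max_right _ _) hm⟩

theorem LogFree.isLarge {f : HahnSeries TM ℝ} (hf : LogFree f) : IsLarge (large f) := by
  obtain ⟨k, hk⟩ := hf
  exact ⟨k, isLargeAt_large hk⟩

theorem LogFree.isGrid {f : HahnSeries TM ℝ} (hf : LogFree f) : IsGrid f.support := by
  obtain ⟨k, hk⟩ := hf
  exact isGrid_of_mem_level hk

theorem IsLarge.logFree {L : HahnSeries TM ℝ} (h : IsLarge L) : LogFree L := by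
  obtain ⟨k, hk⟩ := h
  exact ⟨k, (isLargeAt_iff.1 hk).1⟩

theorem order_texp (f : HahnSeries TM ℝ) :
    (texp f).order = expM (-large f) ∧ (texp f).leadingCoeff = Real.exp (f.coeff 0) :=
  order_single_mul_sexp _ (Real.exp_pos _).ne' (orderTop_smallTerms f)

theorem leadingCoeff_texp_pos (f : HahnSeries TM ℝ) : 0 < (texp f).leadingCoeff := by
  rw [(order_texp f).2]
  exact Real.exp_pos _

theorem large_add (f g : HahnSeries TM ℝ) : large (f + g) = large f + large g := restrict_add f g _

theorem large_smul (c : ℝ) (f : HahnSeries TM ℝ) : large (c • f) = c • large f :=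
  restrict_smul c f _

theorem texp_add {f g : HahnSeries TM ℝ} (hf : LogFree f) (hg : LogFree g) :
    texp (f + g) = texp f * texp g := by
  rw [texp, texp, texp, large_add, HahnSeries.coeff_add, Real.exp_add, neg_add,
    expM_add hf.isLarge.neg hg.isLarge.neg, ← HahnSeries.single_mul_single]
  have h : smallTerms (f + g) = smallTerms f + smallTerms g := restrict_add f g _
  rw [h, sexp_add (orderTop_smallTerms f) (orderTop_smallTerms g)]
  ring

theorem texp_zero : texp 0 = 1 := by
  have h1 : large 0 = 0 := restrict_zero _
  have h2 : smallTerms (0 : HahnSeries TM ℝ) = 0 := restrict_zero _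
  rw [texp, h1, h2, neg_zero, expM_zero, sexp_zero, HahnSeries.coeff_zero, Real.exp_zero,
    HahnSeries.single_zero_one, one_mul]

theorem rpow_texp {f : HahnSeries TM ℝ} (hf : LogFree f) (σ : ℝ) :
    rpow (texp f) σ = texp (σ • f) := by
  rw [texp, rpow_single_mul_sexp _ (Real.exp_pos _) (orderTop_smallTerms f), texp, large_smul]
  have h : smallTerms (σ • f) = σ • smallTerms f := restrict_smul σ f _
  have h2 : -(σ • large f) = σ • -large f := (smul_neg σ (large f)).symm
  rw [h, h2, expM_smul hf.isLarge.neg, HahnSeries.coeff_smul, smul_eq_mul, mul_comm σ,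
    Real.exp_mul]

/-- The dominant monomial of the exponential determines the large part, its coefficient the constant
term, and the remaining factor the small part. -/
theorem texp_injective {f g : HahnSeries TM ℝ} (hf : LogFree f) (hg : LogFree g)
    (h : texp f = texp g) : f = g := by
  have h1 := order_texp f
  rw [h, (order_texp g).1, (order_texp g).2] at h1
  have h2 := (expM_inj hg.isLarge.neg hf.isLarge.neg (σ := 0) (σ' := 0) (by rw [h1.1])).1
  have h3 := Real.exp_injective h1.2
  rw [texp, texp, h2, h3] at h
  have h4 := sexp_injective (orderTop_smallTerms f) (orderTop_smallTerms g)
    (mul_left_cancel₀ (HahnSeries.single_ne_zero (Real.exp_pos _).ne') h)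
  rw [← large_add_const_add_small f, ← large_add_const_add_small g, h3, h4, neg_inj.1 h2]

/-! ### Composition with the exponential -/

theorem order_add_of_lt {V : OrdVec} {f g : HahnSeries V ℝ} (hf : f ≠ 0)
    (h : ∀ u ∈ g.support, f.order < u) :
    (f + g).order = f.order ∧ (f + g).leadingCoeff = f.leadingCoeff := by
  have hz : ∀ u, u ≤ f.order → g.coeff u = 0 := fun u hu => by
    by_contra h0
    exact absurd (h u h0) (not_lt.2 hu)
  have hc : (f + g).coeff f.order = f.leadingCoeff := by
    rw [HahnSeries.coeff_add, hz _ le_rfl, add_zero, HahnSeries.leadingCoeff_eq]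
  rw [← hc]
  refine order_leadingCoeff_of ?_ fun w hw => ?_
  · rw [hc]
    exact HahnSeries.leadingCoeff_ne_zero.2 hf
  · rw [HahnSeries.coeff_add, hz _ hw.le, HahnSeries.coeff_eq_zero_of_lt_order hw, add_zero]

theorem order_mem_support {V : OrdVec} {f : HahnSeries V ℝ} (hf : f ≠ 0) : f.order ∈ f.support := by
  simpa [HahnSeries.coeff_order_eq_zero] using hf

theorem leadingCoeff_smul {V : OrdVec} (c : ℝ) (f : HahnSeries V ℝ) :
    (c • f).leadingCoeff = c * f.leadingCoeff := by
  rw [← HahnSeries.C_mul_eq_smul, HahnSeries.leadingCoeff_mul]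
  exact congrArg (· * _) HahnSeries.leadingCoeff_of_single

/-- A linear map that preserves positivity, as an embedding. -/
def MonoEmb.ofPos {V W : OrdVec} (f : V →ₗ[ℝ] W) (h : ∀ v, 0 < v → 0 < f v) : MonoEmb V W where
  toLinearMap := f
  strictMono a b hab := by
    have := h (b - a) (sub_pos.2 hab)
    rw [map_sub, sub_pos] at this
    exact this

/-- The transseries `x`. -/
def Xs : HahnSeries TM ℝ := HahnSeries.single (xM (-1)) 1

theorem ι_X : (ι 0).mapSeries X.1 = Xs := (ι 0).mapSeries_single _ _

theorem xM_neg_one_neg : xM (-1) < 0 := by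
  have := (expM_neg_iff isLarge_zero (-1)).2 (Or.inr ⟨rfl, by norm_num⟩)
  rwa [expM_zero, zero_add] at this

theorem isLargeAt_Xs : IsLargeAt 0 Xs := ⟨XLarge, ι_X⟩

theorem support_smul_Xs (σ : ℝ) {u : TM} (hu : u ∈ (σ • Xs).support) : u = xM (-1) := by
  by_contra h
  exact hu (by rw [HahnSeries.coeff_smul, Xs, HahnSeries.coeff_single_of_ne h, smul_zero])

/-- An embedding whose values are exponentials of large series of level at most `n`. -/
def IsExpEmb (n : ℕ) (φ : MonoEmb (G n) TM) : Prop :=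
  ∀ v, ∃ Y, IsLargeAt n Y ∧ φ.toLinearMap v = expM Y

theorem IsExpEmb.isLargeAt {n : ℕ} {φ : MonoEmb (G n) TM} (h : IsExpEmb n φ)
    (L : largeSeries (G n)) (σ : ℝ) :
    IsLargeAt (n + 1) (φ.mapSeries (ofLex L.1) + σ • Xs) := by
  refine IsLargeAt.add (isLargeAt_iff.2 ⟨mem_level_iff.2 ⟨φ.isGrid_mapSeries L.2.1, ?_⟩, ?_⟩)
    ((isLargeAt_Xs.mono (Nat.zero_le _)).smul σ)
  · rw [φ.support_mapSeries]
    rintro _ ⟨v, -, rfl⟩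
    obtain ⟨Y, hY, h⟩ := h v
    rw [h]
    exact expM_mem_range hY
  · rw [φ.support_mapSeries]
    rintro _ ⟨v, hv, rfl⟩
    exact φ.neg_iff.2 (L.2.2 v hv)

/-- If L ≠ 0, the dominant monomial of φ(L) is the exponential of a large positive series, hence ≫
x, and the term σx cannot affect the sign. This is why the induction carries the property
`IsExpEmb`. -/
theorem IsExpEmb.leadingCoeff_pos {n : ℕ} {φ : MonoEmb (G n) TM} (h : IsExpEmb n φ)
    (L : largeSeries (G n)) (σ : ℝ) (hL : 0 < L ∨ 0 = L ∧ 0 < σ) :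
    0 < (φ.mapSeries (ofLex L.1) + σ • Xs).leadingCoeff := by
  rcases hL with hL | ⟨rfl, hσ⟩
  · have hL' : 0 < (ofLex L.1).leadingCoeff := HahnSeries.leadingCoeff_pos_iff.2 hL
    have hne : ofLex L.1 ≠ 0 := leadingCoeff_pos_ne_zero hL'
    obtain ⟨h1, h2⟩ := φ.order_leadingCoeff (ofLex L.1)
    have hneg : φ.toLinearMap (ofLex L.1).order < 0 :=
      φ.neg_iff.2 (L.2.2 _ (order_mem_support hne))
    rw [(order_add_of_lt (leadingCoeff_pos_ne_zero (h2.symm ▸ hL')) fun u hu => ?_).2, h2]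
    · exact hL'
    · rw [support_smul_Xs σ hu, h1]
      obtain ⟨Y, hY, hY'⟩ := h (ofLex L.1).order
      rw [hY'] at hneg ⊢
      have h3 := (expM_neg_iff ⟨n, hY⟩ 0).1 (by rwa [xM_zero, add_zero])
      have h4 : Y.leadingCoeff < 0 := by
        rcases h3 with h3 | h3
        exacts [h3, absurd h3.2 (lt_irrefl _)]
      have := (expM_lt_iff ⟨n, hY⟩ isLarge_zero 0 (-1)).2
        (Or.inl (by rw [zero_sub, leadingCoeff_neg]; exact neg_pos.2 h4))
      rwa [xM_zero, add_zero, expM_zero, zero_add] at this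
  · have : φ.mapSeries (ofLex (0 : largeSeries (G n)).1) = 0 := map_zero φ.mapAlg
    rw [this, zero_add, leadingCoeff_smul, Xs, HahnSeries.leadingCoeff_of_single, mul_one]
    exact hσ

theorem expM_pos {L : HahnSeries TM ℝ} (h : IsLarge L) (h' : 0 < L.leadingCoeff) : 0 < expM L := by
  have := (expM_pos_iff h 0).2 (Or.inl h')
  rwa [xM_zero, add_zero] at this

theorem series_add_smul {V : OrdVec} (a b : ℝ) (f : HahnSeries V ℝ) :
    (a + b) • f = a • f + b • f := add_smul a b f

theorem series_smul_add {V : OrdVec} (a : ℝ) (f g : HahnSeries V ℝ) :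
    a • (f + g) = a • f + a • g := smul_add a f g

/-- `x^(-σ) exp(-L) ↦ exp(-φ(L) - σ x)`. -/
def IsExpEmb.succ {n : ℕ} {φ : MonoEmb (G n) TM} (h : IsExpEmb n φ) : MonoEmb (G (n + 1)) TM :=
  MonoEmb.ofPos
    { toFun := fun γ => expM (φ.mapSeries (ofLex (G.largePart γ).1) + G.xExponent γ • Xs)
      map_add' := fun a b => by
        rw [← expM_add ⟨_, h.isLargeAt _ _⟩ ⟨_, h.isLargeAt _ _⟩]
        congr 1
        have h1 : φ.mapSeries (ofLex (G.largePart (a + b)).1) =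
            φ.mapSeries (ofLex (G.largePart a).1) + φ.mapSeries (ofLex (G.largePart b).1) :=
          map_add φ.mapAlg (ofLex (G.largePart a).1) (ofLex (G.largePart b).1)
        have h2 : G.xExponent (a + b) = G.xExponent a + G.xExponent b := rfl
        rw [h1, h2, series_add_smul]
        abel
      map_smul' := fun c a => by
        rw [RingHom.id_apply, ← expM_smul ⟨_, h.isLargeAt _ _⟩]
        congr 1
        have h1 : φ.mapSeries (ofLex (G.largePart (c • a)).1) =
            c • φ.mapSeries (ofLex (G.largePart a).1) :=
          map_smul φ.mapAlg c (ofLex (G.largePart a).1)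
        have h2 : G.xExponent (c • a) = c * G.xExponent a := rfl
        rw [h1, h2, series_smul_add, series_smul_smul] }
    fun γ hγ => expM_pos ⟨_, h.isLargeAt _ _⟩
      (h.leadingCoeff_pos _ _ (Prod.Lex.toLex_lt_toLex.1 hγ))

theorem isLarge_smul_Xs (σ : ℝ) : IsLarge (σ • Xs) := ⟨0, isLargeAt_Xs.smul σ⟩

/-- The composition of monomials of level at most `n` with the exponential. -/
def expEmb : (n : ℕ) → {φ : MonoEmb (G n) TM // IsExpEmb n φ}
  | 0 => ⟨MonoEmb.ofPos
      { toFun := fun σ => expM (G.powExponent σ • Xs)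
        map_add' := fun a b => by
          rw [← expM_add (isLarge_smul_Xs _) (isLarge_smul_Xs _), ← series_add_smul]
          rfl
        map_smul' := fun c a => by
          rw [RingHom.id_apply, ← expM_smul (isLarge_smul_Xs _), series_smul_smul]
          rfl }
      fun σ hσ => expM_pos (isLarge_smul_Xs _) (by
        rw [leadingCoeff_smul, Xs, HahnSeries.leadingCoeff_of_single, mul_one]
        exact hσ),
      fun σ => ⟨_, isLargeAt_Xs.smul _, rfl⟩⟩
  | n + 1 => ⟨(expEmb n).2.succ, fun _ => ⟨_, (expEmb n).2.isLargeAt _ _, rfl⟩⟩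

theorem expEmb_succ (n : ℕ) (γ : G (n + 1)) : (expEmb (n + 1)).1.toLinearMap γ =
    expM ((expEmb n).1.mapSeries (ofLex (G.largePart γ).1) + G.xExponent γ • Xs) := rfl

theorem expEmb_incl (n : ℕ) (v : G n) :
    (expEmb (n + 1)).1.toLinearMap ((incl n).toLinearMap v) = (expEmb n).1.toLinearMap v := by
  induction n with
  | zero =>
    have h : (expEmb 0).1.mapSeries (ofLex (0 : largeSeries (G 0)).1) = 0 :=
      map_zero (expEmb 0).1.mapAlg
    change expM ((expEmb 0).1.mapSeries (ofLex (0 : largeSeries (G 0)).1) +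
      G.powExponent v • Xs) = _
    rw [h, zero_add]
    rfl
  | succ n ih =>
    have h : ((expEmb (n + 1)).1.comp (incl n)) = (expEmb n).1 := MonoEmb.ext ih
    change expM ((expEmb (n + 1)).1.mapSeries ((incl n).mapSeries (ofLex (G.largePart v).1)) +
      G.xExponent v • Xs) = _
    rw [← MonoEmb.mapSeries_comp, h]
    rfl

/-- The composition of monomials with the exponential. -/
def E : MonoEmb TM TM := Lim.liftEmb (fun n => (expEmb n).1) expEmb_incl

theorem E_ι (n : ℕ) (v : G n) : E.toLinearMap ((ι n).toLinearMap v) = (expEmb n).1.toLinearMap v :=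
  Lim.liftEmb_of _ expEmb_incl n v

theorem E_comp_ι (n : ℕ) : E.comp (ι n) = (expEmb n).1 := MonoEmb.ext (E_ι n)

theorem E_mapSeries_ι (n : ℕ) (f : HahnSeries (G n) ℝ) :
    E.mapSeries ((ι n).mapSeries f) = (expEmb n).1.mapSeries f := by
  rw [← MonoEmb.mapSeries_comp, E_comp_ι]

theorem E_mem_level {n : ℕ} {f : HahnSeries TM ℝ} (hf : f ∈ level n) :
    E.mapSeries f ∈ level (n + 1) := by
  obtain ⟨g, rfl⟩ := mem_level.1 hf
  refine mem_level_iff.2 ⟨E.isGrid_mapSeries ((ι n).isGrid_mapSeries g.2), ?_⟩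
  rw [E_mapSeries_ι, MonoEmb.support_mapSeries]
  rintro _ ⟨v, -, rfl⟩
  obtain ⟨Y, hY, h⟩ := (expEmb n).2 v
  rw [h]
  exact expM_mem_range hY

theorem LogFree.E {f : HahnSeries TM ℝ} (hf : LogFree f) : LogFree (E.mapSeries f) := by
  obtain ⟨k, hk⟩ := hf
  exact ⟨_, E_mem_level hk⟩

theorem IsLarge.E {L : HahnSeries TM ℝ} (h : IsLarge L) : IsLarge (E.mapSeries L) := by
  obtain ⟨k, hk⟩ := h
  rw [isLargeAt_iff] at hk
  refine ⟨k + 1, isLargeAt_iff.2 ⟨E_mem_level hk.1, ?_⟩⟩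
  rw [MonoEmb.support_mapSeries]
  rintro _ ⟨v, hv, rfl⟩
  exact Transseries.E.neg_iff.2 (hk.2 v hv)

/-- The composite exp(-(L ∘ exp) - σx) is a pure exponential: the power of x has moved into the
exponent. -/
theorem E_expM_add {L : HahnSeries TM ℝ} (h : IsLarge L) (σ : ℝ) :
    E.toLinearMap (expM L + xM σ) = expM (E.mapSeries L + σ • Xs) := by
  obtain ⟨k, L, rfl⟩ := h
  rw [expM_ιL, ← ι_mono, E_ι, expEmb_succ, ιL, E_mapSeries_ι]
  rfl

theorem series_zero_smul {V : OrdVec} (f : HahnSeries V ℝ) : (0 : ℝ) • f = 0 := zero_smul ℝ f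

theorem E_expM {L : HahnSeries TM ℝ} (h : IsLarge L) :
    E.toLinearMap (expM L) = expM (E.mapSeries L) := by
  have := E_expM_add h 0
  rwa [xM_zero, add_zero, series_zero_smul, add_zero] at this

theorem E_large (f : HahnSeries TM ℝ) : E.mapSeries (large f) = large (E.mapSeries f) :=
  E.mapSeries_restrict f fun _ => E.neg_iff

theorem MonoEmb.mapSeries_neg {V W : OrdVec} (φ : MonoEmb V W) (f : HahnSeries V ℝ) :
    φ.mapSeries (-f) = -φ.mapSeries f := map_neg φ.mapAlg f

theorem MonoEmb.mapSeries_add {V W : OrdVec} (φ : MonoEmb V W) (f g : HahnSeries V ℝ) :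
    φ.mapSeries (f + g) = φ.mapSeries f + φ.mapSeries g := map_add φ.mapAlg f g

theorem E_texp {f : HahnSeries TM ℝ} (hf : LogFree f) :
    E.mapSeries (texp f) = texp (E.mapSeries f) := by
  rw [texp, E.mapSeries_mul, E.mapSeries_single, sexp, E.mapSeries_heval, E_expM hf.isLarge.neg,
    E.mapSeries_neg, E_large, texp, sexp]
  congr 3
  · exact (E.mapSeries_coeff f 0).symm.trans (by rw [map_zero])
  · exact E.mapSeries_restrict f fun _ => E.pos_iff

/-! ### Logarithms -/

/-- The splitting into large, constant and small parts is unique, so any given splitting can be used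
to compute the exponential. -/
theorem texp_add_const_add_small {L : HahnSeries TM ℝ} (h : IsLarge L) (c : ℝ)
    {s : HahnSeries TM ℝ} (hs : 0 < s.orderTop) :
    texp (L + HahnSeries.single 0 c + s) =
      HahnSeries.single (expM (-L)) (Real.exp c) * sexp s := by
  have hs' := orderTop_pos_iff.1 hs
  have hsz : ∀ v, v ≤ 0 → s.coeff v = 0 := fun v hv => by
    by_contra h0
    exact absurd (hs' v h0) (not_lt.2 hv)
  have hLz : ∀ v, 0 ≤ v → L.coeff v = 0 := fun v hv => by
    by_contra h0
    exact absurd (h.neg_of_mem h0) (not_lt.2 hv)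
  have h1 : large (L + HahnSeries.single 0 c + s) = L := by
    classical
    ext v
    change (Set.Iio (0 : TM)).indicator _ v = _
    rw [Set.indicator_apply]
    by_cases hv : v < 0
    · simp [hv, hsz v hv.le, HahnSeries.coeff_single_of_ne hv.ne]
    · rw [if_neg (show v ∉ Set.Iio (0 : TM) from hv), hLz v (not_lt.1 hv)]
  have h2 : smallTerms (L + HahnSeries.single 0 c + s) = s := by
    classical
    ext v
    change (Set.Ioi (0 : TM)).indicator _ v = _
    rw [Set.indicator_apply]
    by_cases hv : 0 < v
    · simp [hv, hLz v hv.le, HahnSeries.coeff_single_of_ne hv.ne']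
    · rw [if_neg (show v ∉ Set.Ioi (0 : TM) from hv), hsz v (not_lt.1 hv)]
  have h3 : (L + HahnSeries.single 0 c + s).coeff 0 = c := by
    simp [hsz 0 le_rfl, hLz 0 le_rfl]
  rw [texp, h1, h2, h3]

theorem logNormalized_mem_level {k : ℕ} {f : HahnSeries TM ℝ} (h : f ∈ level k) :
    logNormalized f ∈ level k := by
  obtain ⟨g, hg, rfl⟩ := h
  change logNormalized ((ι k).mapSeries g) ∈ level k
  rw [← (ι k).mapSeries_logNormalized]
  exact ⟨_, isGrid_logNormalized hg, rfl⟩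

/-- `mag(g) ≫ 1` and `dom(g) > 0`. -/
def LP (g : HahnSeries TM ℝ) : Prop := g.order < 0 ∧ 0 < g.leadingCoeff

theorem LP.E {g : HahnSeries TM ℝ} (h : LP g) : LP (E.mapSeries g) := by
  obtain ⟨h1, h2⟩ := Transseries.E.order_leadingCoeff g
  rw [LP, h1, h2]
  exact ⟨Transseries.E.neg_iff.2 h.1, h.2⟩

theorem const_mem_level (k : ℕ) (c : ℝ) : HahnSeries.single (0 : TM) c ∈ level k := by
  rw [← map_zero (ι k).toLinearMap]
  exact single_mem_level 0 c

/-- After composition with the exponential, large positive series have logarithms. -/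
theorem exists_texp_eq {g : HahnSeries TM ℝ} (hg : LogFree g) (h : LP g) :
    ∃ y, LogFree y ∧ LP y ∧ texp y = E.mapSeries g := by
  obtain ⟨L, σ, hL, hm⟩ := exists_expM g.order
  obtain ⟨h1, h2⟩ := E.order_leadingCoeff g
  have hlc : 0 < (E.mapSeries g).leadingCoeff := h2.symm ▸ h.2
  rw [hm, E_expM_add hL] at h1
  -- The dominant monomial of g ∘ exp is exp(-Y). It has no separate factor x^(-σ), so its logarithm
  -- -Y is log-free.
  set Y := E.mapSeries L + σ • Xs with hY
  have hYl : IsLarge Y := hL.E.add (isLarge_smul_Xs σ)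
  have hs := orderTop_logNormalized hlc
  have hYlc : Y.leadingCoeff < 0 := by
    have h3 : (E.mapSeries g).order < 0 := h.E.1
    rw [h1] at h3
    have h4 := (expM_neg_iff hYl 0).1 (by rwa [xM_zero, add_zero])
    rcases h4 with h4 | h4
    exacts [h4, absurd h4.2 (lt_irrefl _)]
  have hlc' : 0 < (-Y).leadingCoeff := by
    rw [leadingCoeff_neg]
    exact neg_pos.2 hYlc
  have hne := leadingCoeff_pos_ne_zero hlc'
  have hneg : (-Y).order < 0 := hYl.neg.neg_of_mem (order_mem_support hne)
  -- The logarithm of c exp(-Y)(1 + s) is -Y + log c + log(1 + s). The large positive series -Y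
  -- provides its dominant term.
  refine ⟨-Y + HahnSeries.single 0 (Real.log g.leadingCoeff) + logNormalized (E.mapSeries g),
    ?_, ?_, ?_⟩
  · obtain ⟨k, h3, h4⟩ := hYl.neg.logFree.common hg.E
    exact ⟨k, add_mem (add_mem h3 (const_mem_level k _)) (logNormalized_mem_level h4)⟩
  · have h3 := order_add_of_lt (g := HahnSeries.single 0 (Real.log g.leadingCoeff)) hne
      fun u hu => by rwa [HahnSeries.eq_of_mem_support_single hu]
    have h4 := order_add_of_lt (f := -Y + HahnSeries.single 0 (Real.log g.leadingCoeff))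
      (g := logNormalized (E.mapSeries g)) (leadingCoeff_pos_ne_zero (h3.2.symm ▸ hlc'))
      fun u hu => by
        rw [h3.1]
        exact hneg.trans (orderTop_pos_iff.1 hs u hu)
    exact ⟨by rw [h4.1, h3.1]; exact hneg, by rw [h4.2, h3.2]; exact hlc'⟩
  · rw [texp_add_const_add_small hYl.neg _ hs, neg_neg, Real.exp_log h.2]
    conv_rhs => rw [eq_single_mul_sexp hlc, h1, h2]

/-! ### Extension of maps of monomials: algebra -/

section Extend

variable {V W U : OrdVec}

/-- Reindexing changes neither the union of supports nor the coefficient sums. Without the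
well-ordering condition both sides take the default value 0, so no summability is assumed. -/
theorem gsum_eq_of_injective {I J : Type} (e : I → J) (he : Function.Injective e)
    {F : I → HahnSeries V ℝ} {F' : J → HahnSeries V ℝ} (h : ∀ i, F' (e i) = F i)
    (h0 : ∀ j ∉ Set.range e, F' j = 0) : gsum F' = gsum F := by
  have hU : (⋃ j, (F' j).support) = ⋃ i, (F i).support := by
    refine subset_antisymm (Set.iUnion_subset fun j => ?_) (Set.iUnion_subset fun i => ?_)
    · by_cases hj : j ∈ Set.range e
      · obtain ⟨i, rfl⟩ := hj
        rw [h]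
        exact Set.subset_iUnion (fun i => (F i).support) i
      · rw [h0 j hj, HahnSeries.support_zero]
        exact Set.empty_subset _
    · rw [← h]
      exact Set.subset_iUnion (fun j => (F' j).support) (e i)
  have hc : ∀ v, ∑ᶠ j, (F' j).coeff v = ∑ᶠ i, (F i).coeff v := fun v => by
    have h1 : ∀ i, (F i).coeff v = (F' (e i)).coeff v := fun i => by rw [h]
    simp only [h1]
    rw [← finsum_mem_range (f := fun j => (F' j).coeff v) he]
    refine finsum_congr fun j => ?_
    classical
    by_cases hj : j ∈ Set.range e
    · rw [finsum_eq_if, if_pos hj]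
    · rw [finsum_eq_if, if_neg hj, h0 j hj, HahnSeries.coeff_zero]
  by_cases hP : (⋃ i, (F i).support).IsPWO
  · have hP' := hP
    rw [← hU] at hP'
    rw [gsum, gsum, dif_pos hP, dif_pos hP']
    exact HahnSeries.ext (funext hc)
  · have hP' := hP
    rw [← hU] at hP'
    rw [gsum, gsum, dif_neg hP, dif_neg hP']

theorem extend_mapSeries (φ : MonoEmb U V) (Φ : V → HahnSeries W ℝ) (f : HahnSeries U ℝ) :
    extend Φ (φ.mapSeries f) = extend (fun u => Φ (φ.toLinearMap u)) f := by
  refine gsum_eq_of_injective φ.toLinearMap φ.injective (fun i => ?_) fun j hj => ?_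
  · rw [φ.mapSeries_coeff]
  · rw [φ.mapSeries_coeff_of_notMem _ hj, series_zero_smul]

theorem extend_zero (Φ : V → HahnSeries W ℝ) : extend Φ 0 = 0 := by
  ext w
  rw [extend, gsum]
  split_ifs
  · exact finsum_eq_zero_of_forall_eq_zero fun γ => by simp
  · rfl

theorem HasGridSum.add {I : Type} {F F' : I → HahnSeries V ℝ} {S S' : HahnSeries V ℝ}
    (h : HasGridSum F S) (h' : HasGridSum F' S') :
    HasGridSum (fun i => F i + F' i) (S + S') := by
  refine ⟨(h.1.union h'.1).mono (Set.iUnion_subset fun i => ?_), fun v => ?_, fun v => ?_⟩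
  · exact (HahnSeries.support_add_subset _ _).trans (Set.union_subset_union
      (Set.subset_iUnion (fun i => (F i).support) i)
      (Set.subset_iUnion (fun i => (F' i).support) i))
  · refine ((h.2.1 v).union (h'.2.1 v)).subset fun i hi => ?_
    by_contra hcon
    simp only [Set.mem_union, Set.mem_ofPred_eq, not_or, not_not] at hcon
    exact hi (by rw [HahnSeries.coeff_add, hcon.1, hcon.2, add_zero])
  · simp only [HahnSeries.coeff_add]
    rw [h.2.2, h'.2.2, finsum_add_distrib (h.2.1 v) (h'.2.1 v)]

theorem HasGridSum.smul {I : Type} {F : I → HahnSeries V ℝ} {S : HahnSeries V ℝ}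
    (h : HasGridSum F S) (c : ℝ) : HasGridSum (fun i => c • F i) (c • S) := by
  refine ⟨h.1.mono (Set.iUnion_mono fun i => ?_), fun v => ?_, fun v => ?_⟩
  · intro v hv h0
    exact hv (by rw [HahnSeries.coeff_smul, h0, smul_zero])
  · refine (h.2.1 v).subset fun i hi h0 => hi ?_
    rw [HahnSeries.coeff_smul, h0, smul_zero]
  · simp only [HahnSeries.coeff_smul, smul_eq_mul]
    rw [h.2.2]
    exact mul_finsum _ _

theorem extend_single (Φ : V → HahnSeries W ℝ) (hΦ : ∀ v, IsGrid (Φ v).support) (v : V) (c : ℝ) :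
    extend Φ (HahnSeries.single v c) = c • Φ v := by
  have h0 : ∀ γ, γ ≠ v → (HahnSeries.single v c).coeff γ • Φ γ = 0 := fun γ hγ => by
    rw [HahnSeries.coeff_single_of_ne hγ, series_zero_smul]
  refine HasGridSum.gsum_eq ⟨(hΦ v).mono (Set.iUnion_subset fun γ => ?_), fun w => ?_, fun w => ?_⟩
  · by_cases hγ : γ = v
    · subst hγ
      intro w hw h1
      exact hw (by rw [HahnSeries.coeff_smul, h1, smul_zero])
    · dsimp only
      rw [h0 γ hγ, HahnSeries.support_zero]
      exact Set.empty_subset _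
  · refine (Set.finite_singleton v).subset fun γ hγ => ?_
    by_contra h1
    refine hγ ?_
    dsimp only
    rw [h0 γ h1, HahnSeries.coeff_zero]
  · rw [finsum_eq_single _ v fun γ hγ => by dsimp only; rw [h0 γ hγ, HahnSeries.coeff_zero]]
    dsimp only
    rw [HahnSeries.coeff_single_same]

/-- A map of monomials whose strongly linear extension exists on grid-based series. -/
def Extendable (Φ : V → HahnSeries W ℝ) : Prop :=
  ∀ f : HahnSeries V ℝ, IsGrid f.support → GridSummable fun γ => f.coeff γ • Φ γ

theorem Extendable.hasGridSum {Φ : V → HahnSeries W ℝ} (h : Extendable Φ) {f : HahnSeries V ℝ}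
    (hf : IsGrid f.support) : HasGridSum (fun γ => f.coeff γ • Φ γ) (extend Φ f) :=
  (h f hf).hasGridSum

theorem Extendable.add {Φ : V → HahnSeries W ℝ} (h : Extendable Φ) {f g : HahnSeries V ℝ}
    (hf : IsGrid f.support) (hg : IsGrid g.support) :
    extend Φ (f + g) = extend Φ f + extend Φ g := by
  refine HasGridSum.gsum_eq ?_
  have := (h.hasGridSum hf).add (h.hasGridSum hg)
  simpa only [HahnSeries.coeff_add, series_add_smul] using this

theorem Extendable.smul {Φ : V → HahnSeries W ℝ} (h : Extendable Φ) {f : HahnSeries V ℝ}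
    (hf : IsGrid f.support) (c : ℝ) : extend Φ (c • f) = c • extend Φ f := by
  refine HasGridSum.gsum_eq ?_
  have := (h.hasGridSum hf).smul c
  simpa only [HahnSeries.coeff_smul, series_smul_smul, smul_eq_mul] using this

theorem IsSubst.extendable {Φ : V → HahnSeries W ℝ} (h : IsSubst Φ) : Extendable Φ :=
  fun _ hf => h.gridSummable hf

theorem MonoEmb.mapSeries_smul (φ : MonoEmb V W) (c : ℝ) (f : HahnSeries V ℝ) :
    φ.mapSeries (c • f) = c • φ.mapSeries f := map_smul φ.mapAlg c f

theorem Extendable.mapSeries (φ : MonoEmb W U) {Φ : V → HahnSeries W ℝ} (h : Extendable Φ)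
    {f : HahnSeries V ℝ} (hf : IsGrid f.support) :
    φ.mapSeries (extend Φ f) = extend (fun v => φ.mapSeries (Φ v)) f := by
  refine (HasGridSum.gsum_eq ?_).symm
  have := φ.hasGridSum_map_iff.2 (h.hasGridSum hf)
  simpa only [φ.mapSeries_smul] using this

/-- Since Φ(-a) Φ(a) = 1, the condition on small monomials follows from the one on large monomials.
-/
theorem IsSubst.of_neg {Φ : V → HahnSeries W ℝ} (zero : Φ 0 = 1)
    (add : ∀ a b, Φ (a + b) = Φ a * Φ b) (grid : ∀ a, IsGrid (Φ a).support)
    (lc : ∀ a, 0 < (Φ a).leadingCoeff) (neg : ∀ a, a < 0 → (Φ a).order < 0) : IsSubst Φ where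
  zero := zero
  add := add
  grid := grid
  lc := lc
  pos a ha := by
    have h1 := neg (-a) (neg_neg_of_pos ha)
    have h2 := HahnSeries.order_mul (leadingCoeff_pos_ne_zero (lc (-a)))
      (leadingCoeff_pos_ne_zero (lc a))
    rw [← add, neg_add_cancel, zero, HahnSeries.order_one] at h2
    rw [eq_neg_of_add_eq_zero_right h2.symm]
    exact neg_pos.2 h1

end Extend

/-! ### Composition of log-free transseries -/

/-- The composition of the monomials of level at most `n` with `g`. -/
def comp (g : HahnSeries TM ℝ) : (n : ℕ) → G n → HahnSeries TM ℝ
  | 0, γ => rpow g (-G.powExponent γ)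
  | n + 1, γ => rpow g (-G.xExponent γ) * texp (-extend (comp g n) (ofLex (G.largePart γ).1))

theorem comp_incl (g : HahnSeries TM ℝ) (n : ℕ) (γ : G n) :
    comp g (n + 1) ((incl n).toLinearMap γ) = comp g n γ := by
  induction n with
  | zero =>
    change rpow g (-G.powExponent γ) *
      texp (-extend (comp g 0) (ofLex (0 : largeSeries (G 0)).1)) = rpow g (-G.powExponent γ)
    have h : extend (comp g 0) (ofLex (0 : largeSeries (G 0)).1) = 0 := extend_zero _
    rw [h, neg_zero, texp_zero, mul_one]
  | succ n ih =>
    change rpow g (-G.xExponent γ) *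
      texp (-extend (comp g (n + 1)) ((incl n).mapSeries (ofLex (G.largePart γ).1))) = _
    rw [extend_mapSeries]
    simp only [ih]
    rfl

/-- The axioms of `OrdVec` do not link scalars with the order. For transmonomials the link is
provided by the normal form x^(-σ) exp(-L). -/
theorem smul_neg_of_neg {v : TM} (hv : v < 0) {c : ℝ} (hc : 0 < c) : c • v < 0 := by
  obtain ⟨L, σ, hL, rfl⟩ := exists_expM v
  rw [smul_add, ← expM_smul hL, ← xM_smul, expM_neg_iff (hL.smul c), leadingCoeff_smul]
  rcases (expM_neg_iff hL σ).1 hv with h | ⟨rfl, h⟩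
  · exact Or.inl (mul_neg_of_pos_of_neg hc h)
  · exact Or.inr ⟨smul_zero c, mul_neg_of_pos_of_neg hc h⟩

theorem order_large {f : HahnSeries TM ℝ} (h : f.order < 0) :
    (large f).order = f.order ∧ (large f).leadingCoeff = f.leadingCoeff := by
  have hne : f ≠ 0 := by
    rintro rfl
    simp at h
  have hc : ∀ v, v < 0 → (large f).coeff v = f.coeff v := fun v hv =>
    Set.indicator_of_mem (s := Set.Iio (0 : TM)) hv f.coeff
  rw [HahnSeries.leadingCoeff_eq (x := f), ← hc _ h]
  refine order_leadingCoeff_of ?_ fun w hw => ?_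
  · rw [hc _ h]
    exact order_mem_support hne
  · rw [hc _ (hw.trans h), HahnSeries.coeff_eq_zero_of_lt_order hw]

theorem mem_support_of_smul {V : OrdVec} {c : ℝ} {f : HahnSeries V ℝ} {v : V}
    (h : v ∈ (c • f).support) : v ∈ f.support := fun h0 =>
  h (by rw [HahnSeries.coeff_smul, h0, smul_zero])

theorem mem_support_smul {V : OrdVec} {c : ℝ} (hc : c ≠ 0) {f : HahnSeries V ℝ} {v : V}
    (h : v ∈ f.support) : v ∈ (c • f).support := by
  rw [HahnSeries.mem_support, HahnSeries.coeff_smul]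
  exact mul_ne_zero hc h

/-- Composition with `g` is a multiplicative substitution; it maps large monomials to series that
dominate the logarithm of the dominant monomial of `g`. -/
theorem comp_spec {m : ℕ} {g L : HahnSeries TM ℝ} {σ : ℝ} (hg : g ∈ level m) (h : LP g)
    (hL : IsLarge L) (hgL : g.order = expM L + xM σ) (n : ℕ) :
    IsSubst (comp g n) ∧ (∀ γ, comp g n γ ∈ level (m + n)) ∧
      ∀ γ < 0, ∀ v ∈ L.support, (comp g n γ).order < v := by
  -- The dominant monomial of g^c has exponent cL, and a large monomial exceeds all the monomials in
  -- its own exponent; those of cL are those of L.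
  have hpow : ∀ c : ℝ, 0 < c → (rpow g c).order < 0 ∧ ∀ v ∈ L.support, (rpow g c).order < v := by
    intro c hc
    have h1 : (rpow g c).order < 0 := by
      rw [(order_rpow h.2 c).1]
      exact smul_neg_of_neg h.1 hc
    refine ⟨h1, fun v hv => ?_⟩
    rw [(order_rpow h.2 c).1, hgL, smul_add, ← expM_smul hL, ← xM_smul] at h1 ⊢
    obtain ⟨k, hk⟩ := hL
    exact expM_lt_of_mem (hk.smul c) h1 (mem_support_smul hc.ne' hv)
  have hpowlc : ∀ c : ℝ, 0 < (rpow g c).leadingCoeff := fun c => by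
    rw [(order_rpow h.2 c).2]
    exact Real.rpow_pos_of_pos h.2 c
  induction n with
  | zero =>
    have hneg : ∀ γ : G 0, γ < 0 → 0 < -G.powExponent γ := fun γ hγ =>
      neg_pos.2 (show G.powExponent γ < 0 from hγ)
    refine ⟨IsSubst.of_neg ?_ ?_ ?_ ?_ ?_, fun γ => rpow_mem_level hg _, fun γ hγ =>
      (hpow _ (hneg γ hγ)).2⟩
    · exact (congrArg (rpow g) neg_zero).trans (rpow_zero h.2)
    · intro a b
      have : -G.powExponent (a + b) = -G.powExponent a + -G.powExponent b :=
        neg_add (G.powExponent a) (G.powExponent b)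
      change rpow g (-G.powExponent (a + b)) = _
      rw [this, rpow_add h.2]
      rfl
    · exact fun a => isGrid_rpow (isGrid_of_mem_level hg) _
    · exact fun a => hpowlc _
    · exact fun a ha => (hpow _ (hneg a ha)).1
  | succ n ih =>
    obtain ⟨ih1, ih2, ih3⟩ := ih
    set C : G (n + 1) → HahnSeries TM ℝ := fun γ =>
      extend (comp g n) (ofLex (G.largePart γ).1) with hC
    have hlev : ∀ γ, C γ ∈ level (m + n) := fun γ =>
      (ih1.extendable.hasGridSum (G.largePart γ).2.1).mem_level fun i =>
        (level (m + n)).smul_mem (ih2 i) _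
    have hfree : ∀ γ, LogFree (-C γ) := fun γ => ⟨_, neg_mem (hlev γ)⟩
    have hcomp : ∀ γ, comp g (n + 1) γ = rpow g (-G.xExponent γ) * texp (-C γ) := fun _ => rfl
    have hlev' : ∀ γ, comp g (n + 1) γ ∈ level (m + (n + 1)) := fun γ => by
      rw [hcomp]
      exact mul_mem (level_mono (Nat.le_add_right m (n + 1)) (rpow_mem_level hg _))
        (texp_mem_level (neg_mem (hlev γ)))
    have hneg : ∀ γ : G (n + 1), γ < 0 → (comp g (n + 1) γ).order < 0 ∧
        ∀ v ∈ L.support, (comp g (n + 1) γ).order < v := by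
      intro γ hγ
      have hγ' : G.largePart γ < 0 ∨ G.largePart γ = 0 ∧ G.xExponent γ < 0 :=
        Prod.Lex.toLex_lt_toLex.1 hγ
      rcases hγ' with hl | ⟨hl, hs⟩
      · have hl' : (ofLex (G.largePart γ).1).leadingCoeff < 0 :=
          HahnSeries.leadingCoeff_neg_iff.2 hl
        have hne : ofLex (G.largePart γ).1 ≠ 0 := HahnSeries.leadingCoeff_ne_zero.1 hl'.ne
        have hord := (G.largePart γ).2.2 _ (order_mem_support hne)
        obtain ⟨c1, c2⟩ := ih1.order_leadingCoeff (G.largePart γ).2.1 hne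
        change (C γ).order = _ at c1
        change (C γ).leadingCoeff = _ at c2
        have hw : (C γ).order < 0 := by
          have h1 := ih1.ord_strictMono hord
          rw [map_zero] at h1
          rw [c1]
          exact h1
        have hlc : (C γ).leadingCoeff < 0 := by
          rw [c2]
          exact mul_neg_of_neg_of_pos hl' (ih1.lc _)
        obtain ⟨l1, l2⟩ := order_large hw
        have hlne : large (C γ) ≠ 0 := HahnSeries.leadingCoeff_ne_zero.1 (by rw [l2]; exact hlc.ne)
        have hlarge : IsLarge (large (C γ)) := ⟨_, isLargeAt_large (hlev γ)⟩
        -- By the induction hypothesis the dominant monomial of `C γ` is ≫ every monomial of L.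
        -- Hence the multiple of L contributed by the power of g does not change the dominant term
        -- of the exponent.
        obtain ⟨y1, y2⟩ := order_add_of_lt (g := (-G.xExponent γ) • L) hlne fun u hu => by
          rw [l1, c1]
          exact ih3 _ hord u (mem_support_of_smul hu)
        have hY : IsLarge (large (C γ) + (-G.xExponent γ) • L) := hlarge.add (hL.smul _)
        have hYlc : (large (C γ) + (-G.xExponent γ) • L).leadingCoeff < 0 := by
          rw [y2, l2]
          exact hlc
        have horder : (comp g (n + 1) γ).order =
            expM (large (C γ) + (-G.xExponent γ) • L) + xM (-G.xExponent γ * σ) := by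
          rw [hcomp, HahnSeries.order_mul (leadingCoeff_pos_ne_zero (hpowlc _))
            (leadingCoeff_pos_ne_zero (leadingCoeff_texp_pos _)), (order_rpow h.2 _).1,
            (order_texp _).1]
          have : -large (-C γ) = large (C γ) := by
            rw [large, restrict_neg, neg_neg]
            rfl
          rw [this, hgL, smul_add, ← expM_smul hL, ← xM_smul, expM_add hlarge (hL.smul _)]
          abel
        have hfin : (comp g (n + 1) γ).order < 0 := by
          rw [horder]
          exact (expM_neg_iff hY _).2 (Or.inl hYlc)
        -- The new dominant monomial exceeds the dominant monomial of its exponent, which is that of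
        -- `C γ`, which in turn exceeds v by the induction hypothesis.
        refine ⟨hfin, fun v hv => lt_trans ?_ (ih3 _ hord v hv)⟩
        have hmem := order_mem_support (HahnSeries.leadingCoeff_ne_zero.1 hYlc.ne)
        rw [horder] at hfin ⊢
        rw [← c1, ← l1, ← y1]
        obtain ⟨k, hk⟩ := hY
        exact expM_lt_of_mem hk hfin hmem
      · have h0 : C γ = 0 := by
          rw [hC]
          dsimp only
          rw [hl]
          exact extend_zero _
        rw [hcomp, h0, neg_zero, texp_zero, mul_one]
        exact hpow _ (neg_pos.2 hs)
    refine ⟨IsSubst.of_neg ?_ ?_ ?_ ?_ fun a ha => (hneg a ha).1, hlev', fun γ hγ => (hneg γ hγ).2⟩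
    · have h0 : C 0 = 0 := extend_zero _
      have h1 : -G.xExponent (0 : G (n + 1)) = 0 := neg_zero
      rw [hcomp, h0, h1, rpow_zero h.2, neg_zero, texp_zero, mul_one]
    · intro a b
      have h0 : C (a + b) = C a + C b :=
        ih1.extendable.add (G.largePart a).2.1 (G.largePart b).2.1
      have h1 : -G.xExponent (a + b) = -G.xExponent a + -G.xExponent b :=
        neg_add (G.xExponent a) (G.xExponent b)
      rw [hcomp, hcomp, hcomp, h0, h1, rpow_add h.2, neg_add, texp_add (hfree a) (hfree b)]
      ring
    · exact fun a => isGrid_of_mem_level (hlev' a)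
    · intro a
      rw [hcomp, HahnSeries.leadingCoeff_mul]
      exact mul_pos (hpowlc _) (leadingCoeff_texp_pos _)

theorem comp_isSubst {m : ℕ} {g : HahnSeries TM ℝ} (hg : g ∈ level m) (h : LP g) (n : ℕ) :
    IsSubst (comp g n) ∧ ∀ γ, comp g n γ ∈ level (m + n) := by
  obtain ⟨L, σ, hL, hgL⟩ := exists_expM g.order
  obtain ⟨h1, h2, -⟩ := comp_spec hg h hL hgL n
  exact ⟨h1, h2⟩

/-- The composition of monomials with `g`. -/
def tcomp (g : HahnSeries TM ℝ) : TM → HahnSeries TM ℝ := Lim.lift (comp g)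

theorem tcomp_ι (g : HahnSeries TM ℝ) (n : ℕ) (γ : G n) :
    tcomp g ((ι n).toLinearMap γ) = comp g n γ := Lim.lift_of (comp_incl g) n γ

/-- The composition `f ∘ g`. -/
def circ (f g : HahnSeries TM ℝ) : HahnSeries TM ℝ := extend (tcomp g) f

theorem circ_ι (g : HahnSeries TM ℝ) {n : ℕ} (f : HahnSeries (G n) ℝ) :
    circ ((ι n).mapSeries f) g = extend (comp g n) f := by
  rw [circ, extend_mapSeries]
  simp only [tcomp_ι]

theorem tcomp_isSubst {g : HahnSeries TM ℝ} (hg : LogFree g) (h : LP g) : IsSubst (tcomp g) := by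
  obtain ⟨m, hm⟩ := hg
  have hs := fun n => (comp_isSubst hm h n).1
  refine ⟨?_, fun a b => ?_, fun a => ?_, fun a => ?_, fun a ha => ?_⟩
  · rw [← map_zero (ι 0).toLinearMap, tcomp_ι, (hs 0).zero]
  · obtain ⟨n, a, b, rfl, rfl⟩ := Lim.exists_of₂ a b
    exact (congrArg (tcomp g) (map_add (ι n).toLinearMap a b).symm).trans
      ((tcomp_ι g n _).trans (((hs n).add a b).trans
        (congrArg₂ _ (tcomp_ι g n a).symm (tcomp_ι g n b).symm)))
  · obtain ⟨n, a, rfl⟩ := Lim.exists_of incl a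
    exact tcomp_ι g n a ▸ (hs n).grid a
  · obtain ⟨n, a, rfl⟩ := Lim.exists_of incl a
    exact tcomp_ι g n a ▸ (hs n).lc a
  · obtain ⟨n, a, rfl⟩ := Lim.exists_of incl a
    exact tcomp_ι g n a ▸ (hs n).pos a ((ι n).pos_iff.1 ha)

theorem circ_mem_level {m n : ℕ} {f g : HahnSeries TM ℝ} (hf : f ∈ level n) (hg : g ∈ level m)
    (h : LP g) : circ f g ∈ level (m + n) := by
  obtain ⟨f, rfl⟩ := mem_level.1 hf
  rw [circ_ι]
  obtain ⟨h1, h2⟩ := comp_isSubst hg h n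
  exact (h1.extendable.hasGridSum f.2).mem_level fun i => (level (m + n)).smul_mem (h2 i) _

theorem LogFree.circ {f g : HahnSeries TM ℝ} (hf : LogFree f) (hg : LogFree g) (h : LP g) :
    LogFree (circ f g) := by
  obtain ⟨n, hn⟩ := hf
  obtain ⟨m, hm⟩ := hg
  exact ⟨_, circ_mem_level hn hm h⟩

theorem tcomp_expM_add (g : HahnSeries TM ℝ) {L : HahnSeries TM ℝ} (hL : IsLarge L) (σ : ℝ) :
    tcomp g (expM L + xM σ) = rpow g (-σ) * texp (-circ L g) := by
  obtain ⟨k, L, rfl⟩ := hL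
  rw [expM_ιL, ← ι_mono, tcomp_ι, ιL, circ_ι]
  rfl

theorem tcomp_expM {g : HahnSeries TM ℝ} (h : LP g) {L : HahnSeries TM ℝ} (hL : IsLarge L) :
    tcomp g (expM L) = texp (-circ L g) := by
  have := tcomp_expM_add g hL 0
  rwa [xM_zero, add_zero, neg_zero, rpow_zero h.2, one_mul] at this

theorem tcomp_xM {g : HahnSeries TM ℝ} (σ : ℝ) : tcomp g (xM σ) = rpow g (-σ) := tcomp_ι g 0 _

theorem circ_smul_Xs {g : HahnSeries TM ℝ} (hg : LogFree g) (h : LP g) (σ : ℝ) :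
    circ (σ • Xs) g = σ • g := by
  have hs := tcomp_isSubst hg h
  rw [circ, hs.extendable.smul (f := Xs) (isGrid_single _ _), Xs,
    extend_single _ hs.grid, tcomp_xM, neg_neg, rpow_one h.2, one_smul]

/-- `(f ∘ g) ∘ exp = f ∘ (g ∘ exp)`. -/
theorem E_circ {f g : HahnSeries TM ℝ} (hf : LogFree f) (hg : LogFree g) (h : LP g) :
    E.mapSeries (circ f g) = circ f (E.mapSeries g) := by
  obtain ⟨m, hm⟩ := hg
  have key : ∀ n γ, E.mapSeries (comp g n γ) = comp (E.mapSeries g) n γ := by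
    intro n
    induction n with
    | zero => exact fun γ => E.mapSeries_rpow g _
    | succ n ih =>
      intro γ
      obtain ⟨h1, h2⟩ := comp_isSubst hm h n
      have h3 : E.mapSeries (extend (comp g n) (ofLex (G.largePart γ).1)) =
          extend (comp (E.mapSeries g) n) (ofLex (G.largePart γ).1) := by
        rw [h1.extendable.mapSeries E (G.largePart γ).2.1]
        simp only [ih]
      have h4 : LogFree (extend (comp g n) (ofLex (G.largePart γ).1)) :=
        ⟨_, (h1.extendable.hasGridSum (G.largePart γ).2.1).mem_level fun i =>
          (level (m + n)).smul_mem (h2 i) _⟩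
      have h5 : LogFree (-extend (comp g n) (ofLex (G.largePart γ).1)) :=
        h4.imp fun _ h => neg_mem h
      change E.mapSeries (_ * texp _) = _ * texp _
      rw [E.mapSeries_mul, E.mapSeries_rpow, E_texp h5, E.mapSeries_neg, h3]
  obtain ⟨n, hn⟩ := hf
  obtain ⟨f, rfl⟩ := mem_level.1 hn
  rw [circ_ι, circ_ι, (comp_isSubst hm h n).1.extendable.mapSeries E f.2]
  simp only [key]

theorem order_texp_neg {g : HahnSeries TM ℝ} (hg : LogFree g) (h : LP g) : LP (texp g) := by
  refine ⟨?_, leadingCoeff_texp_pos g⟩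
  rw [(order_texp g).1]
  have := (expM_neg_iff hg.isLarge.neg 0).2 (Or.inl (by
    rw [leadingCoeff_neg, (order_large h.1).2]
    exact neg_lt_zero.2 h.2))
  rwa [xM_zero, add_zero] at this

theorem LogFree.neg {f : HahnSeries TM ℝ} (h : LogFree f) : LogFree (-f) :=
  h.imp fun _ h => neg_mem h

theorem LogFree.smul {f : HahnSeries TM ℝ} (h : LogFree f) (c : ℝ) : LogFree (c • f) :=
  h.imp fun k h => (level k).smul_mem h c

theorem LogFree.texp {f : HahnSeries TM ℝ} (h : LogFree f) : LogFree (texp f) := by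
  obtain ⟨k, hk⟩ := h
  exact ⟨_, texp_mem_level hk⟩

/-- `(f ∘ exp) ∘ g = f ∘ (exp g)`. -/
theorem circ_E {f g : HahnSeries TM ℝ} (hf : LogFree f) (hg : LogFree g) (h : LP g) :
    circ (E.mapSeries f) g = circ f (texp g) := by
  have hs := tcomp_isSubst hg h
  have key : ∀ n γ, tcomp g (E.toLinearMap ((ι n).toLinearMap γ)) = comp (texp g) n γ := by
    intro n
    induction n with
    | zero =>
      intro γ
      rw [E_ι]
      change tcomp g (expM (G.powExponent γ • Xs)) = rpow (texp g) (-G.powExponent γ)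
      -- On powers of x the claim is exp(-σg) = (exp g)^(-σ).
      rw [tcomp_expM h (isLarge_smul_Xs _), circ_smul_Xs hg h, rpow_texp hg]
      congr 1
      exact (neg_smul (G.powExponent γ) g).symm
    | succ n ih =>
      intro γ
      have hl : IsLarge (ιL (G.largePart γ)) := ⟨n, _, rfl⟩
      have h1 : circ (E.mapSeries (ιL (G.largePart γ))) g =
          extend (comp (texp g) n) (ofLex (G.largePart γ).1) := by
        rw [ιL, circ, extend_mapSeries, extend_mapSeries]
        simp only [ih]
      have h2 : -(G.xExponent γ • g) = (-G.xExponent γ) • g := (neg_smul _ g).symm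
      rw [exists_expM_of_level, E_expM_add hl, tcomp_expM h (hl.E.add (isLarge_smul_Xs _)), circ,
        hs.extendable.add hl.E.logFree.isGrid (isLarge_smul_Xs _).logFree.isGrid, ← circ, ← circ,
        circ_smul_Xs hg h, neg_add, texp_add (hl.E.logFree.circ hg h).neg (hg.smul _).neg, h1, h2,
        ← rpow_texp hg, mul_comm]
      rfl
  obtain ⟨n, hn⟩ := hf
  obtain ⟨f, rfl⟩ := mem_level.1 hn
  rw [circ_ι, circ, extend_mapSeries, extend_mapSeries]
  simp only [key]

/-! ### Composition with x and with exp x. -/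

theorem LP_Xs : LP Xs := by
  rw [LP, Xs, HahnSeries.order_single one_ne_zero, HahnSeries.leadingCoeff_of_single]
  exact ⟨xM_neg_one_neg, one_pos⟩

theorem logFree_Xs : LogFree Xs := IsLarge.logFree ⟨0, isLargeAt_Xs⟩

theorem extend_single_one {V : OrdVec} {f : HahnSeries V ℝ} (hf : IsGrid f.support) :
    extend (fun v => HahnSeries.single v (1 : ℝ)) f = f := by
  refine HasGridSum.gsum_eq ⟨hf.mono (Set.iUnion_subset fun γ w hw => ?_), fun w => ?_, fun w => ?_⟩
  · rw [HahnSeries.mem_support, HahnSeries.coeff_smul] at hw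
    rw [HahnSeries.eq_of_mem_support_single (right_ne_zero_of_mul hw)]
    exact left_ne_zero_of_mul hw
  · refine (Set.finite_singleton w).subset fun γ hγ => ?_
    by_contra h1
    exact hγ (by rw [HahnSeries.coeff_smul, HahnSeries.coeff_single_of_ne (Ne.symm h1), smul_zero])
  · rw [finsum_eq_single _ w fun γ hγ => by
      rw [HahnSeries.coeff_smul, HahnSeries.coeff_single_of_ne (Ne.symm hγ), smul_zero]]
    rw [HahnSeries.coeff_smul, HahnSeries.coeff_single_same, smul_eq_mul, mul_one]

theorem texp_of_isLarge {L : HahnSeries TM ℝ} (h : IsLarge L) :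
    texp L = HahnSeries.single (expM (-L)) 1 := by
  have := texp_add_const_add_small h 0 (s := 0) (by simp)
  rwa [HahnSeries.single_eq_zero, add_zero, add_zero, Real.exp_zero, sexp_zero, mul_one] at this

theorem rpow_Xs (σ : ℝ) : rpow Xs (-σ) = HahnSeries.single (xM σ) 1 := by
  have := rpow_single_mul_sexp (xM (-1)) one_pos (t := 0) (by simp) (-σ)
  rw [smul_zero, sexp_zero, mul_one, mul_one, Real.one_rpow, ← xM_smul] at this
  rw [Xs, this, neg_mul_neg, mul_one]

theorem circ_Xs {f : HahnSeries TM ℝ} (hf : LogFree f) : circ f Xs = f := by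
  have key : ∀ n γ, comp Xs n γ = HahnSeries.single ((ι n).toLinearMap γ) 1 := by
    intro n
    induction n with
    | zero => exact fun γ => rpow_Xs _
    | succ n ih =>
      intro γ
      have h1 : extend (comp Xs n) (ofLex (G.largePart γ).1) = ιL (G.largePart γ) := by
        rw [← circ_ι, circ, extend_mapSeries]
        simp only [tcomp_ι, ih]
        rw [← extend_mapSeries (ι n) (fun v => HahnSeries.single v (1 : ℝ)), extend_single_one]
        · rfl
        · exact (ι n).isGrid_mapSeries (G.largePart γ).2.1
      have hl : IsLarge (ιL (G.largePart γ)) := ⟨n, _, rfl⟩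
      change rpow Xs (-G.xExponent γ) *
        texp (-extend (comp Xs n) (ofLex (G.largePart γ).1)) = _
      rw [h1, rpow_Xs, texp_of_isLarge hl.neg, neg_neg, HahnSeries.single_mul_single, mul_one,
        exists_expM_of_level, add_comm]
  obtain ⟨n, hn⟩ := hf
  obtain ⟨f, rfl⟩ := mem_level.1 hn
  rw [circ_ι, funext (key n), ← extend_mapSeries (ι n) (fun v => HahnSeries.single v (1 : ℝ)),
    extend_single_one]
  exact (ι n).isGrid_mapSeries f.2

theorem ι_expX : (ι 1).mapSeries expX.1 = texp Xs := by
  rw [texp_of_isLarge ⟨0, isLargeAt_Xs⟩]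
  have h : expM (-Xs) = (ι 1).toLinearMap (G.mono (-XLarge) 0) := by
    rw [← expM_ιL, ιL_neg]
    congr 2
    exact ι_X.symm
  rw [h]
  exact (ι 1).mapSeries_single _ _

/-- By `circ_E`, f ∘ exp x = (f ∘ exp) ∘ x. It identifies the composition used in `FormalComp.Ident`
with the embedding `E`. -/
theorem circ_expX {f : HahnSeries TM ℝ} (hf : LogFree f) : circ f (texp Xs) = E.mapSeries f := by
  rw [← circ_E hf logFree_Xs LP_Xs, circ_Xs hf.E]

/-! ### The composition relation -/

theorem ι_liftSeries (m n : ℕ) (f : HahnSeries (G m) ℝ) :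
    (ι (m + n)).mapSeries (liftSeries m n f) = (ι m).mapSeries f := by
  induction n with
  | zero => rfl
  | succ n ih =>
    rw [← ih]
    exact ι_mapSeries_succ (m + n) _

theorem LargePos.LP {m : ℕ} {g : T m} (h : LargePos g) : LP ((ι m).mapSeries g.1) := by
  obtain ⟨h1, h2⟩ := (ι m).order_leadingCoeff g.1
  rw [Transseries.LP, h1, h2]
  exact ⟨(ι m).neg_iff.2 h.1, h.2⟩

theorem ι_mem_level {m : ℕ} (g : T m) : (ι m).mapSeries g.1 ∈ level m := ⟨g.1, g.2, rfl⟩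

theorem Extendable.hasGridSum_iff {V W : OrdVec} {Φ : V → HahnSeries W ℝ} (h : Extendable Φ)
    {f : HahnSeries V ℝ} (hf : IsGrid f.support) {S : HahnSeries W ℝ} :
    HasGridSum (fun γ => f.coeff γ • Φ γ) S ↔ S = extend Φ f :=
  ⟨fun h' => h'.gsum_eq.symm, fun h' => h' ▸ h.hasGridSum hf⟩

/-- By induction the auxiliary compositions c γ are forced to be those of the exponents of γ. Their
existence at level m + n comes from `circ_mem_level`, and summability is transferred in both
directions by `MonoEmb.hasGridSum_map_iff`. -/
theorem isComp_iff {n m : ℕ} {f : T n} {g : T m} (hg : LargePos g) {h : T (m + n)} :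
    IsComp n m f g h ↔
      (ι (m + n)).mapSeries h.1 = circ ((ι n).mapSeries f.1) ((ι m).mapSeries g.1) := by
  have hs := fun n => comp_isSubst (ι_mem_level g) hg.LP n
  induction n with
  | zero =>
    rw [circ_ι, ← (hs 0).1.extendable.hasGridSum_iff f.2]
    rw [IsComp, ← (ι m).hasGridSum_map_iff]
    simp only [MonoEmb.mapSeries_smul, MonoEmb.mapSeries_rpow]
    rfl
  | succ n ih =>
    rw [circ_ι, ← (hs (n + 1)).1.extendable.hasGridSum_iff f.2]
    have key : ∀ c : G (n + 1) → T (m + n),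
        (∀ γ, IsComp n m (largeSeries.toGrid (G.largePart γ)) g (c γ)) →
        ∀ γ, (ι (m + n + 1)).mapSeries (f.1.coeff γ •
          (liftSeries m (n + 1) (rpow g.1 (-G.xExponent γ)) * expSeries (-c γ))) =
          f.1.coeff γ • comp ((ι m).mapSeries g.1) (n + 1) γ := by
      intro c hc γ
      have h1 := ih.1 (hc γ)
      have h2 : (ι (m + n)).mapSeries (-c γ).1 = -(ι (m + n)).mapSeries (c γ).1 :=
        (ι (m + n)).mapSeries_neg _
      have h3 := ι_liftSeries m (n + 1) (rpow g.1 (-G.xExponent γ))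
      change (ι (m + n + 1)).mapSeries _ = _ at h3
      rw [circ_ι] at h1
      rw [MonoEmb.mapSeries_smul, MonoEmb.mapSeries_mul, h3, ι_expSeries, MonoEmb.mapSeries_rpow,
        h2, h1]
      rfl
    constructor
    · rintro ⟨c, hc, hsum⟩
      have := (ι (m + n + 1)).hasGridSum_map_iff.2 hsum
      simp only [key c hc] at this
      exact this
    · intro hsum
      have hex : ∀ γ : G (n + 1), ∃ c : T (m + n),
          IsComp n m (largeSeries.toGrid (G.largePart γ)) g c := fun γ => by
        obtain ⟨c, hc⟩ := mem_level.1
          (circ_mem_level (ι_mem_level (largeSeries.toGrid (G.largePart γ))) (ι_mem_level g) hg.LP)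
        exact ⟨c, ih.2 hc⟩
      choose c hc using hex
      refine ⟨c, hc, ?_⟩
      refine (ι (m + n + 1)).hasGridSum_map_iff.1 ?_
      simp only [key c hc]
      exact hsum

theorem exists_isComp {n m : ℕ} (f : T n) {g : T m} (hg : LargePos g) : ∃ h, IsComp n m f g h := by
  obtain ⟨h, hh⟩ := mem_level.1 (circ_mem_level (ι_mem_level f) (ι_mem_level g) hg.LP)
  exact ⟨h, (isComp_iff hg).2 hh⟩

theorem largePos_expX : LargePos expX := by
  obtain ⟨h1, h2⟩ := (ι 1).order_leadingCoeff expX.1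
  have h := order_texp_neg logFree_Xs LP_Xs
  rw [LP, ← ι_expX, h1, h2] at h
  exact ⟨(ι 1).neg_iff.1 h.1, h.2⟩

theorem isComp_expX_iff {n : ℕ} {f : T n} {g : T (1 + n)} :
    IsComp n 1 f expX g ↔ (ι (1 + n)).mapSeries g.1 = E.mapSeries ((ι n).mapSeries f.1) := by
  rw [isComp_iff largePos_expX, ι_expX, circ_expX ⟨n, ι_mem_level f⟩]

theorem isExp_iff {n : ℕ} {f : T n} {h : T (n + 1)} :
    IsExp f h ↔ (ι (n + 1)).mapSeries h.1 = texp ((ι n).mapSeries f.1) := by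
  rw [← ι_expSeries, (ι (n + 1)).mapSeries_injective.eq_iff]
  rfl

/-! ### Strong additivity -/

section Tame

variable {V W : OrdVec}

/-- The relative supports of the series `Φ γ`, for `γ` in a grid, lie in one grid. -/
def Tame (φ : MonoEmb V W) (Φ : V → HahnSeries W ℝ) : Prop :=
  ∀ U : Set V, IsGrid U → ∃ U' : Set W, IsGrid U' ∧
    ∀ γ ∈ U, ∀ w ∈ (Φ γ).support, w - φ.toLinearMap γ ∈ U'

theorem finite_add_eq {U U' : Set V} (hU : IsGrid U) (hU' : IsGrid U') (w : V) :
    {γ | γ ∈ U ∧ w - γ ∈ U'}.Finite := by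
  refine ((Set.AddAntidiagonal.finite_of_isPWO hU.isPWO hU'.isPWO w).image Prod.fst).subset ?_
  rintro γ ⟨h1, h2⟩
  exact ⟨(γ, w - γ), ⟨h1, h2, add_sub_cancel γ w⟩, rfl⟩

theorem IsGrid.image (φ : MonoEmb V W) {S : Set V} (hS : IsGrid S) :
    IsGrid (φ.toLinearMap '' S) := by
  obtain ⟨M, μ, k₀, hμ, H⟩ := hS
  refine ⟨M, fun i => φ.toLinearMap (μ i), k₀, fun i => φ.pos_iff.2 (hμ i), ?_⟩
  rintro _ ⟨v, hv, rfl⟩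
  obtain ⟨k, hk, rfl⟩ := H v hv
  exact ⟨k, hk, by simp only [map_sum, map_zsmul]⟩

theorem finite_image_add_eq (φ : MonoEmb V W) {U : Set V} {U' : Set W} (hU : IsGrid U)
    (hU' : IsGrid U') (w : W) : {γ | γ ∈ U ∧ w - φ.toLinearMap γ ∈ U'}.Finite := by
  refine Set.Finite.of_finite_image (f := φ.toLinearMap) ?_ φ.injective.injOn
  refine (finite_add_eq (hU.image φ) hU' w).subset ?_
  rintro _ ⟨γ, ⟨h1, h2⟩, rfl⟩
  exact ⟨⟨γ, h1, rfl⟩, h2⟩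

/-- Every term is supported in φ(U) + U' with U and U' grids. A sum of two grids is a grid, and each
monomial has finitely many decompositions in it. -/
theorem Tame.extendable {φ : MonoEmb V W} {Φ : V → HahnSeries W ℝ} (h : Tame φ Φ) :
    Extendable Φ := by
  intro f hf
  obtain ⟨U', hU', H⟩ := h _ hf
  have key : ∀ γ w, (f.coeff γ • Φ γ).coeff w ≠ 0 →
      γ ∈ f.support ∧ w - φ.toLinearMap γ ∈ U' := by
    intro γ w hw
    rw [HahnSeries.coeff_smul] at hw
    exact ⟨left_ne_zero_of_mul hw, H γ (left_ne_zero_of_mul hw) w (right_ne_zero_of_mul hw)⟩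
  refine ⟨(IsGrid.add (hf.image φ) hU' fun u hu => hu).mono ?_,
    fun w => (finite_image_add_eq φ hf hU' w).subset fun γ hγ => key γ w hγ⟩
  rintro w hw
  obtain ⟨γ, hγ⟩ := Set.mem_iUnion.1 hw
  obtain ⟨h1, h2⟩ := key γ w hγ
  exact ⟨_, ⟨γ, h1, rfl⟩, _, h2, add_sub_cancel _ _⟩

/-- The extension of a tame map to series is strongly additive. -/
theorem Tame.hasGridSum_extend {φ : MonoEmb V W} {Φ : V → HahnSeries W ℝ} (h : Tame φ Φ)
    {I : Type} {F : I → HahnSeries V ℝ} {S : HahnSeries V ℝ} (hF : HasGridSum F S) :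
    HasGridSum (fun i => extend Φ (F i)) (extend Φ S) := by
  obtain ⟨U', hU', H⟩ := h _ hF.1
  have hFi : ∀ i, (F i).support ⊆ ⋃ i, (F i).support :=
    fun i => Set.subset_iUnion (fun i => (F i).support) i
  -- For fixed w a single finite set of γ serves all f supported in the common grid, so the double
  -- sum can be interchanged.
  have hsum : ∀ f : HahnSeries V ℝ, f.support ⊆ (⋃ i, (F i).support) → ∀ w,
      (extend Φ f).coeff w = ∑ γ ∈ (finite_image_add_eq φ hF.1 hU' w).toFinset,
        f.coeff γ * (Φ γ).coeff w := by
    intro f hf w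
    rw [(h.extendable.hasGridSum (hF.1.mono hf)).2.2 w]
    refine finsum_eq_sum_of_support_subset _ fun γ hγ => ?_
    rw [Set.Finite.coe_toFinset]
    have hγ' : f.coeff γ * (Φ γ).coeff w ≠ 0 := hγ
    have h1 := hf (left_ne_zero_of_mul hγ')
    exact ⟨h1, H γ h1 w (right_ne_zero_of_mul hγ')⟩
  have hne : ∀ i w, (extend Φ (F i)).coeff w ≠ 0 →
      ∃ γ ∈ (finite_image_add_eq φ hF.1 hU' w).toFinset, (F i).coeff γ ≠ 0 := by
    intro i w hw
    rw [hsum (F i) (hFi i) w] at hw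
    obtain ⟨γ, hγ, hγ'⟩ := Finset.exists_ne_zero_of_sum_ne_zero hw
    exact ⟨γ, hγ, left_ne_zero_of_mul hγ'⟩
  refine ⟨(IsGrid.add (hF.1.image φ) hU' fun u hu => hu).mono ?_, fun w => ?_, fun w => ?_⟩
  · intro w hw
    obtain ⟨i, hi⟩ := Set.mem_iUnion.1 hw
    obtain ⟨γ, hγ, -⟩ := hne i w hi
    rw [Set.Finite.mem_toFinset] at hγ
    exact ⟨_, ⟨γ, hγ.1, rfl⟩, _, hγ.2, add_sub_cancel _ _⟩
  · refine ((finite_image_add_eq φ hF.1 hU' w).toFinset.finite_toSet.biUnion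
      fun γ _ => hF.2.1 γ).subset fun i hi => ?_
    obtain ⟨γ, hγ, hi'⟩ := hne i w hi
    exact Set.mem_biUnion hγ hi'
  · rw [hsum S hF.support_subset w]
    simp only [hsum _ (hFi _) w]
    rw [finsum_sum_comm]
    · refine Finset.sum_congr rfl fun γ _ => ?_
      rw [hF.2.2 γ, finsum_mul _ _]
    · exact fun γ _ => (hF.2.1 γ).subset fun i hi => left_ne_zero_of_mul hi

/-- The identity embedding. -/
def MonoEmb.id (V : OrdVec) : MonoEmb V V where
  toLinearMap := LinearMap.id
  strictMono := strictMono_id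

theorem tame_mul {h : HahnSeries V ℝ} (hh : IsGrid h.support) :
    Tame (MonoEmb.id V) fun γ => HahnSeries.single γ 1 * h := by
  refine fun U _ => ⟨h.support, hh, fun γ _ w hw => ?_⟩
  rw [HahnSeries.mem_support, HahnSeries.coeff_single_mul, one_mul] at hw
  exact hw

/-- The product expanded along the monomials of f; strong additivity of multiplication and the
Leibniz rule start from it. -/
theorem hasGridSum_mul_single {f h : HahnSeries V ℝ} (hf : IsGrid f.support)
    (hh : IsGrid h.support) :
    HasGridSum (fun γ => f.coeff γ • (HahnSeries.single γ (1 : ℝ) * h)) (f * h) := by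
  obtain ⟨h1, h2, -⟩ := (tame_mul hh).extendable.hasGridSum hf
  refine ⟨h1, h2, fun w => ?_⟩
  classical
  rw [finsum_eq_sum_of_support_subset (s := (Finset.antidiagonal f.isPWO_support
    h.isPWO_support w).image Prod.fst), HahnSeries.coeff_mul, Finset.sum_image]
  · refine Finset.sum_congr rfl fun p hp => ?_
    obtain ⟨-, -, hp⟩ := Finset.mem_antidiagonal.1 hp
    rw [HahnSeries.coeff_smul, HahnSeries.coeff_single_mul, one_mul, ← hp, add_sub_cancel_left,
      smul_eq_mul]
  · intro p hp q hq hpq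
    obtain ⟨-, -, hp⟩ := Finset.mem_antidiagonal.1 hp
    obtain ⟨-, -, hq⟩ := Finset.mem_antidiagonal.1 hq
    refine Prod.ext hpq (add_left_cancel (a := p.1) ?_)
    rw [hp, hpq, hq]
  · intro γ hγ
    rw [Function.mem_support, HahnSeries.coeff_smul, HahnSeries.coeff_single_mul, one_mul] at hγ
    refine Finset.mem_coe.2 (Finset.mem_image.2 ⟨(γ, w - γ), ?_, rfl⟩)
    exact Finset.mem_antidiagonal.2
      ⟨left_ne_zero_of_mul hγ, right_ne_zero_of_mul hγ, add_sub_cancel _ _⟩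

/-- Multiplication by a series is strongly additive. -/
theorem HasGridSum.mul_right {I : Type} {F : I → HahnSeries V ℝ} {S : HahnSeries V ℝ}
    (hF : HasGridSum F S) {h : HahnSeries V ℝ} (hh : IsGrid h.support) :
    HasGridSum (fun i => F i * h) (S * h) := by
  have hmul : ∀ f : HahnSeries V ℝ, IsGrid f.support →
      extend (fun γ => HahnSeries.single γ (1 : ℝ) * h) f = f * h := fun f hf =>
    (hasGridSum_mul_single hf hh).gsum_eq
  have := (tame_mul hh).hasGridSum_extend hF
  rw [hmul S hF.isGrid] at this
  simpa only [hmul _ (hF.1.mono (Set.subset_iUnion (fun i => (F i).support) _))] using this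

theorem HasGridSum.mul_left {I : Type} {F : I → HahnSeries V ℝ} {S : HahnSeries V ℝ}
    (hF : HasGridSum F S) {h : HahnSeries V ℝ} (hh : IsGrid h.support) :
    HasGridSum (fun i => h * F i) (h * S) := by
  simpa only [mul_comm h] using hF.mul_right hh

theorem hasGridSum_single {f : HahnSeries V ℝ} (hf : IsGrid f.support) :
    HasGridSum (fun γ => f.coeff γ • HahnSeries.single γ (1 : ℝ)) f := by
  have := hasGridSum_mul_single hf isGrid_one
  simpa only [mul_one] using this

theorem MonoEmb.hasGridSum_single (φ : MonoEmb V W) {f : HahnSeries V ℝ} (hf : IsGrid f.support) :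
    HasGridSum (fun γ => f.coeff γ • HahnSeries.single (φ.toLinearMap γ) (1 : ℝ))
      (φ.mapSeries f) := by
  have := φ.hasGridSum_map_iff.2 (Transseries.hasGridSum_single hf)
  simpa only [φ.mapSeries_smul, φ.mapSeries_single] using this

end Tame

/-! ### Derivations defined on monomials -/

section Deriv

variable {V W : OrdVec}

/-- For γ = b + ∑ nᵢ μᵢ, the support of δ γ lies in the union of the supports of δ b and the δ (μ
i): these finitely many grids serve the whole grid `U`. -/
theorem tame_deriv (φ : MonoEmb V W) {δ : V → HahnSeries W ℝ}
    (hadd : ∀ a b, δ (a + b) = δ a + δ b) (hgrid : ∀ a, IsGrid (δ a).support) :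
    Tame φ fun γ => HahnSeries.single (φ.toLinearMap γ) 1 * δ γ := by
  intro U hU
  obtain ⟨M, μ, b, -, H⟩ := hU.exists_nat
  have hz : δ 0 = 0 := by
    have := hadd 0 0
    rwa [add_zero, left_eq_add] at this
  have hfin : ∀ s : Finset (Fin M), IsGrid (⋃ i ∈ s, (δ (μ i)).support) := by
    classical
    intro s
    induction s using Finset.induction with
    | empty => simpa using IsGrid.zero.mono (Set.empty_subset ({0} : Set W))
    | insert i s _ ih =>
      rw [Finset.set_biUnion_insert]
      exact (hgrid _).union ih
  refine ⟨_, (hgrid b).union (hfin Finset.univ), fun γ hγ w hw => ?_⟩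
  rw [HahnSeries.mem_support, HahnSeries.coeff_single_mul, one_mul] at hw
  obtain ⟨n, hn⟩ := H γ hγ
  generalize w - φ.toLinearMap γ = u at hw ⊢
  by_contra hu
  simp only [Set.mem_union, Set.mem_iUnion, not_or, not_exists, HahnSeries.mem_support,
    not_not] at hu
  -- The coefficient at u is an additive functional of the monomial. If it vanishes at b and at all
  -- μ i, it vanishes at γ.
  let Δ : V →+ ℝ := ⟨⟨fun a => (δ a).coeff u, by rw [hz, HahnSeries.coeff_zero]⟩, fun a b => by
    change (δ (a + b)).coeff u = _
    rw [hadd, HahnSeries.coeff_add]⟩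
  have h1 : Δ γ ≠ 0 := hw
  have h2 : Δ b = 0 := hu.1
  have h3 : ∀ i, Δ (μ i) = 0 := fun i => hu.2 i (Finset.mem_univ i)
  refine h1 ?_
  rw [hn, map_add, h2, map_sum, zero_add]
  exact Finset.sum_eq_zero fun i _ => by rw [map_nsmul, h3, smul_zero]

theorem extend_single_mul (φ : MonoEmb V W) {Ψ : V → HahnSeries W ℝ} (hΨ : Extendable Ψ)
    (a : V) (hgrid : IsGrid (Ψ a).support)
    (hadd : ∀ b, Ψ (a + b) = HahnSeries.single (φ.toLinearMap b) 1 * Ψ a +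
      HahnSeries.single (φ.toLinearMap a) 1 * Ψ b) {g : HahnSeries V ℝ} (hg : IsGrid g.support) :
    extend Ψ (HahnSeries.single a 1 * g) =
      φ.mapSeries g * Ψ a + HahnSeries.single (φ.toLinearMap a) 1 * extend Ψ g := by
  have h1 : extend Ψ (HahnSeries.single a 1 * g) = gsum fun b => g.coeff b • Ψ (a + b) := by
    refine gsum_eq_of_injective (a + ·) (add_right_injective a) (fun b => ?_) fun j hj => ?_
    · rw [add_comm a b, HahnSeries.coeff_single_mul_add, one_mul]
    · exact absurd ⟨j - a, add_sub_cancel a j⟩ hj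
  rw [h1]
  refine HasGridSum.gsum_eq ?_
  have h2 := ((φ.hasGridSum_single hg).mul_right hgrid).add
    ((hΨ.hasGridSum hg).mul_left (isGrid_single (φ.toLinearMap a) 1))
  simpa only [hadd, series_smul_mul, series_mul_smul, series_smul_add] using h2

/-- The Leibniz rule for a monomial times g is `extend_single_mul`; summing over the terms of f
gives the general case. -/
theorem extend_deriv_mul (φ : MonoEmb V W) {δ : V → HahnSeries W ℝ}
    (hadd : ∀ a b, δ (a + b) = δ a + δ b) (hgrid : ∀ a, IsGrid (δ a).support)
    {f g : HahnSeries V ℝ} (hf : IsGrid f.support) (hg : IsGrid g.support) :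
    extend (fun γ => HahnSeries.single (φ.toLinearMap γ) 1 * δ γ) (f * g) =
      φ.mapSeries f * extend (fun γ => HahnSeries.single (φ.toLinearMap γ) 1 * δ γ) g +
      φ.mapSeries g * extend (fun γ => HahnSeries.single (φ.toLinearMap γ) 1 * δ γ) f := by
  have ht := tame_deriv φ hadd hgrid
  set Ψ : V → HahnSeries W ℝ := fun γ => HahnSeries.single (φ.toLinearMap γ) 1 * δ γ with hΨ
  have hΨg : ∀ a, IsGrid (Ψ a).support := fun a => isGrid_mul (isGrid_single _ _) (hgrid a)
  have hΨa : ∀ a b, Ψ (a + b) = HahnSeries.single (φ.toLinearMap b) 1 * Ψ a +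
      HahnSeries.single (φ.toLinearMap a) 1 * Ψ b := by
    intro a b
    simp only [hΨ]
    rw [map_add, hadd, ← mul_assoc, ← mul_assoc, HahnSeries.single_mul_single,
      HahnSeries.single_mul_single, one_mul, mul_add, add_comm (φ.toLinearMap b)]
  -- Strong additivity permits term by term differentiation of the expansion of f * g along the
  -- monomials of f.
  have h1 := ht.hasGridSum_extend (hasGridSum_mul_single hf hg)
  refine h1.unique ?_
  have h2 := (((φ.hasGridSum_single hf).mul_right (ht.extendable.hasGridSum hg).isGrid).add
    ((ht.extendable.hasGridSum hf).mul_left (φ.isGrid_mapSeries hg)))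
  have h3 : ∀ a, extend Ψ (f.coeff a • (HahnSeries.single a (1 : ℝ) * g)) =
      f.coeff a • HahnSeries.single (φ.toLinearMap a) (1 : ℝ) * extend Ψ g +
        φ.mapSeries g * (f.coeff a • Ψ a) := by
    intro a
    rw [ht.extendable.smul (isGrid_mul (isGrid_single _ _) hg),
      extend_single_mul φ ht.extendable a (hΨg a) (hΨa a) hg, series_smul_add, series_smul_mul,
      series_mul_smul, add_comm]
  simpa only [h3] using h2

end Deriv

/-! ### The derivative of log-free transseries -/

/-- The logarithmic derivative of the monomials of level at most `n`. -/
def logDeriv : (n : ℕ) → G n → HahnSeries TM ℝ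
  | 0, γ => HahnSeries.single (xM 1) (-G.powExponent γ)
  | n + 1, γ => HahnSeries.single (xM 1) (-G.xExponent γ) -
      extend (fun v => HahnSeries.single ((ι n).toLinearMap v) 1 * logDeriv n v)
        (ofLex (G.largePart γ).1)

theorem logDeriv_incl (n : ℕ) (γ : G n) :
    logDeriv (n + 1) ((incl n).toLinearMap γ) = logDeriv n γ := by
  induction n with
  | zero =>
    change HahnSeries.single (xM 1) (-G.powExponent γ) -
      extend (fun v => HahnSeries.single ((ι 0).toLinearMap v) 1 * logDeriv 0 v)
        (0 : HahnSeries (G 0) ℝ) = HahnSeries.single (xM 1) (-G.powExponent γ)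
    rw [extend_zero, sub_zero]
  | succ n ih =>
    change HahnSeries.single (xM 1) (-G.xExponent γ) -
      extend (fun v => HahnSeries.single ((ι (n + 1)).toLinearMap v) 1 * logDeriv (n + 1) v)
        ((incl n).mapSeries (ofLex (G.largePart γ).1)) = _
    rw [extend_mapSeries]
    simp only [ih, ι_succ]
    rfl

/-- The logarithmic derivative of transmonomials. -/
def tlogDeriv : TM → HahnSeries TM ℝ := Lim.lift logDeriv

theorem tlogDeriv_ι (n : ℕ) (γ : G n) : tlogDeriv ((ι n).toLinearMap γ) = logDeriv n γ :=
  Lim.lift_of logDeriv_incl n γ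

/-- The derivative, taken term by term. -/
def deriv (f : HahnSeries TM ℝ) : HahnSeries TM ℝ :=
  extend (fun v => HahnSeries.single v 1 * tlogDeriv v) f

theorem deriv_ι (n : ℕ) (f : HahnSeries (G n) ℝ) : deriv ((ι n).mapSeries f) =
    extend (fun v => HahnSeries.single ((ι n).toLinearMap v) 1 * logDeriv n v) f := by
  rw [deriv, extend_mapSeries]
  simp only [tlogDeriv_ι]

theorem single_xM_mem_level (n : ℕ) (σ c : ℝ) : HahnSeries.single (xM σ) c ∈ level n := by
  rw [← ι_xMono n]
  exact single_mem_level _ _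

/-- Additivity and the bound on the level are proved together, as both are needed to differentiate
the exponents at the next level. -/
theorem logDeriv_spec (n : ℕ) : (∀ a b : G n, logDeriv n (a + b) = logDeriv n a + logDeriv n b) ∧
    ∀ a, logDeriv n a ∈ level n := by
  induction n with
  | zero =>
    refine ⟨fun a b => ?_, fun a => single_xM_mem_level _ _ _⟩
    have h : -G.powExponent (a + b) = -G.powExponent a + -G.powExponent b :=
      neg_add (G.powExponent a) (G.powExponent b)
    change HahnSeries.single (xM 1) (-G.powExponent (a + b)) = _
    rw [h, HahnSeries.single_add]
    rfl
  | succ n ih =>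
    obtain ⟨ih1, ih2⟩ := ih
    have ht := (tame_deriv (ι n) ih1 fun a => isGrid_of_mem_level (ih2 a)).extendable
    refine ⟨fun a b => ?_, fun a => sub_mem (single_xM_mem_level _ _ _) (level_mono n.le_succ ?_)⟩
    · have h : -G.xExponent (a + b) = -G.xExponent a + -G.xExponent b :=
        neg_add (G.xExponent a) (G.xExponent b)
      have h' := ht.add (G.largePart a).2.1 (G.largePart b).2.1
      change HahnSeries.single (xM 1) (-G.xExponent (a + b)) -
        extend _ (ofLex (G.largePart a).1 + ofLex (G.largePart b).1) = _
      rw [h, HahnSeries.single_add, h', add_sub_add_comm]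
      rfl
    · exact (ht.hasGridSum (G.largePart a).2.1).mem_level fun v =>
        (level n).smul_mem (mul_mem (single_mem_level _ _) (ih2 v)) _

theorem extendable_deriv (n : ℕ) : Extendable fun v : G n =>
    HahnSeries.single ((ι n).toLinearMap v) 1 * logDeriv n v :=
  (tame_deriv (ι n) (logDeriv_spec n).1 fun a =>
    isGrid_of_mem_level ((logDeriv_spec n).2 a)).extendable

theorem deriv_mem_level {n : ℕ} {f : HahnSeries TM ℝ} (hf : f ∈ level n) : deriv f ∈ level n := by
  obtain ⟨f, rfl⟩ := mem_level.1 hf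
  rw [deriv_ι]
  exact ((extendable_deriv n).hasGridSum f.2).mem_level fun v =>
    (level n).smul_mem (mul_mem (single_mem_level _ _) ((logDeriv_spec n).2 v)) _

theorem deriv_add {f g : HahnSeries TM ℝ} (hf : LogFree f) (hg : LogFree g) :
    deriv (f + g) = deriv f + deriv g := by
  obtain ⟨n, h1, h2⟩ := hf.common hg
  obtain ⟨f, rfl⟩ := mem_level.1 h1
  obtain ⟨g, rfl⟩ := mem_level.1 h2
  rw [← MonoEmb.mapSeries_add, deriv_ι, deriv_ι, deriv_ι, (extendable_deriv n).add f.2 g.2]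

theorem deriv_smul {f : HahnSeries TM ℝ} (hf : LogFree f) (c : ℝ) :
    deriv (c • f) = c • deriv f := by
  obtain ⟨n, h1⟩ := hf
  obtain ⟨f, rfl⟩ := mem_level.1 h1
  rw [← MonoEmb.mapSeries_smul, deriv_ι, deriv_ι, (extendable_deriv n).smul f.2]

theorem deriv_mul {f g : HahnSeries TM ℝ} (hf : LogFree f) (hg : LogFree g) :
    deriv (f * g) = f * deriv g + g * deriv f := by
  obtain ⟨n, h1, h2⟩ := hf.common hg
  obtain ⟨f, rfl⟩ := mem_level.1 h1
  obtain ⟨g, rfl⟩ := mem_level.1 h2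
  rw [← MonoEmb.mapSeries_mul, deriv_ι, deriv_ι, deriv_ι]
  exact extend_deriv_mul (ι n) (logDeriv_spec n).1
    (fun a => isGrid_of_mem_level ((logDeriv_spec n).2 a)) f.2 g.2

/-- As for `isComp_iff`: the auxiliary derivatives d γ are determined by induction, and sums are
tested after embedding in `TM`. -/
theorem isDeriv_iff {n : ℕ} {f g : T n} :
    IsDeriv n f g ↔ (ι n).mapSeries g.1 = deriv ((ι n).mapSeries f.1) := by
  induction n with
  | zero =>
    rw [deriv_ι, ← (extendable_deriv 0).hasGridSum_iff f.2, IsDeriv, ← (ι 0).hasGridSum_map_iff]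
    simp only [MonoEmb.mapSeries_smul, MonoEmb.mapSeries_mul, MonoEmb.mapSeries_single, ι_xMono]
    rfl
  | succ n ih =>
    rw [deriv_ι, ← (extendable_deriv (n + 1)).hasGridSum_iff f.2]
    have key : ∀ d : G (n + 1) → T n,
        (∀ γ, IsDeriv n (largeSeries.toGrid (G.largePart γ)) (d γ)) →
        ∀ γ, (ι (n + 1)).mapSeries (f.1.coeff γ • (HahnSeries.single γ (1 : ℝ) *
          (HahnSeries.single (xMono (n + 1) 1) (-G.xExponent γ) - (T.lift (d γ)).1))) =
          f.1.coeff γ • (HahnSeries.single ((ι (n + 1)).toLinearMap γ) 1 * logDeriv (n + 1) γ) := by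
      intro d hd γ
      have h1 := ih.1 (hd γ)
      have h2 : (ι (n + 1)).mapSeries (T.lift (d γ)).1 = (ι n).mapSeries (d γ).1 :=
        ι_mapSeries_succ n _
      rw [deriv_ι] at h1
      rw [MonoEmb.mapSeries_smul, MonoEmb.mapSeries_mul, sub_eq_add_neg, MonoEmb.mapSeries_add,
        MonoEmb.mapSeries_neg, MonoEmb.mapSeries_single, MonoEmb.mapSeries_single, ι_xMono, h2, h1,
        ← sub_eq_add_neg]
      rfl
    constructor
    · rintro ⟨d, hd, hsum⟩
      have := (ι (n + 1)).hasGridSum_map_iff.2 hsum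
      simp only [key d hd] at this
      exact this
    · intro hsum
      have hex : ∀ γ : G (n + 1), ∃ d : T n, IsDeriv n (largeSeries.toGrid (G.largePart γ)) d :=
        fun γ => by
          obtain ⟨d, hd⟩ := mem_level.1
            (deriv_mem_level (ι_mem_level (largeSeries.toGrid (G.largePart γ))))
          exact ⟨d, ih.2 hd⟩
      choose d hd using hex
      refine ⟨d, hd, (ι (n + 1)).hasGridSum_map_iff.1 ?_⟩
      simp only [key d hd]
      exact hsum

theorem exists_isDeriv {n : ℕ} (f : T n) : ∃ g, IsDeriv n f g := by
  obtain ⟨g, hg⟩ := mem_level.1 (deriv_mem_level (ι_mem_level f))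
  exact ⟨g, isDeriv_iff.2 hg⟩

theorem tlogDeriv_expM_add {L : HahnSeries TM ℝ} (hL : IsLarge L) (σ : ℝ) :
    tlogDeriv (expM L + xM σ) = HahnSeries.single (xM 1) (-σ) - deriv L := by
  obtain ⟨k, L, rfl⟩ := hL
  rw [expM_ιL, ← ι_mono, tlogDeriv_ι, ιL, deriv_ι]
  rfl

theorem tlogDeriv_expM {L : HahnSeries TM ℝ} (hL : IsLarge L) :
    tlogDeriv (expM L) = -deriv L := by
  have := tlogDeriv_expM_add hL 0
  rwa [xM_zero, add_zero, neg_zero, HahnSeries.single_eq_zero, zero_sub] at this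

theorem deriv_Xs : deriv Xs = 1 := by
  rw [← ι_X, deriv_ι]
  refine (extend_single _ (fun v => isGrid_mul (isGrid_single _ _)
    (isGrid_of_mem_level ((logDeriv_spec 0).2 v))) _ _).trans ?_
  change (1 : ℝ) • (HahnSeries.single (xM (-1)) (1 : ℝ) * HahnSeries.single (xM 1) (-(-1 : ℝ))) = 1
  rw [HahnSeries.single_mul_single, ← xM_add, neg_add_cancel, xM_zero, one_mul, neg_neg]
  exact one_smul ℝ _

theorem deriv_smul_Xs (σ : ℝ) : deriv (σ • Xs) = HahnSeries.single 0 σ := by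
  rw [deriv_smul logFree_Xs, deriv_Xs, ← HahnSeries.C_mul_eq_smul, mul_one]
  rfl

theorem series_mul_neg {V : OrdVec} (f g : HahnSeries V ℝ) : f * -g = -(f * g) := by
  rw [← series_neg_one_smul, series_mul_smul, series_neg_one_smul]

/-- `D (f ∘ exp) = exp x · (D f ∘ exp)`. -/
theorem deriv_E {f : HahnSeries TM ℝ} (hf : LogFree f) :
    deriv (E.mapSeries f) = texp Xs * E.mapSeries (deriv f) := by
  have htexp : texp Xs = HahnSeries.single (expM (-Xs)) 1 := texp_of_isLarge ⟨0, isLargeAt_Xs⟩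
  -- The factor exp x cancels (σ/x) ∘ exp = σ exp(-x).
  have hpow : ∀ σ : ℝ, texp Xs * E.mapSeries (HahnSeries.single (xM 1) σ) =
      HahnSeries.single 0 σ := fun σ => by
    have h := E_expM_add isLarge_zero 1
    rw [expM_zero, zero_add, show E.mapSeries (0 : HahnSeries TM ℝ) = 0 from map_zero E.mapAlg,
      zero_add, show (1 : ℝ) • Xs = Xs from one_smul ℝ Xs] at h
    rw [htexp, E.mapSeries_single, HahnSeries.single_mul_single, h,
      expM_neg ⟨0, isLargeAt_Xs⟩, neg_add_cancel, one_mul]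
  -- The identity for the monomials of level n implies it for series of level n. The induction on n
  -- alternates this with the formula for the exponents.
  have step : ∀ n, (∀ γ : G n, tlogDeriv (E.toLinearMap ((ι n).toLinearMap γ)) =
      texp Xs * E.mapSeries (logDeriv n γ)) → ∀ f : HahnSeries (G n) ℝ, IsGrid f.support →
      deriv (E.mapSeries ((ι n).mapSeries f)) =
        texp Xs * E.mapSeries (deriv ((ι n).mapSeries f)) := by
    intro n hn f hf
    rw [deriv_ι, deriv, extend_mapSeries, extend_mapSeries]
    refine HasGridSum.gsum_eq ?_
    have := (E.hasGridSum_map_iff.2 ((extendable_deriv n).hasGridSum hf)).mul_left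
      (logFree_Xs.texp.isGrid)
    simpa only [hn, E.mapSeries_smul, E.mapSeries_mul, E.mapSeries_single, series_mul_smul,
      mul_left_comm (texp Xs)] using this
  have key : ∀ n, ∀ γ : G n, tlogDeriv (E.toLinearMap ((ι n).toLinearMap γ)) =
      texp Xs * E.mapSeries (logDeriv n γ) := by
    intro n
    induction n with
    | zero =>
      intro γ
      rw [E_ι]
      change tlogDeriv (expM (G.powExponent γ • Xs)) = _
      rw [tlogDeriv_expM (isLarge_smul_Xs _), deriv_smul_Xs, logDeriv, hpow]
      exact (HahnSeries.single_neg _ _).symm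
    | succ n ih =>
      intro γ
      have hl : IsLarge (ιL (G.largePart γ)) := ⟨n, _, rfl⟩
      rw [exists_expM_of_level, E_expM_add hl, tlogDeriv_expM (hl.E.add (isLarge_smul_Xs _)),
        deriv_add hl.E.logFree (isLarge_smul_Xs _).logFree, deriv_smul_Xs, ιL,
        step n ih _ (G.largePart γ).2.1, logDeriv, ← deriv_ι, sub_eq_add_neg, E.mapSeries_add,
        mul_add, hpow, E.mapSeries_neg, HahnSeries.single_neg, series_mul_neg]
      exact neg_add_rev _ _
  obtain ⟨n, hn⟩ := hf
  obtain ⟨f, rfl⟩ := mem_level.1 hn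
  exact step n (key n) f.1 f.2

/-! ### General transseries as series -/

/-- The group of general transmonomials: the direct limit of the compositions with the
exponential. -/
def KM : OrdVec := Lim.lim (V := fun _ => TM) fun _ => E

/-- The embedding `𝔪 ↦ 𝔪 ∘ L_p`. -/
def κ (p : ℕ) : MonoEmb TM KM := Lim.of (V := fun _ => TM) (fun _ => E) p

theorem κ_E (p : ℕ) (f : HahnSeries TM ℝ) :
    (κ (p + 1)).mapSeries (E.mapSeries f) = (κ p).mapSeries f := by
  rw [← MonoEmb.mapSeries_comp]
  congr 1
  exact MonoEmb.ext fun v => Lim.of_succ (V := fun _ => TM) (fun _ => E) p v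

/-- `f ↦ f ∘ L_p`, as a homomorphism. -/
def valHom (n p : ℕ) : T n →ₐ[ℝ] HahnSeries KM ℝ :=
  ((κ p).mapAlg.comp (ι n).mapAlg).comp (gridSeries (G n)).val

/-- A general transseries as a series of general transmonomials. -/
def val : GeneralTransseries → HahnSeries KM ℝ :=
  Quot.lift (fun c => (κ c.p).mapSeries ((ι c.n).mapSeries c.f.1)) fun _ _ h => by
    induction h with
    | lift n p f => exact congrArg (κ p).mapSeries (ι_mapSeries_succ n f.1).symm
    | log n p f g h =>
      dsimp only
      rw [isComp_expX_iff.1 h, κ_E]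

theorem val_compLog (n p : ℕ) (f : T n) :
    val (compLog n p f) = (κ p).mapSeries ((ι n).mapSeries f.1) := rfl

theorem compLog_lift_le {n m : ℕ} (h : n ≤ m) (p : ℕ) (f : T n) :
    ∃ f' : T m, compLog n p f = compLog m p f' := by
  induction m, h using Nat.le_induction with
  | base => exact ⟨f, rfl⟩
  | succ m _ ih =>
    obtain ⟨f', h'⟩ := ih
    exact ⟨f'.lift, h'.trans (Quot.sound (.lift m p f'))⟩

theorem compLog_log_le {p q : ℕ} (h : p ≤ q) {n : ℕ} (f : T n) :
    ∃ (m : ℕ) (f' : T m), compLog n p f = compLog m q f' := by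
  induction q, h using Nat.le_induction with
  | base => exact ⟨n, f, rfl⟩
  | succ q _ ih =>
    obtain ⟨m, f', h'⟩ := ih
    obtain ⟨g, hg⟩ := exists_isComp f' largePos_expX
    exact ⟨_, g, h'.trans (Quot.sound (.log m q f' g hg))⟩

theorem exists_compLog (A : GeneralTransseries) : ∃ (n p : ℕ) (f : T n), A = compLog n p f := by
  induction A using Quot.ind with
  | mk c => exact ⟨c.n, c.p, c.f, rfl⟩

/-- The logarithmic depths are made equal first, since this raises the levels; the levels are then
equalised without touching the depth. -/
theorem exists_compLog₂ (A B : GeneralTransseries) : ∃ (n p : ℕ) (f g : T n),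
    A = compLog n p f ∧ B = compLog n p g := by
  obtain ⟨n, p, f, rfl⟩ := exists_compLog A
  obtain ⟨m, q, g, rfl⟩ := exists_compLog B
  obtain ⟨n', f', hf⟩ := compLog_log_le (le_max_left p q) f
  obtain ⟨m', g', hg⟩ := compLog_log_le (le_max_right p q) g
  obtain ⟨f'', hf'⟩ := compLog_lift_le (le_max_left n' m') (max p q) f'
  obtain ⟨g'', hg'⟩ := compLog_lift_le (le_max_right n' m') (max p q) g'
  exact ⟨_, _, f'', g'', hf.trans hf', hg.trans hg'⟩

/-- After reduction to a common level and depth, only the injectivity of the two embeddings `ι n`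
and `κ p` is needed. -/
theorem val_injective : Function.Injective val := by
  intro A B h
  obtain ⟨n, p, f, g, rfl, rfl⟩ := exists_compLog₂ A B
  congr 1
  exact Subtype.ext ((ι n).mapSeries_injective ((κ p).mapSeries_injective h))

/-- The field of series that represent general transseries. -/
def valRange : Subfield (HahnSeries KM ℝ) where
  carrier := Set.range val
  mul_mem' := by
    rintro _ _ ⟨A, rfl⟩ ⟨B, rfl⟩
    obtain ⟨n, p, f, g, rfl, rfl⟩ := exists_compLog₂ A B
    exact ⟨compLog n p (f * g), map_mul (valHom n p) f g⟩
  one_mem' := ⟨compLog 0 0 1, map_one (valHom 0 0)⟩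
  add_mem' := by
    rintro _ _ ⟨A, rfl⟩ ⟨B, rfl⟩
    obtain ⟨n, p, f, g, rfl, rfl⟩ := exists_compLog₂ A B
    exact ⟨compLog n p (f + g), map_add (valHom n p) f g⟩
  zero_mem' := ⟨compLog 0 0 0, map_zero (valHom 0 0)⟩
  neg_mem' := by
    rintro _ ⟨A, rfl⟩
    obtain ⟨n, p, f, rfl⟩ := exists_compLog A
    exact ⟨compLog n p (-f), map_neg (valHom n p) f⟩
  inv_mem' := by
    rintro _ ⟨A, rfl⟩
    obtain ⟨n, p, f, rfl⟩ := exists_compLog A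
    exact ⟨compLog n p ⟨f.1⁻¹, isGrid_inv f.2⟩,
      map_inv₀ ((κ p).mapAlg.comp (ι n).mapAlg) f.1⟩

/-- General transseries are the elements of a field of series. -/
def valEquiv : GeneralTransseries ≃ valRange := Equiv.ofInjective val val_injective

instance : Field GeneralTransseries := valEquiv.field

/-- A general transseries as a series, as a homomorphism. -/
def valRingHom : GeneralTransseries →+* HahnSeries KM ℝ :=
  valRange.subtype.comp valEquiv.ringEquiv.toRingHom

theorem valRingHom_apply (A : GeneralTransseries) : valRingHom A = val A := rfl

instance : LinearOrder GeneralTransseries :=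
  LinearOrder.lift' (fun A => toLex (val A)) val_injective

instance : IsStrictOrderedRing GeneralTransseries :=
  Function.Injective.isStrictOrderedRing (fun A => toLex (val A)) (map_zero valRingHom)
    (map_one valRingHom) (map_add valRingHom) (map_mul valRingHom) Iff.rfl Iff.rfl

theorem compLog_add (n p : ℕ) (f g : T n) :
    compLog n p f + compLog n p g = compLog n p (f + g) :=
  val_injective ((map_add valRingHom _ _).trans (map_add (valHom n p) f g).symm)

theorem compLog_mul (n p : ℕ) (f g : T n) :
    compLog n p f * compLog n p g = compLog n p (f * g) :=
  val_injective ((map_mul valRingHom _ _).trans (map_mul (valHom n p) f g).symm)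

theorem compLog_pos_iff (n p : ℕ) (f : T n) : 0 < compLog n p f ↔ 0 < f.1.leadingCoeff := by
  rw [← ((ι n).order_leadingCoeff f.1).2, ← ((κ p).order_leadingCoeff _).2, ← val_compLog]
  refine Iff.trans ?_ HahnSeries.leadingCoeff_pos_iff.symm
  change toLex (val 0) < toLex (val (compLog n p f)) ↔ _
  rw [← valRingHom_apply, map_zero]
  rfl

/-! ### The derivation -/

theorem E_Xs : E.mapSeries Xs = texp Xs := by
  have h := circ_smul_Xs logFree_Xs.texp (order_texp_neg logFree_Xs LP_Xs) 1
  rw [← circ_expX logFree_Xs]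
  rwa [show (1 : ℝ) • Xs = Xs from one_smul ℝ Xs, show (1 : ℝ) • texp Xs = texp Xs from
    one_smul ℝ _] at h

theorem iterLog_ne_zero (p : ℕ) : iterLog p ≠ 0 := by
  have h : 0 < iterLog p := (compLog_pos_iff 0 p X).2 (by
    rw [X, HahnSeries.leadingCoeff_of_single]
    exact one_pos)
  exact h.ne'

/-- The derivative of a log-free transseries. -/
def T.deriv {n : ℕ} (f : T n) : T n := (exists_isDeriv f).choose

theorem T.isDeriv {n : ℕ} (f : T n) : IsDeriv n f f.deriv := (exists_isDeriv f).choose_spec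

theorem val_compLog_deriv (n p : ℕ) (f : T n) : val (compLog n p f.deriv) =
    (κ p).mapSeries (Transseries.deriv ((ι n).mapSeries f.1)) := by
  rw [val_compLog, isDeriv_iff.1 f.isDeriv]

/-- The derivative of a general transseries. -/
def D : GeneralTransseries → GeneralTransseries :=
  Quot.lift (fun c => (∏ k ∈ Finset.range c.p, iterLog k)⁻¹ * compLog c.n c.p c.f.deriv)
    fun _ _ h => by
      induction h with
      | lift n p f =>
        refine congrArg _ (val_injective ?_)
        rw [val_compLog_deriv, val_compLog_deriv]
        exact congrArg (fun g => (κ p).mapSeries (Transseries.deriv g))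
          (ι_mapSeries_succ n f.1).symm
      | log n p f g h =>
        dsimp only
        -- By `deriv_E` the derivative of f ∘ exp carries a factor exp x, and exp x ∘ L_(p+1) = L_p.
        -- This cancels the extra factor L_p in the longer product.
        have h1 : compLog (1 + n) (p + 1) g.deriv = iterLog p * compLog n p f.deriv := by
          refine val_injective (Eq.trans ?_ (map_mul valRingHom _ _).symm)
          rw [valRingHom_apply, valRingHom_apply, val_compLog_deriv, val_compLog_deriv, iterLog,
            val_compLog, isComp_expX_iff.1 h, deriv_E ⟨n, ι_mem_level f⟩, MonoEmb.mapSeries_mul,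
            κ_E, ι_X, ← E_Xs, κ_E]
        rw [h1, Finset.prod_range_succ, mul_inv, mul_assoc,
          inv_mul_cancel_left₀ (iterLog_ne_zero p)]

theorem D_compLog (n p : ℕ) (f : T n) : D (compLog n p f) =
    (∏ k ∈ Finset.range p, iterLog k)⁻¹ * compLog n p f.deriv := rfl

theorem D_add (A B : GeneralTransseries) : D (A + B) = D A + D B := by
  obtain ⟨n, p, f, g, rfl, rfl⟩ := exists_compLog₂ A B
  rw [compLog_add, D_compLog, D_compLog, D_compLog, ← mul_add]
  refine congrArg _ (val_injective ?_)
  rw [← valRingHom_apply (_ + _), map_add, valRingHom_apply, valRingHom_apply, val_compLog_deriv,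
    val_compLog_deriv, val_compLog_deriv, ← MonoEmb.mapSeries_add,
    ← deriv_add ⟨n, ι_mem_level f⟩ ⟨n, ι_mem_level g⟩, ← MonoEmb.mapSeries_add]
  rfl

theorem D_mul (A B : GeneralTransseries) : D (A * B) = A * D B + B * D A := by
  obtain ⟨n, p, f, g, rfl, rfl⟩ := exists_compLog₂ A B
  rw [compLog_mul, D_compLog, D_compLog, D_compLog, mul_left_comm, mul_left_comm (compLog n p g),
    ← mul_add]
  refine congrArg _ (val_injective ?_)
  rw [← valRingHom_apply (_ + _), map_add, map_mul, map_mul, valRingHom_apply, valRingHom_apply,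
    valRingHom_apply, valRingHom_apply, val_compLog_deriv, val_compLog_deriv, val_compLog_deriv,
    val_compLog, val_compLog, ← MonoEmb.mapSeries_mul, ← MonoEmb.mapSeries_mul,
    ← MonoEmb.mapSeries_add, ← deriv_mul ⟨n, ι_mem_level f⟩ ⟨n, ι_mem_level g⟩,
    ← MonoEmb.mapSeries_mul]
  rfl

/-- The derivation of general transseries. -/
def derivation : Derivation ℤ GeneralTransseries GeneralTransseries :=
  Derivation.mk' (AddMonoidHom.mk' D D_add).toIntLinearMap D_mul

/-! ### Representatives of general transseries -/

/-- `A = a ∘ L_p`, with `a` log-free. -/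
def Rep (p : ℕ) (a : HahnSeries TM ℝ) (A : GeneralTransseries) : Prop :=
  LogFree a ∧ val A = (κ p).mapSeries a

theorem rep_compLog (n p : ℕ) (f : T n) : Rep p ((ι n).mapSeries f.1) (compLog n p f) :=
  ⟨⟨n, ι_mem_level f⟩, rfl⟩

theorem Rep.unique {p : ℕ} {a b : HahnSeries TM ℝ} {A : GeneralTransseries} (ha : Rep p a A)
    (hb : Rep p b A) : a = b :=
  (κ p).mapSeries_injective (ha.2.symm.trans hb.2)

theorem Rep.eq {p : ℕ} {a : HahnSeries TM ℝ} {A B : GeneralTransseries} (hA : Rep p a A)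
    (hB : Rep p a B) : A = B :=
  val_injective (hA.2.trans hB.2.symm)

theorem Rep.exists_compLog {p : ℕ} {a : HahnSeries TM ℝ} {A : GeneralTransseries}
    (h : Rep p a A) {n : ℕ} (hn : a ∈ level n) :
    ∃ f : T n, (ι n).mapSeries f.1 = a ∧ A = compLog n p f := by
  obtain ⟨f, rfl⟩ := mem_level.1 hn
  exact ⟨f, rfl, h.eq (rep_compLog n p f)⟩

theorem LogFree.exists_rep {a : HahnSeries TM ℝ} (h : LogFree a) (p : ℕ) : ∃ A, Rep p a A := by
  obtain ⟨n, hn⟩ := h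
  obtain ⟨f, rfl⟩ := mem_level.1 hn
  exact ⟨_, rep_compLog n p f⟩

theorem Rep.E {p : ℕ} {a : HahnSeries TM ℝ} {A : GeneralTransseries} (h : Rep p a A) :
    Rep (p + 1) (E.mapSeries a) A :=
  ⟨h.1.E, h.2.trans (κ_E p a).symm⟩

theorem Rep.iterate {p : ℕ} {a : HahnSeries TM ℝ} {A : GeneralTransseries} (h : Rep p a A)
    (k : ℕ) : Rep (p + k) (Transseries.E.mapSeries^[k] a) A := by
  induction k with
  | zero => exact h
  | succ k ih =>
    rw [Function.iterate_succ_apply']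
    exact ih.E

theorem exists_rep₂ (A B : GeneralTransseries) : ∃ p a b, Rep p a A ∧ Rep p b B := by
  obtain ⟨n, p, f, g, rfl, rfl⟩ := exists_compLog₂ A B
  exact ⟨p, _, _, rep_compLog n p f, rep_compLog n p g⟩

/-! ### Exponentials and iterated logarithms -/

theorem iterate_E_texp {a : HahnSeries TM ℝ} (h : LogFree a) (k : ℕ) :
    LogFree (E.mapSeries^[k] a) ∧ E.mapSeries^[k] (texp a) = texp (E.mapSeries^[k] a) := by
  induction k with
  | zero => exact ⟨h, rfl⟩
  | succ k ih =>
    simp only [Function.iterate_succ_apply']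
    exact ⟨ih.1.E, by rw [ih.2, E_texp ih.1]⟩

theorem isGenExp_of_rep {p : ℕ} {a : HahnSeries TM ℝ} {Y Z : GeneralTransseries}
    (hY : Rep p a Y) (hZ : Rep p (texp a) Z) : IsGenExp Y Z := by
  obtain ⟨n, hn⟩ := hY.1
  obtain ⟨f, rfl, rfl⟩ := hY.exists_compLog hn
  obtain ⟨h, hh, rfl⟩ := hZ.exists_compLog (texp_mem_level hn)
  exact .mk n p f h (isExp_iff.2 hh)

/-- The relation may have been produced at another depth q. Both representatives are compared at
depth p + q, where iterates of `E` commute with the exponential. -/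
theorem IsGenExp.rep {Y Z : GeneralTransseries} (h : IsGenExp Y Z) {p : ℕ}
    {a : HahnSeries TM ℝ} (hY : Rep p a Y) : Rep p (texp a) Z := by
  obtain ⟨n, q, f, h, hfh⟩ := h
  have h1 := (rep_compLog n q f).iterate p
  have h2 := hY.iterate q
  rw [add_comm p q] at h2
  have h3 := (rep_compLog (n + 1) q h).iterate p
  rw [isExp_iff.1 hfh, (iterate_E_texp ⟨n, ι_mem_level f⟩ p).2, h1.unique h2,
    ← (iterate_E_texp hY.1 q).2] at h3
  obtain ⟨Z, hZ⟩ := hY.1.texp.exists_rep p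
  have h4 := hZ.iterate q
  rw [add_comm p q] at h4
  exact h3.eq h4 ▸ hZ

theorem IsGenExp.injective {Y Y' Z : GeneralTransseries} (h : IsGenExp Y Z)
    (h' : IsGenExp Y' Z) : Y = Y' := by
  obtain ⟨p, a, b, ha, hb⟩ := exists_rep₂ Y Y'
  have := texp_injective ha.1 hb.1 ((h.rep ha).unique (h'.rep hb))
  exact ha.eq (this ▸ hb)

theorem IsIterLog.unique {p : ℕ} {B Y Y' : GeneralTransseries} (h : IsIterLog p B Y)
    (h' : IsIterLog p B Y') : Y = Y' := by
  induction p generalizing Y Y' with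
  | zero => exact Eq.trans h (Eq.symm h')
  | succ p ih =>
    obtain ⟨Z, hZ, hY⟩ := h
    obtain ⟨Z', hZ', hY'⟩ := h'
    exact hY.injective (ih hZ hZ' ▸ hY')

/-- The logarithm is found at depth p + 1, where b is replaced by b ∘ exp. It is again large and
positive, so the construction can be iterated. -/
theorem Rep.exists_log {p : ℕ} {b : HahnSeries TM ℝ} {Z : GeneralTransseries} (h : Rep p b Z)
    (hb : LP b) : ∃ Y y, IsGenExp Y Z ∧ Rep (p + 1) y Y ∧ LP y ∧
      texp y = Transseries.E.mapSeries b := by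
  obtain ⟨y, h1, h2, h3⟩ := exists_texp_eq h.1 hb
  obtain ⟨Y, hY⟩ := h1.exists_rep (p + 1)
  exact ⟨Y, y, isGenExp_of_rep hY (h3 ▸ h.E), hY, h2, h3⟩

theorem exists_isIterLog {q : ℕ} {b : HahnSeries TM ℝ} {B : GeneralTransseries} (h : Rep q b B)
    (hb : LP b) (p : ℕ) : ∃ Y r y, IsIterLog p B Y ∧ Rep r y Y ∧ LP y := by
  induction p with
  | zero => exact ⟨B, q, b, rfl, h, hb⟩
  | succ p ih =>
    obtain ⟨Z, r, z, hZ, hz, hz'⟩ := ih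
    obtain ⟨Y, y, h1, h2, h3, -⟩ := hz.exists_log hz'
    exact ⟨Y, r + 1, y, ⟨Z, hZ, h1⟩, h2, h3⟩

/-! ### Composition of general transseries -/

/-- `C = A ∘ B`, computed from a representative of `A` as `a ∘ L_p`. -/
def CompRep (p : ℕ) (A B C : GeneralTransseries) : Prop :=
  ∃ a Y q g, Rep p a A ∧ IsIterLog p B Y ∧ Rep q g Y ∧ LP g ∧ Rep q (circ a g) C

theorem IsGenComp.exists_compRep {A B C : GeneralTransseries} (h : IsGenComp A B C) :
    ∃ p, CompRep p A B C := by
  obtain ⟨n, p, f, B, m, q, g, c, hB, hg, hc⟩ := h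
  exact ⟨p, _, _, q, _, rep_compLog n p f, hB, rep_compLog m q g, hg.LP,
    (isComp_iff hg).1 hc ▸ rep_compLog (m + n) q c⟩

theorem largePos_of_LP {m : ℕ} {g : T m} (h : LP ((ι m).mapSeries g.1)) : LargePos g := by
  obtain ⟨h1, h2⟩ := (ι m).order_leadingCoeff g.1
  rw [LP, h1, h2] at h
  exact ⟨(ι m).neg_iff.1 h.1, h.2⟩

theorem CompRep.isGenComp {p : ℕ} {A B C : GeneralTransseries} (h : CompRep p A B C) :
    IsGenComp A B C := by
  obtain ⟨a, Y, q, g, hA, hY, hg, hLP, hC⟩ := h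
  obtain ⟨n, hn⟩ := hA.1
  obtain ⟨m, hm⟩ := hg.1
  obtain ⟨f, rfl, rfl⟩ := hA.exists_compLog hn
  obtain ⟨g, rfl, rfl⟩ := hg.exists_compLog hm
  obtain ⟨c, hc, rfl⟩ := hC.exists_compLog (circ_mem_level hn hm hLP)
  have hg' := largePos_of_LP hLP
  exact .mk n p f B m q g c hY hg' ((isComp_iff hg').2 hc)

/-- Raising the depth of A replaces a by a ∘ exp and g by a logarithm y with exp y = g ∘ exp. Then
(a ∘ exp) ∘ y = a ∘ exp y = (a ∘ g) ∘ exp, the same element C at depth q + 1. -/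
theorem CompRep.succ {p : ℕ} {A B C : GeneralTransseries} (h : CompRep p A B C) :
    CompRep (p + 1) A B C := by
  obtain ⟨a, Y, q, g, hA, hY, hg, hLP, hC⟩ := h
  obtain ⟨Y', y, h1, h2, h3, h4⟩ := hg.exists_log hLP
  refine ⟨_, Y', q + 1, y, hA.E, ⟨Y, hY, h1⟩, h2, h3, ?_⟩
  rw [circ_E hA.1 h2.1 h3, h4, ← E_circ hA.1 hg.1 hLP]
  exact hC.E

theorem CompRep.add {p : ℕ} {A B C : GeneralTransseries} (h : CompRep p A B C) (k : ℕ) :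
    CompRep (p + k) A B C := by
  induction k with
  | zero => exact h
  | succ k ih => exact ih.succ

theorem iterate_E_circ {a g : HahnSeries TM ℝ} (ha : LogFree a) (hg : LogFree g) (h : LP g)
    (k : ℕ) : LogFree (E.mapSeries^[k] g) ∧ LP (E.mapSeries^[k] g) ∧
      E.mapSeries^[k] (circ a g) = circ a (E.mapSeries^[k] g) := by
  induction k with
  | zero => exact ⟨hg, h, rfl⟩
  | succ k ih =>
    simp only [Function.iterate_succ_apply']
    exact ⟨ih.1.E, ih.2.1.E, by rw [ih.2.2, E_circ ha ih.1 ih.2.1]⟩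

/-- At a fixed p the representative of A and the iterated logarithm of B are unique. Only the depths
q and q' may differ, and `E_circ` compares the results at depth q + q'. -/
theorem CompRep.unique {p : ℕ} {A B C C' : GeneralTransseries} (h : CompRep p A B C)
    (h' : CompRep p A B C') : C = C' := by
  obtain ⟨a, Y, q, g, hA, hY, hg, hLP, hC⟩ := h
  obtain ⟨a', Y', q', g', hA', hY', hg', hLP', hC'⟩ := h'
  obtain rfl := hA.unique hA'
  obtain rfl := hY.unique hY'
  have h1 := hC.iterate q'
  have h2 := hC'.iterate q
  have h3 := hg'.iterate q
  rw [add_comm q' q] at h2 h3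
  rw [(iterate_E_circ hA.1 hg.1 hLP q').2.2] at h1
  rw [(iterate_E_circ hA.1 hg'.1 hLP' q).2.2, h3.unique (hg.iterate q')] at h2
  exact h1.eq h2

/-- Existence follows from iterated logarithms of large positive series. For uniqueness,
compositions computed at depths p and p' are both raised to p + p'. -/
theorem existsUnique_isGenComp (A : GeneralTransseries) (m q : ℕ) (g : T m) (hg : LargePos g) :
    ∃! C : GeneralTransseries, IsGenComp A (compLog m q g) C := by
  obtain ⟨n, p, f, rfl⟩ := exists_compLog A
  obtain ⟨Y, r, y, h1, h2, h3⟩ := exists_isIterLog (rep_compLog m q g) hg.LP p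
  obtain ⟨C, hC⟩ := ((rep_compLog n p f).1.circ h2.1 h3).exists_rep r
  have hC : CompRep p (compLog n p f) (compLog m q g) C :=
    ⟨_, Y, r, y, rep_compLog n p f, h1, h2, h3, hC⟩
  refine ⟨C, hC.isGenComp, fun C' hC' => ?_⟩
  obtain ⟨p', hp'⟩ := IsGenComp.exists_compRep hC'
  exact (hp'.add p).unique (add_comm p p' ▸ hC.add p')

end Transseries

end

/-! ### The field, the order, the derivation and composition assembled. -/

theorem mainTheorem6 :
    ∃ (_ : Field GeneralTransseries) (_ : LinearOrder GeneralTransseries)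
      (D : Derivation ℤ GeneralTransseries GeneralTransseries),
      IsStrictOrderedRing GeneralTransseries ∧
      (∀ A B : GeneralTransseries, ∃ (n p : ℕ) (f g : T n),
        A = compLog n p f ∧ B = compLog n p g) ∧
      (∀ (n p : ℕ) (f g : T n), compLog n p f + compLog n p g = compLog n p (f + g)) ∧
      (∀ (n p : ℕ) (f g : T n), compLog n p f * compLog n p g = compLog n p (f * g)) ∧
      (∀ (n p : ℕ) (f : T n), 0 < compLog n p f ↔ 0 < f.1.leadingCoeff) ∧
      (∀ (n p : ℕ) (f : T n), ∃ f' : T n, IsDeriv n f f' ∧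
        D (compLog n p f) = (∏ k ∈ Finset.range p, iterLog k)⁻¹ * compLog n p f') ∧
      ∀ (A : GeneralTransseries) (m q : ℕ) (g : T m), LargePos g →
        ∃! C : GeneralTransseries, IsGenComp A (compLog m q g) C :=
  ⟨inferInstance, inferInstance, derivation, inferInstance, exists_compLog₂, compLog_add,
    compLog_mul, compLog_pos_iff, fun n p f => ⟨f.deriv, f.isDeriv, D_compLog n p f⟩,
    existsUnique_isGenComp⟩
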